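/- Let $K$ be a totally real number field of degree $n=[K:\mathbb Q]>1$, with real embeddings $\sigma_1,\ldots,\sigma_n$ and ring of integers $\mathcal O_K$; write $a_i=\sigma_i(a)$ for $a\in K$. Let $\mathcal H$ be the complex upper half-plane, and let the Hilbert modular group $\Gamma_K=\mathbf{SL}_2(\mathcal O_K)$ act on $\mathcal H^n$ by \[\gamma(z)=\left(\frac{a_1z_1+b_1}{c_1z_1+d_1},\ldots,\frac{a_nz_n+b_n}{c_nz_n+d_n}\right),\qquad \gamma=\begin{pmatrix}a&b\\c&d\end{pmatrix}\in\Gamma_K .\] A holomorphic function $F:\mathcal H^n\to\mathbb C$ is called a Hilbert quasi-modular form for $\Gamma_K$ of weight $(k_1,\ldots,k_n)\in\mathbb Z^n$ and depth $s\in\mathbb N$ if there is a polynomial $P\in\mathrm{Hol}(\mathcal H^n)[X_1,\ldots,X_n]$ of total degree $s$, with coefficients holomorphic functions on $\mathcal H^n$, such that for all $z\in\mathcal H^n$ and all $\gamma\in\Gamma_K$ \[F(\gamma(z))=\prod_{i=1}^n(c_iz_i+d_i)^{k_i}\;P\!\left(\frac{c_1}{c_1z_1+d_1},\ldots,\frac{c_n}{c_nz_n+d_n}\right),\]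 where the coefficients of $P$ are evaluated at $z$ (the zero polynomial is given total degree $0$). Let $\mathcal Y(K)$ be the $\mathbb C$-algebra of functions on $\mathcal H^n$ generated by the Hilbert quasi-modular forms for $\Gamma_K$ of all weights and all depths. Then $\mathcal Y(K)$ is not finitely generated as a $\mathbb C$-algebra. -/

import Mathlib

open scoped NumberField UpperHalfPlane MatrixGroups

noncomputable section

namespace HilbertQuasiModular

variable (K : Type*) [Field K] [NumberField K]

/-- The product `ℍⁿ` of upper half planes, with one factor for each real embedding of `K`
(so `n = [K : ℚ]` when `K` is totally real). -/
abbrev PolyUpperHalfPlane : Type _ := (K →+* ℝ) → ℍ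

/-- The algebra `Hol(ℍⁿ)` of holomorphic functions `ℍⁿ → ℂ`. A function on `ℍⁿ` is read, through
`UpperHalfPlane.ofComplex` (the inverse of the inclusion `ℍ → ℂ` on points of positive imaginary
part), as a function of `n` complex variables on the open set where all imaginary parts are
positive, and must be complex differentiable there. -/
def Hol : Subalgebra ℂ (PolyUpperHalfPlane K → ℂ) where
  carrier := {F | DifferentiableOn ℂ
    (fun w : (K →+* ℝ) → ℂ => F (fun i => UpperHalfPlane.ofComplex (w i)))
    {w | ∀ i, 0 < (w i).im}}
  mul_mem' := fun hF hG => DifferentiableOn.mul hF hG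
  add_mem' := fun hF hG => DifferentiableOn.add hF hG
  algebraMap_mem' := fun c => differentiableOn_const c

/-- Evaluation of holomorphic functions at a point of `ℍⁿ`. -/
def evalAt (z : PolyUpperHalfPlane K) : Hol K →+* ℂ :=
  (Pi.evalRingHom (fun _ : PolyUpperHalfPlane K => ℂ) z).comp (Hol K).subtype

variable {K}

/-- The matrix `(σ a, σ b; σ c, σ d)` in `SL₂(ℝ)` attached to `(a, b; c, d)` in the Hilbert modular
group `SL₂(𝓞 K)` and to the real embedding `σ` of `K`. -/
def conj (γ : SL(2, 𝓞 K)) (σ : K →+* ℝ) : SL(2, ℝ) :=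
  Matrix.SpecialLinearGroup.map (σ.comp (algebraMap (𝓞 K) K)) γ

/-- The action of the Hilbert modular group on `ℍⁿ`: in the coordinate of index `σ`, this is the
homographic action of the matrix `(σ a, σ b; σ c, σ d)`. -/
def act (γ : SL(2, 𝓞 K)) (z : PolyUpperHalfPlane K) : PolyUpperHalfPlane K :=
  fun σ => conj γ σ • z σ

/-- The lower left entry `σ c`, as a complex number. -/
def lowerLeft (γ : SL(2, 𝓞 K)) (σ : K →+* ℝ) : ℂ := ((σ (γ 1 0 : K) : ℝ) : ℂ)

/-- The automorphy factor `σ(c) z_σ + σ(d)`. -/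
def autFactor (γ : SL(2, 𝓞 K)) (z : PolyUpperHalfPlane K) (σ : K →+* ℝ) : ℂ :=
  lowerLeft γ σ * (z σ : ℂ) + ((σ (γ 1 1 : K) : ℝ) : ℂ)

/-- `F` is a Hilbert quasi-modular form of weight `k ∈ ℤⁿ` and depth `s ∈ ℕ` for `SL₂(𝓞 K)`, where
`K` is a totally real number field of degree `n > 1`: `F` is holomorphic on `ℍⁿ` and there is a
polynomial `P ∈ Hol(ℍⁿ)[X₁, …, Xₙ]` of total degree `s` such that, for all `z` and all
`γ = (a, b; c, d)`,
`F (γ z) = ∏ᵢ (cᵢ zᵢ + dᵢ) ^ kᵢ * P(z; c₁ / (c₁ z₁ + d₁), …, cₙ / (cₙ zₙ + dₙ))`. -/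
def IsQuasiModularForm (k : (K →+* ℝ) → ℤ) (s : ℕ) (F : PolyUpperHalfPlane K → ℂ) : Prop :=
  F ∈ Hol K ∧
  ∃ P : MvPolynomial (K →+* ℝ) (Hol K), P.totalDegree = s ∧
    ∀ (z : PolyUpperHalfPlane K) (γ : SL(2, 𝓞 K)),
      F (act γ z) = (∏ σ, autFactor γ z σ ^ k σ) *
        MvPolynomial.eval₂ (evalAt K z) (fun σ => lowerLeft γ σ / autFactor γ z σ) P

variable (K)

/-- The ring `𝒴(K)` of polynomials, with complex coefficients, in the Hilbert quasi-modular forms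
of all weights and all depths. -/
def quasiModularRing : Subalgebra ℂ (PolyUpperHalfPlane K → ℂ) :=
  Algebra.adjoin ℂ {F | ∃ (k : (K →+* ℝ) → ℤ) (s : ℕ), IsQuasiModularForm k s F}

end HilbertQuasiModular

end

/-!
Every finitely generated algebra of quasi-modular forms has bounded slope, while the quasi-modular
Eisenstein series do not.

At a fixed point `z` the automorphy factors `u_σ = c_σ z_σ + d_σ` and the quotients `X_σ = c_σ /
u_σ` are functions of `γ = (a, b; c, d)`. Since the conjugates of the integers of `K` are Zariski
dense in `ℂⁿ`, the monomials `u^a X^m` are linearly independent (`linearIndependent_autMonomial`),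
so that the expansion of `γ ↦ F (γ z)` in these monomials is unique. The functions `F` whose
expansions only involve exponents with `0 ≤ |a| - 2 |m|` and `|m| ≤ C (|a| - 2 |m|)` form a
subalgebra, increasing with `C` (`slopeSubalgebra`).

* A nonzero quasi-modular form of weight `w` and depth `s` has slope at most `s`, because
  `0 ≤ |w| - 2 s`, with strict inequality if `s > 0` (`IsQuasiModularForm.two_mul_depth_le`). The
  coefficients of degree `s` are Hilbert modular forms of total weight `|w| - 2 s`, and
  `IsModularForm.weight` says that a nonzero one has nonnegative total weight, and is a constant of
  weight zero if the total weight vanishes. This is deduced from the case of elliptic modular forms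
  by restriction to the diagonals `τ ↦ (α_σ τ)_σ`, with `α` a totally positive integer; Koecher's
  principle (`koecher`) gives the conditions at the cusps, and the density of the directions of
  totally positive integers makes these restrictions determine the form. If `|w| = 2 s` and `s > 0`,
  a coefficient of degree `s - 1` behaves like the Eisenstein series `E₂` with respect to one of the
  variables; the units of `K` make it vanish at infinity, which its restriction to the diagonal
  cannot do (`eq_zero_of_quasimodular_weight_two_single`).
* Hence a finitely generated `quasiModularRing K` is contained in `slopeSubalgebra K C` for one `C`
  (`exists_quasiModularRing_le_slopeSubalgebra`).
* The series `∑ (c₁ / u₁) ^ N ∏ u_σ ^ (-4)` over pairs `(c, d) ≠ 0` of integers modulo units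
  (`eisenstein`) is quasi-modular, of weight `4 + 2 N e₁`. The exponent `X₁ ^ N` occurs in its
  expansion, with coefficient `±` the Eisenstein series of weight `4`, which is not zero
  (`eisenstein_act`, `exists_eisenstein_zero_ne_zero`). So `N ≤ 4 n C` for all `N`, a contradiction.
-/

noncomputable section

namespace HilbertQuasiModular

/-! ### Koecher's principle on tube domains -/

section Koecher

open Complex Filter Topology

variable {ι : Type*}

/-- The tube domain in `ℂ^ι` of points all of whose coordinates have positive imaginary part. -/
def tube (ι : Type*) : Set (ι → ℂ) := {w | ∀ i, 0 < (w i).im}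

lemma isOpen_tube [Finite ι] : IsOpen (tube ι) := by
  have : tube ι = ⋂ i, {w : ι → ℂ | 0 < (w i).im} := by
    ext; simp [tube]
  rw [this]
  exact isOpen_iInter_of_finite fun i => isOpen_lt continuous_const (by fun_prop)

/-- The point of `ℂ^ι` with real part `x` and imaginary part `y`. -/
def reImPoint (x y : ι → ℝ) : ι → ℂ := fun i => (x i : ℂ) + (y i : ℂ) * I

lemma reImPoint_mem_tube {x y : ι → ℝ} (hy : ∀ i, 0 < y i) : reImPoint x y ∈ tube ι := by
  intro i; simpa [reImPoint] using hy i

lemma eq_reImPoint (w : ι → ℂ) : w = reImPoint (fun i => (w i).re) (fun i => (w i).im) := by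
  ext i; simp [reImPoint, Complex.re_add_im]

variable [Fintype ι] {H : (ι → ℂ) → ℂ}

/-- A function with a full lattice of real periods is bounded on the part of the tube lying over
a compact set of imaginary parts. -/
lemma exists_bound_of_periodic (hH : ContinuousOn H (tube ι)) (b : Module.Basis ι ℝ (ι → ℝ))
    (hper : ∀ j, ∀ w ∈ tube ι, H (w + fun i => (b j i : ℂ)) = H w)
    {Y : Set (ι → ℝ)} (hY : IsCompact Y) (hpos : ∀ y ∈ Y, ∀ i, 0 < y i) :
    ∃ C : ℝ, 0 < C ∧ ∀ y ∈ Y, ∀ x : ι → ℝ, ‖H (reImPoint x y)‖ ≤ C := by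
  have key : ∀ v ∈ Submodule.span ℤ (Set.range b), ∀ w ∈ tube ι,
      H (w + fun i => (v i : ℂ)) = H w := by
    have hmem : ∀ (v : ι → ℝ), ∀ w ∈ tube ι, (w + fun i => (v i : ℂ)) ∈ tube ι := by
      intro v w hw i; simpa using hw i
    let S : AddSubgroup (ι → ℝ) :=
      { carrier := {v | ∀ w ∈ tube ι, H (w + fun i => (v i : ℂ)) = H w}
        zero_mem' := by
          intro w _
          congr 1; ext i; simp
        add_mem' := by
          intro v v' h h' w hw
          rw [← h w hw, ← h' _ (hmem v w hw)]
          congr 1; ext i; simp [add_assoc]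
        neg_mem' := by
          intro v h w hw
          rw [← h _ (hmem (-v) w hw)]
          congr 1; ext i; simp }
    have hS : Submodule.span ℤ (Set.range b) ≤ AddSubgroup.toIntSubmodule S := by
      rw [Submodule.span_le]
      rintro _ ⟨j, rfl⟩
      exact hper j
    exact fun v hv => hS hv
  have hc : IsCompact ((fun p : (ι → ℝ) × (ι → ℝ) => reImPoint p.1 p.2) ''
      (Metric.closedBall 0 (∑ i, ‖b i‖) ×ˢ Y)) :=
    ((isCompact_closedBall _ _).prod hY).image (by unfold reImPoint; fun_prop)
  have hsub : ((fun p : (ι → ℝ) × (ι → ℝ) => reImPoint p.1 p.2) ''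
      (Metric.closedBall 0 (∑ i, ‖b i‖) ×ˢ Y)) ⊆ tube ι := by
    rintro _ ⟨⟨x, y⟩, ⟨-, hy⟩, rfl⟩
    exact reImPoint_mem_tube (hpos y hy)
  obtain ⟨C, hC⟩ := hc.exists_bound_of_continuousOn (hH.mono hsub)
  refine ⟨max C 1, by positivity, fun y hy x => le_trans ?_ (le_max_left _ _)⟩
  have h1 := key (ZSpan.floor b x) (ZSpan.floor b x).2 (reImPoint (ZSpan.fract b x) y)
    (reImPoint_mem_tube (hpos y hy))
  have h2 : reImPoint (ZSpan.fract b x) y + (fun i => (((ZSpan.floor b x : ι → ℝ) i : ℝ) : ℂ))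
      = reImPoint x y := by
    ext i
    simp [reImPoint, ZSpan.fract_apply]
    ring
  rw [h2] at h1
  rw [h1]
  exact hC _ ⟨(ZSpan.fract b x, y), ⟨by simpa using ZSpan.norm_fract_le b x, hy⟩, rfl⟩

/-- Three lines theorem on the tube: `y ↦ sup_x ‖H (x + i y)‖` is logarithmically convex. -/
lemma norm_le_of_periodic_of_segment (hH : DifferentiableOn ℂ H (tube ι))
    (b : Module.Basis ι ℝ (ι → ℝ))
    (hper : ∀ j, ∀ w ∈ tube ι, H (w + fun i => (b j i : ℂ)) = H w)
    {y₀ y₁ : ι → ℝ} (hy₀ : ∀ i, 0 < y₀ i) (hy₁ : ∀ i, 0 < y₁ i) {B₀ B₁ : ℝ}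
    (h₀ : ∀ x, ‖H (reImPoint x y₀)‖ ≤ B₀) (h₁ : ∀ x, ‖H (reImPoint x y₁)‖ ≤ B₁)
    {θ : ℝ} (hθ : θ ∈ Set.Icc (0 : ℝ) 1) (x : ι → ℝ) :
    ‖H (reImPoint x (y₀ + θ • (y₁ - y₀)))‖ ≤ B₀ ^ (1 - θ) * B₁ ^ θ := by
  let g : ℂ → ι → ℂ := fun s i => (x i : ℂ) + ((y₀ i : ℂ) + s * ((y₁ i : ℂ) - y₀ i)) * I
  have hg : ∀ s : ℂ, g s = reImPoint (fun i => x i - s.im * (y₁ i - y₀ i))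
      (y₀ + s.re • (y₁ - y₀)) := by
    intro s; ext i
    apply Complex.ext <;> simp [g, reImPoint] <;> ring
  have hpos : ∀ t ∈ Set.Icc (0 : ℝ) 1, ∀ i, 0 < (y₀ + t • (y₁ - y₀)) i := by
    intro t ht i
    have : (y₀ + t • (y₁ - y₀)) i = (1 - t) * y₀ i + t * y₁ i := by simp; ring
    rw [this]
    rcases ht.1.eq_or_lt with rfl | h
    · simpa using hy₀ i
    · have := hy₀ i; have := hy₁ i; have := ht.2
      have : 0 ≤ (1 - t) * y₀ i := mul_nonneg (by linarith) (by linarith)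
      have : 0 < t * y₁ i := by positivity
      linarith
  have hmaps : Set.MapsTo g (HadamardThreeLines.verticalClosedStrip 0 1) (tube ι) := by
    intro s hs
    rw [hg]
    exact reImPoint_mem_tube (hpos _ hs)
  have hgd : Differentiable ℂ g := by
    rw [differentiable_pi]; intro i; fun_prop
  have hd : DifferentiableOn ℂ (H ∘ g) (HadamardThreeLines.verticalClosedStrip 0 1) :=
    hH.comp hgd.differentiableOn hmaps
  have hcl : closure (HadamardThreeLines.verticalStrip 0 1) ⊆
      HadamardThreeLines.verticalClosedStrip 0 1 := by
    apply closure_minimal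
    · exact Set.preimage_mono Set.Ioo_subset_Icc_self
    · exact isClosed_Icc.preimage continuous_re
  have hY : IsCompact ((fun t : ℝ => y₀ + t • (y₁ - y₀)) '' Set.Icc 0 1) :=
    isCompact_Icc.image (by fun_prop)
  obtain ⟨C, -, hC⟩ := exists_bound_of_periodic hH.continuousOn b hper hY (by
    rintro _ ⟨t, ht, rfl⟩; exact hpos t ht)
  have := HadamardThreeLines.norm_le_interp_of_mem_verticalClosedStrip₀₁' (H ∘ g) (z := (θ : ℂ))
    (a := B₀) (b := B₁) (by simpa [HadamardThreeLines.verticalClosedStrip] using hθ)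
    (DifferentiableOn.diffContOnCl (hd.mono hcl)) ⟨C, by
      rintro _ ⟨s, hs, rfl⟩
      simp only [Function.comp_apply, hg]
      exact hC _ ⟨_, hs, rfl⟩ _⟩
    (by
      intro s hs
      have hs : s.re = 0 := hs
      simp only [Function.comp_apply, hg, hs]
      simpa using h₀ _)
    (by
      intro s hs
      have hs : s.re = 1 := hs
      simp only [Function.comp_apply, hg, hs]
      simpa using h₁ _)
  simp only [Function.comp_apply, hg] at this
  simpa using this

lemma convex_setOf_norm_le (hH : DifferentiableOn ℂ H (tube ι))
    (b : Module.Basis ι ℝ (ι → ℝ))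
    (hper : ∀ j, ∀ w ∈ tube ι, H (w + fun i => (b j i : ℂ)) = H w) {B : ℝ} (hB : 0 < B) :
    Convex ℝ {y : ι → ℝ | (∀ i, 0 < y i) ∧ ∀ x, ‖H (reImPoint x y)‖ ≤ B} := by
  rintro y ⟨hy, hyB⟩ y' ⟨hy', hyB'⟩ s t hs ht hst
  obtain rfl : s = 1 - t := by linarith
  refine ⟨fun i => ?_, fun x => ?_⟩
  · exact (convex_Ioi (0 : ℝ)) (hy i) (hy' i) hs ht hst
  · have := norm_le_of_periodic_of_segment hH b hper hy hy' hyB hyB' (θ := t) ⟨ht, by linarith⟩ x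
    rw [← Real.rpow_add hB] at this
    convert this using 2
    · congr 2; module
    · simp

/-- **Koecher's principle**: if a holomorphic function on the tube has a full lattice of real
periods and is multiplied by constants under the dilations by vectors `v i`, where `v i` expands
the `i`-th coordinate and contracts the others, then `y ↦ sup_x ‖H (x + i y)‖` is nonincreasing.
The dilations bound this supremum polynomially along a sequence going to infinity in any given
direction, and a logarithmically convex function of subexponential growth is nonincreasing. -/
theorem koecher [Nonempty ι] (hH : DifferentiableOn ℂ H (tube ι))
    (b : Module.Basis ι ℝ (ι → ℝ))
    (hper : ∀ j, ∀ w ∈ tube ι, H (w + fun i => (b j i : ℂ)) = H w)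
    (v : ι → ι → ℝ) (hv₀ : ∀ i j, 0 < v i j) (hv₁ : ∀ i, 1 < v i i)
    (hv₂ : ∀ i j, j ≠ i → v i j ≤ 1) (R : ι → ℝ)
    (hR : ∀ i, ∀ w ∈ tube ι, ‖H (fun j => (v i j : ℂ) * w j)‖ ≤ R i * ‖H w‖)
    {y y' : ι → ℝ} (hy : ∀ i, 0 < y i) (hyy' : ∀ i, y i < y' i) {B : ℝ}
    (hB : ∀ x, ‖H (reImPoint x y)‖ ≤ B) (x : ι → ℝ) : ‖H (reImPoint x y')‖ ≤ B := by
  -- a common bound `S` for the constants `R i`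
  obtain ⟨S, hS1, hS⟩ : ∃ S : ℝ, 1 ≤ S ∧ ∀ i, R i ≤ S := by
    obtain ⟨S, hS⟩ := (Set.finite_range R).bddAbove
    exact ⟨max S 1, le_max_right _ _, fun i => (hS ⟨i, rfl⟩).trans (le_max_left _ _)⟩
  -- the dilation by the `m`-th power of `v i` costs a factor `S ^ m`
  have hpow : ∀ (m : ℕ) (i : ι), ∀ w ∈ tube ι,
      (fun j => ((v i j : ℂ) ^ m) * w j) ∈ tube ι ∧
      ‖H (fun j => ((v i j : ℂ) ^ m) * w j)‖ ≤ S ^ m * ‖H w‖ := by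
    intro m i
    induction m with
    | zero => intro w hw; simpa using hw
    | succ m ih =>
      intro w hw
      obtain ⟨h1, h2⟩ := ih w hw
      refine ⟨fun j => ?_, ?_⟩
      · have h3 := hw j
        have : ((v i j : ℂ) ^ (m + 1) * w j).im = v i j ^ (m + 1) * (w j).im := by
          rw [← Complex.ofReal_pow, Complex.im_ofReal_mul]
        rw [this]
        have := hv₀ i j
        positivity
      · have h3 := hR i _ h1
        have : (fun j => (v i j : ℂ) * ((v i j : ℂ) ^ m * w j)) =
            fun j => (v i j : ℂ) ^ (m + 1) * w j := by ext j; ring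
        rw [this] at h3
        refine h3.trans ?_
        calc R i * _ ≤ S * (S ^ m * ‖H w‖) :=
              mul_le_mul (hS i) h2 (norm_nonneg _) (by linarith)
          _ = _ := by ring
  set d : ι → ℝ := fun i => y' i - y i with hd
  have hdpos : ∀ i, 0 < d i := fun i => by simp [hd, hyy']
  -- bound on a box of directions around `d`
  set n : ℝ := (Fintype.card ι : ℝ) with hn
  have hn1 : 1 ≤ n := by
    rw [hn]; exact_mod_cast Fintype.card_pos
  have hbox : IsCompact (Set.Icc (fun i => d i / n) (fun i => d i + n * y i)) := isCompact_Icc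
  obtain ⟨C, hC0, hC⟩ := exists_bound_of_periodic hH.continuousOn b hper hbox (by
    intro u hu i
    exact lt_of_lt_of_le (by have := hdpos i; positivity) (hu.1 i))
  -- expansion rate
  obtain ⟨ρ, hρ1, hρ⟩ : ∃ ρ : ℝ, 1 < ρ ∧ ∀ i, ρ ≤ v i i := by
    obtain ⟨i₀, hi₀⟩ := Finite.exists_min (fun i => v i i)
    exact ⟨v i₀ i₀, hv₁ i₀, hi₀⟩
  let D : ℕ → ℝ := fun m => ∑ i, (v i i ^ m)⁻¹
  have hD0 : ∀ m, 0 < D m := fun m =>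
    Finset.sum_pos (fun i _ => by have := hv₀ i i; positivity) Finset.univ_nonempty
  let c : ℕ → ℝ := fun m => (D m)⁻¹
  have hc0 : ∀ m, 0 < c m := fun m => inv_pos.mpr (hD0 m)
  have hcρ : ∀ m, ρ ^ m / n ≤ c m := by
    intro m
    have h1 : D m ≤ n * (ρ ^ m)⁻¹ := by
      have : D m ≤ ∑ _i : ι, (ρ ^ m)⁻¹ := Finset.sum_le_sum fun i _ => by
        have := hρ i
        gcongr
      simpa [hn] using this
    calc ρ ^ m / n = (n * (ρ ^ m)⁻¹)⁻¹ := by rw [mul_inv, inv_inv]; ring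
      _ ≤ c m := inv_anti₀ (hD0 m) h1
  have hcn : ∀ m, 1 / n ≤ c m := fun m => le_trans (by gcongr; exact one_le_pow₀ hρ1.le) (hcρ m)
  -- the supremum at `y + c m • d` is at most `S ^ m * C`
  have hfar : ∀ m x, (∀ i, 0 < (y + c m • d) i) ∧
      ‖H (reImPoint x (y + c m • d))‖ ≤ S ^ m * C := by
    intro m
    have hSC : 0 < S ^ m * C := by positivity
    have hconv := convex_setOf_norm_le hH b hper hSC
    let β : ι → ℝ := fun j => ∑ i, (v i i ^ m)⁻¹ * v i j ^ m
    have hβ1 : ∀ j, 1 ≤ β j := by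
      intro j
      have h1 : (v j j ^ m)⁻¹ * v j j ^ m = 1 :=
        inv_mul_cancel₀ (pow_ne_zero _ (hv₀ j j).ne')
      rw [← h1]
      exact Finset.single_le_sum (f := fun i => (v i i ^ m)⁻¹ * v i j ^ m)
        (fun i _ => by have := hv₀ i i; have := hv₀ i j; positivity) (Finset.mem_univ j)
    have hβn : ∀ j, β j ≤ n := by
      intro j
      have : β j ≤ ∑ _i : ι, (1 : ℝ) := by
        refine Finset.sum_le_sum fun i _ => ?_
        have h0 := hv₀ i i
        rw [inv_mul_le_iff₀ (by positivity), mul_one]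
        apply pow_le_pow_left₀ (hv₀ i j).le
        by_cases h : j = i
        · rw [h]
        · exact (hv₂ i j h).trans (hv₁ i).le
      simpa [hn] using this
    let e : ι → ℝ := fun j => (d j + y j / c m) / β j
    have he : e ∈ Set.Icc (fun i => d i / n) (fun i => d i + n * y i) := by
      have h3 : ∀ i, d i ≤ d i + y i / c m := fun i => by
        have := hy i; have := hc0 m
        have : 0 ≤ y i / c m := by positivity
        linarith
      have h4 : ∀ i, y i / c m ≤ n * y i := fun i => by
        rw [div_le_iff₀ (hc0 m)]
        have := hcn m
        have h5 : 1 ≤ n * c m := by rwa [div_le_iff₀' (by positivity)] at this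
        have := hy i
        nlinarith
      refine ⟨fun i => ?_, fun i => ?_⟩
      · exact div_le_div₀ ((hdpos i).le.trans (h3 i)) (h3 i) (by linarith [hβ1 i]) (hβn i)
      · refine (div_le_self ((hdpos i).le.trans (h3 i)) (hβ1 i)).trans ?_
        linarith [h4 i]
    have hepos : ∀ i, 0 < e i := fun i =>
      lt_of_lt_of_le (by have := hdpos i; positivity) (he.1 i)
    have hmem : ∑ i, (c m * (v i i ^ m)⁻¹) • (fun j => v i j ^ m * e j) ∈
        {y : ι → ℝ | (∀ i, 0 < y i) ∧ ∀ x, ‖H (reImPoint x y)‖ ≤ S ^ m * C} := by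
      refine hconv.sum_mem (fun i _ => ?_) ?_ (fun i _ => ⟨fun j => ?_, fun x => ?_⟩)
      · have := hv₀ i i; have := hc0 m; positivity
      · rw [← Finset.mul_sum]; exact inv_mul_cancel₀ (hD0 m).ne'
      · have := hv₀ i j; have := hepos j; positivity
      · have h1 := (hpow m i (reImPoint (fun j => (v i j ^ m)⁻¹ * x j) e)
          (reImPoint_mem_tube hepos)).2
        have h2 : (fun j => (v i j : ℂ) ^ m * reImPoint (fun j => (v i j ^ m)⁻¹ * x j) e j) =
            reImPoint x (fun j => v i j ^ m * e j) := by
          ext j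
          have : (v i j : ℂ) ≠ 0 := by exact_mod_cast (hv₀ i j).ne'
          simp [reImPoint]
          field_simp
        rw [h2] at h1
        refine h1.trans ?_
        gcongr
        exact hC e he _
    have hsum : ∑ i, (c m * (v i i ^ m)⁻¹) • (fun j => v i j ^ m * e j) = y + c m • d := by
      ext j
      have h0 : β j ≠ 0 := by linarith [hβ1 j]
      have h1 := (hc0 m).ne'
      calc (∑ i, (c m * (v i i ^ m)⁻¹) • (fun j => v i j ^ m * e j)) j
          = c m * β j * e j := by
            simp only [Finset.sum_apply, Pi.smul_apply, smul_eq_mul, β]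
            rw [Finset.mul_sum, Finset.sum_mul]
            exact Finset.sum_congr rfl fun i _ => by ring
        _ = (y + c m • d) j := by
            simp only [e, Pi.add_apply, Pi.smul_apply, smul_eq_mul]
            field_simp
            ring
    rw [hsum] at hmem
    exact fun x => ⟨hmem.1, hmem.2 x⟩
  -- compare with the chord from `y` to `y + c m • d`
  apply le_of_forall_gt_imp_ge_of_dense
  intro B' hB'
  have hB'0 : 0 < B' := lt_of_le_of_lt ((norm_nonneg _).trans (hB 0)) hB'
  have hctop : Tendsto c atTop atTop := by
    refine tendsto_atTop_mono hcρ ?_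
    exact (tendsto_pow_atTop_atTop_of_one_lt hρ1).atTop_div_const (by positivity)
  have hlim : Tendsto (fun m => B' ^ (1 - 1 / c m) * (S ^ m * C) ^ (1 / c m)) atTop (𝓝 B') := by
    have h1 : Tendsto (fun m => 1 / c m) atTop (𝓝 0) := by
      simpa using! hctop.inv_tendsto_atTop
    have h2 : Tendsto (fun m : ℕ => (m : ℝ) / c m) atTop (𝓝 0) := by
      have h3 : Tendsto (fun m : ℕ => n * ((m : ℝ) / ρ ^ m)) atTop (𝓝 0) := by
        have := tendsto_pow_const_div_const_pow_of_one_lt 1 hρ1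
        simpa using this.const_mul n
      refine squeeze_zero (fun m => by have := hc0 m; positivity) (fun m => ?_) h3
      have h4 := hcρ m
      have h5 : 0 < ρ ^ m / n := by positivity
      calc (m : ℝ) / c m ≤ m / (ρ ^ m / n) := by gcongr
        _ = n * (m / ρ ^ m) := by field_simp
    have h6 : ∀ m, B' ^ (1 - 1 / c m) * (S ^ m * C) ^ (1 / c m) =
        Real.exp (Real.log B' * (1 - 1 / c m) +
          (Real.log S * (m / c m) + Real.log C * (1 / c m))) := by
      intro m
      rw [Real.rpow_def_of_pos hB'0, Real.rpow_def_of_pos (by positivity),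
        Real.log_mul (by positivity) (by positivity), Real.log_pow, ← Real.exp_add]
      congr 1; ring
    simp only [h6]
    have h7 : Tendsto (fun m : ℕ => Real.log B' * (1 - 1 / c m) +
          (Real.log S * (m / c m) + Real.log C * (1 / c m))) atTop
        (𝓝 (Real.log B' * (1 - 0) + (Real.log S * 0 + Real.log C * 0))) :=
      ((tendsto_const_nhds.sub h1).const_mul _).add ((h2.const_mul _).add (h1.const_mul _))
    have h8 := (Real.continuous_exp.tendsto _).comp h7
    simpa [Real.exp_log hB'0] using! h8
  refine ge_of_tendsto hlim ?_
  filter_upwards [hctop.eventually_ge_atTop 1] with m hm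
  have h9 := norm_le_of_periodic_of_segment hH b hper hy (hfar m 0).1
    (fun x => (hB x).trans hB'.le) (fun x => (hfar m x).2) (θ := 1 / c m)
    ⟨by have := hc0 m; positivity, by rw [div_le_one (hc0 m)]; exact hm⟩ x
  have h10 : y + (1 / c m) • ((y + c m • d) - y) = y' := by
    ext i
    have := (hc0 m).ne'
    simp [hd]
    field_simp
    ring
  rwa [h10] at h9

end Koecher

section IdentityPrinciple

open Complex Filter Topology

variable {ι : Type*} [Fintype ι]

/-- A holomorphic function on the tube that vanishes at all points with purely imaginary
coordinates is zero: the coordinates are released one at a time. -/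
lemma eq_zero_of_eq_zero_on_imaginary {G : (ι → ℂ) → ℂ} (hG : DifferentiableOn ℂ G (tube ι))
    (h : ∀ y : ι → ℝ, (∀ i, 0 < y i) → G (reImPoint 0 y) = 0) {w : ι → ℂ} (hw : w ∈ tube ι) :
    G w = 0 := by
  classical
  suffices ∀ (S : Finset ι), ∀ w ∈ tube ι, (∀ i ∉ S, (w i).re = 0) → G w = 0 from
    this Finset.univ w hw (by simp)
  intro S
  induction S using Finset.induction with
  | empty =>
    intro w hw h0
    rw [eq_reImPoint w]
    convert h (fun i => (w i).im) hw using 3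
    ext i; simpa using h0 i
  | insert a S ha ih =>
    intro w hw h0
    have hup : ∀ t : ℂ, 0 < t.im → Function.update w a t ∈ tube ι := by
      intro t ht i
      by_cases hi : i = a
      · subst hi; simpa
      · simpa [hi] using hw i
    have hU : IsOpen {t : ℂ | 0 < t.im} := isOpen_lt continuous_const continuous_im
    have hf : DifferentiableOn ℂ (fun t => G (Function.update w a t)) {t : ℂ | 0 < t.im} := by
      refine hG.comp (Differentiable.differentiableOn ?_) hup
      rw [differentiable_pi]
      intro i
      by_cases hi : i = a
      · subst hi; simp only [Function.update_self]; exact differentiable_id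
      · simp only [Function.update_of_ne hi]; exact differentiable_const _
    have hpre : IsPreconnected {t : ℂ | 0 < t.im} := (convex_halfSpace_im_gt 0).isPreconnected
    have hz : ∀ y : ℝ, 0 < y → G (Function.update w a (y * I)) = 0 := by
      intro y hy
      refine ih _ (hup _ (by simpa)) fun i hi => ?_
      by_cases hia : i = a
      · subst hia; simp
      · simpa [hia] using h0 i (by simp [hia, hi])
    have hfreq : ∃ᶠ t in 𝓝[≠] I, G (Function.update w a t) = 0 := by
      have ht : Tendsto (fun m : ℕ => ((1 + 1 / ((m : ℝ) + 1) : ℝ) : ℂ) * I) atTop (𝓝[≠] I) := by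
        refine tendsto_nhdsWithin_iff.mpr ⟨?_, Eventually.of_forall fun m => ?_⟩
        · have h1 : Tendsto (fun m : ℕ => (1 + 1 / ((m : ℝ) + 1) : ℝ)) atTop (𝓝 (1 + 0)) :=
            tendsto_const_nhds.add tendsto_one_div_add_atTop_nhds_zero_nat
          have h2 := ((continuous_ofReal.tendsto _).comp h1).mul_const I
          simpa using! h2
        · intro hI
          have := congrArg Complex.im hI
          simp at this
          norm_cast at this
      exact ht.frequently (Eventually.of_forall fun m => hz _ (by positivity)).frequently
    have := (hf.analyticOnNhd hU).eqOn_zero_of_preconnected_of_frequently_eq_zero hpre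
      (by simp) hfreq (hw a)
    simpa using this

end IdentityPrinciple

/-! ### Integers and units of a totally real field -/

section Arithmetic

open NumberField InfinitePlace

variable {K : Type*} [Field K]

/-- The infinite place attached to a real embedding. -/
def placeOf (σ : K →+* ℝ) : InfinitePlace K := InfinitePlace.mk (Complex.ofRealHom.comp σ)

@[simp] lemma placeOf_apply (σ : K →+* ℝ) (x : K) : placeOf σ x = |σ x| := by
  simp [placeOf, InfinitePlace.apply]

lemma placeOf_injective : Function.Injective (placeOf (K := K)) := by
  intro σ τ h
  rw [placeOf, placeOf, InfinitePlace.mk_eq_iff] at h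
  ext x
  rcases h with h | h
  · simpa using RingHom.congr_fun h x
  · simpa [ComplexEmbedding.conjugate_coe_eq] using RingHom.congr_fun h x

lemma placeOf_bijective [IsTotallyReal K] : Function.Bijective (placeOf (K := K)) := by
  refine ⟨placeOf_injective, fun w => ?_⟩
  have hw : w.IsReal := IsTotallyReal.isReal w
  refine ⟨embedding_of_isReal hw, ?_⟩
  ext x
  rw [placeOf_apply, ← norm_embedding_of_isReal hw, Real.norm_eq_abs]

variable [NumberField K] [IsTotallyReal K]

variable (K) in
lemma card_embeddings : Fintype.card (K →+* ℝ) = Module.finrank ℚ K := by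
  rw [Fintype.card_of_bijective (placeOf_bijective (K := K)),
    card_eq_nrRealPlaces_add_nrComplexPlaces, IsTotallyReal.nrComplexPlaces_eq_zero, add_zero,
    IsTotallyReal.finrank]

instance nonempty_embeddings : Nonempty (K →+* ℝ) := by
  rw [← Fintype.card_pos_iff, card_embeddings]; exact Module.finrank_pos

/-- The nonzero principal ideal generated by `α` is a full lattice in `∏ ℝ`. The real embeddings
are linearly independent characters, so the matrix of the conjugates of a `ℤ`-basis of `𝓞 K` is
invertible. -/
lemma exists_basis_conjugates {α : 𝓞 K} (hα : α ≠ 0) :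
    ∃ b : Module.Basis (K →+* ℝ) ℝ ((K →+* ℝ) → ℝ),
      ∀ j, ∃ β : 𝓞 K, ∀ σ, b j σ = σ (α * β : 𝓞 K) := by
  classical
  have hcard : Fintype.card (K →+* ℝ) = Fintype.card (Module.Free.ChooseBasisIndex ℤ (𝓞 K)) := by
    rw [card_embeddings, ← RingOfIntegers.rank, Module.finrank_eq_card_chooseBasisIndex]
  let e := Fintype.equivOfCardEq hcard
  let M : Matrix (K →+* ℝ) (K →+* ℝ) ℝ := fun j σ =>
    σ ((α * RingOfIntegers.basis K (e j) : 𝓞 K) : K)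
  have hM : Function.Injective M.mulVec := by
    refine (injective_iff_map_eq_zero (Matrix.mulVecLin M)).mpr ?_
    intro l hl
    have h1 : ∀ j, ∑ σ : K →+* ℝ,
        l σ * σ ((RingOfIntegers.basis K (e j) : 𝓞 K) : K) * σ (α : K) = 0 := by
      intro j
      have := congrFun hl j
      simp only [M, Pi.zero_apply] at this
      rw [← this]
      refine Finset.sum_congr rfl fun σ _ => ?_
      simp only [map_mul]; ring
    -- the character sum vanishes on an integral basis, hence on all of `K`
    have h2 : ∀ x : K, ∑ σ : K →+* ℝ, (l σ * σ (α : K)) * σ x = 0 := by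
      let φ : K →+ ℝ := ∑ σ : K →+* ℝ, (AddMonoidHom.mulLeft (l σ * σ (α : K))).comp (σ : K →+ ℝ)
      have hφ : ∀ x, φ x = ∑ σ : K →+* ℝ, (l σ * σ (α : K)) * σ x := by
        intro x; simp [φ, AddMonoidHom.finsetSum_apply]
      have : φ.toRatLinearMap = 0 := by
        refine (integralBasis K).ext fun i => ?_
        obtain ⟨j, rfl⟩ := e.surjective i
        rw [AddMonoidHom.coe_toRatLinearMap, hφ, integralBasis_apply]
        rw [LinearMap.zero_apply, ← h1 j]
        exact Finset.sum_congr rfl fun σ _ => by ring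
      intro x
      rw [← hφ]
      exact LinearMap.congr_fun this x
    have hli : LinearIndependent ℝ (fun σ : K →+* ℝ => (σ : K → ℝ)) :=
      (linearIndependent_monoidHom K ℝ).comp (fun σ : K →+* ℝ => (σ : K →* ℝ))
        (fun σ τ h => by ext x; exact DFunLike.congr_fun h x)
    have h3 := Fintype.linearIndependent_iff.mp hli (fun σ => l σ * σ (α : K)) (by
      ext x; simpa using h2 x)
    ext σ
    have h4 : σ (α : K) ≠ 0 := by simpa using hα
    simpa [h4] using h3 σ
  have hU : IsUnit M := Matrix.mulVec_injective_iff_isUnit.mp hM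
  have hli : LinearIndependent ℝ (fun j => M j) := Matrix.linearIndependent_rows_iff_isUnit.mpr hU
  refine ⟨basisOfLinearIndependentOfCardEqFinrank hli (by simp), fun j =>
    ⟨RingOfIntegers.basis K (e j), fun σ => ?_⟩⟩
  simp [M]

/-- Any positive direction is approximated by that of a totally positive integer. -/
lemma exists_integer_approx (t : (K →+* ℝ) → ℝ) {δ : ℝ} (hδ : 0 < δ) :
    ∃ (α : 𝓞 K) (r : ℝ), 0 < r ∧ ∀ σ : K →+* ℝ, |r * σ (α : K) - t σ| < δ := by
  obtain ⟨b, hb⟩ := exists_basis_conjugates (K := K) (α := 1) one_ne_zero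
  have hspan : ∀ v ∈ Submodule.span ℤ (Set.range b), ∃ α : 𝓞 K, ∀ σ, v σ = σ (α : K) := by
    intro v hv
    induction hv using Submodule.span_induction with
    | mem v hv =>
      obtain ⟨j, rfl⟩ := hv
      obtain ⟨β, hβ⟩ := hb j
      exact ⟨1 * β, hβ⟩
    | zero => exact ⟨0, by simp⟩
    | add v v' _ _ h h' =>
      obtain ⟨β, hβ⟩ := h
      obtain ⟨β', hβ'⟩ := h'
      exact ⟨β + β', fun σ => by simp [hβ, hβ']⟩
    | smul m v _ h =>
      obtain ⟨β, hβ⟩ := h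
      exact ⟨m • β, fun σ => by simp [hβ]⟩
  set C := ∑ i, ‖b i‖ with hC
  have hC0 : 0 ≤ C := Finset.sum_nonneg fun _ _ => norm_nonneg _
  set S := (C + 1) / δ with hS
  have hS0 : 0 < S := by positivity
  obtain ⟨α, hα⟩ := hspan (ZSpan.floor b (S • t)) (ZSpan.floor b (S • t)).2
  refine ⟨α, S⁻¹, by positivity, fun σ => ?_⟩
  rw [← hα]
  have h1 : |(ZSpan.fract b (S • t)) σ| ≤ C :=
    (norm_le_pi_norm (ZSpan.fract b (S • t)) σ).trans (ZSpan.norm_fract_le b _)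
  rw [ZSpan.fract_apply] at h1
  have h2 : S⁻¹ * (ZSpan.floor b (S • t) : (K →+* ℝ) → ℝ) σ - t σ =
      -(S⁻¹ * (S • t - (ZSpan.floor b (S • t) : (K →+* ℝ) → ℝ)) σ) := by
    simp only [Pi.sub_apply, Pi.smul_apply, smul_eq_mul]
    field_simp
    ring
  rw [h2, abs_neg, abs_mul, abs_of_pos (inv_pos.mpr hS0)]
  calc S⁻¹ * _ ≤ S⁻¹ * C := by gcongr
    _ < S⁻¹ * (C + 1) := by gcongr; linarith
    _ = δ := by rw [hS]; field_simp

/-- For every real embedding `σ` there is a unit congruent to its inverse modulo `α`, expanding at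
`σ` and contracting at all other embeddings. -/
lemma exists_unit_expanding (hK : 1 < Module.finrank ℚ K) {α : 𝓞 K} (hα : α ≠ 0) (σ : K →+* ℝ) :
    ∃ η : (𝓞 K)ˣ, α ∣ (η : 𝓞 K) - (η⁻¹ : (𝓞 K)ˣ) ∧ 1 < |σ (η : 𝓞 K)| ∧
      ∀ τ : K →+* ℝ, τ ≠ σ → |τ (η : 𝓞 K)| < 1 := by
  classical
  obtain ⟨u, hu⟩ := Units.dirichletUnitTheorem.exists_unit K (placeOf σ)
  have hpos : ∀ τ : K →+* ℝ, 0 < |τ (u : 𝓞 K)| := fun τ => by simp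
  have h1 : ∀ τ : K →+* ℝ, τ ≠ σ → |τ (u : 𝓞 K)| < 1 := by
    intro τ hτ
    have := hu (placeOf τ) (fun h => hτ (placeOf_injective h))
    rw [placeOf_apply] at this
    exact (Real.log_neg_iff (hpos τ)).mp this
  have h2 : 1 < |σ (u : 𝓞 K)| := by
    have hsum : ∑ τ : K →+* ℝ, Real.log |τ (u : 𝓞 K)| = 0 := by
      rw [← Units.sum_mult_mul_log u]
      refine Fintype.sum_bijective placeOf placeOf_bijective _ _ fun τ => ?_
      rw [IsTotallyReal.mult_eq, placeOf_apply]; simp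
    have : Nontrivial (K →+* ℝ) := by
      rw [← Fintype.one_lt_card_iff_nontrivial, card_embeddings]; exact hK
    obtain ⟨τ, hτ⟩ := exists_ne σ
    rw [← Finset.add_sum_erase _ _ (Finset.mem_univ σ)] at hsum
    have hneg : ∑ τ ∈ Finset.univ.erase σ, Real.log |τ (u : 𝓞 K)| < 0 :=
      Finset.sum_neg (fun τ hτ => Real.log_neg (hpos τ) (h1 τ (Finset.ne_of_mem_erase hτ)))
        ⟨τ, by simp [hτ]⟩
    exact (Real.log_pos_iff (hpos σ).le).mp (by linarith)
  have hfin : Finite (𝓞 K ⧸ Ideal.span {α}) :=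
    Ideal.finiteQuotientOfFreeOfNeBot _ (by simpa using hα)
  set m := Nat.card (𝓞 K ⧸ Ideal.span {α})ˣ with hm
  have hm0 : m ≠ 0 := Nat.card_pos.ne'
  refine ⟨u ^ m, ?_, ?_, fun τ hτ => ?_⟩
  · have hv : Units.map (Ideal.Quotient.mk (Ideal.span {α})).toMonoidHom (u ^ m) = 1 := by
      rw [map_pow]; exact pow_card_eq_one'
    rw [← Ideal.mem_span_singleton, ← Ideal.Quotient.eq]
    have h3 := congrArg Units.val hv
    have h4 := congrArg Units.val (congrArg (·⁻¹) hv)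
    simp only [← map_inv] at h4
    rw [inv_one] at h4
    exact h3.trans h4.symm
  · simp only [Units.val_pow_eq_pow_val, map_pow, abs_pow]
    exact one_lt_pow₀ h2 hm0
  · simp only [Units.val_pow_eq_pow_val, map_pow, abs_pow]
    exact pow_lt_one₀ (abs_nonneg _) (h1 τ hτ) hm0

omit [IsTotallyReal K] in
lemma exists_natCast_dvd {α : 𝓞 K} (hα : α ≠ 0) : ∃ N : ℕ, N ≠ 0 ∧ α ∣ (N : 𝓞 K) := by
  refine ⟨Ideal.absNorm (Ideal.span {α}), ?_, ?_⟩
  · simpa [Ideal.absNorm_eq_zero_iff] using hα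
  · rw [← Ideal.mem_span_singleton]
    exact Ideal.absNorm_mem _

open mixedEmbedding fundamentalCone in
/-- Every positive vector can be balanced by a unit: after multiplication by a suitable unit, all
coordinates are bounded by a constant times the geometric mean. -/
lemma exists_unit_balancing : ∃ C : ℝ, 0 < C ∧ ∀ x : (K →+* ℝ) → ℝ, (∀ σ, 0 < x σ) →
    ∃ u : (𝓞 K)ˣ, ∀ σ, (|σ (u : 𝓞 K)| * x σ) ^ Module.finrank ℚ K ≤ C * ∏ σ, x σ := by
  classical
  obtain ⟨C, hC⟩ := isBounded_iff_forall_norm_le.mp (isBounded_normLeOne K)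
  refine ⟨(max C 1) ^ Module.finrank ℚ K, by positivity, fun x hx => ?_⟩
  set P := ∏ σ, x σ with hP
  have hP0 : 0 < P := Finset.prod_pos fun σ _ => hx σ
  have hn : (Module.finrank ℚ K : ℝ) ≠ 0 := by exact_mod_cast Module.finrank_pos.ne'
  let m : mixedSpace K := (fun w => x (embedding_of_isReal w.2), 0)
  have hpl : ∀ σ : K →+* ℝ, normAtPlace (placeOf σ) m = x σ := by
    intro σ
    have hw : (placeOf σ).IsReal := IsTotallyReal.isReal _
    rw [normAtPlace_apply_of_isReal hw]
    have : embedding_of_isReal hw = σ := by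
      apply placeOf_injective
      ext y
      rw [placeOf_apply, ← Real.norm_eq_abs, norm_embedding_of_isReal]
    simp only [m, this]
    exact Real.norm_of_nonneg (hx σ).le
  have hnorm : mixedEmbedding.norm m = P := by
    rw [mixedEmbedding.norm_apply, hP]
    refine (Fintype.prod_bijective placeOf placeOf_bijective _ _ fun σ => ?_).symm
    rw [hpl, IsTotallyReal.mult_eq, pow_one]
  obtain ⟨u, hu⟩ := exists_unit_smul_mem (x := m) (by rw [hnorm]; exact hP0.ne')
  refine ⟨u, fun σ => ?_⟩
  -- rescale to norm one
  set c : ℝ := P ^ (-(Module.finrank ℚ K : ℝ)⁻¹) with hc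
  have hc0 : 0 < c := Real.rpow_pos_of_pos hP0 _
  have hcn : c ^ Module.finrank ℚ K = P⁻¹ := by
    rw [hc, ← Real.rpow_natCast, ← Real.rpow_mul hP0.le, neg_mul, inv_mul_cancel₀ hn,
      Real.rpow_neg_one]
  have hmem : c • (u • m) ∈ normLeOne K := by
    refine mem_normLeOne.mpr ⟨smul_mem_of_mem hu hc0.ne', ?_⟩
    rw [mixedEmbedding.norm_smul, norm_unit_smul, hnorm, abs_of_pos hc0, hcn,
      inv_mul_cancel₀ hP0.ne']
  have h1 : normAtPlace (placeOf σ) (c • (u • m)) ≤ C := by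
    classical
    refine le_trans ?_ (hC _ hmem)
    rw [norm_eq_sup'_normAtPlace]
    exact Finset.le_sup' (fun w => normAtPlace w (c • (u • m))) (Finset.mem_univ _)
  rw [normAtPlace_smul, unitSMul_smul, map_mul, hpl, normAtPlace_apply, placeOf_apply,
    abs_of_pos hc0] at h1
  have hux : 0 ≤ |σ (u : 𝓞 K)| * x σ := mul_nonneg (abs_nonneg _) (hx σ).le
  have h2 : (c * (|σ (u : 𝓞 K)| * x σ)) ^ Module.finrank ℚ K ≤ (max C 1) ^ Module.finrank ℚ K :=
    pow_le_pow_left₀ (by positivity) (h1.trans (le_max_left _ _)) _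
  rw [mul_pow, hcn, inv_mul_le_iff₀ hP0] at h2
  linarith

end Arithmetic

/-! ### Hilbert modular forms -/

section Slash

open UpperHalfPlane

variable {ι : Type*} [Fintype ι]

/-- The slash operator of weight `κ ∈ ℤ^ι` attached to a family of matrices, on functions on a
product of upper half planes. It is meant for matrices of positive determinant, and it is not
normalized by a power of the determinants. -/
def slash (κ : ι → ℤ) (A : ι → GL (Fin 2) ℝ) (f : (ι → ℍ) → ℂ) (z : ι → ℍ) : ℂ :=
  (∏ i, denom (A i) (z i) ^ (-κ i)) * f (fun i => A i • z i)

lemma slash_mul (κ : ι → ℤ) {A B : ι → GL (Fin 2) ℝ} (hB : ∀ i, 0 < (B i).det.val)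
    (f : (ι → ℍ) → ℂ) : slash κ (A * B) f = slash κ B (slash κ A f) := by
  ext z
  have h : ∀ i, denom (A i * B i) (z i) = denom (A i) ↑(B i • z i) * denom (B i) (z i) := by
    intro i
    rw [denom_cocycle_σ]
    rw [σ, if_pos (hB i), ContinuousAlgEquiv.refl_apply]
  simp only [slash, Pi.mul_apply, h, mul_zpow, Finset.prod_mul_distrib, mul_smul]
  ring

end Slash

section Modular

open UpperHalfPlane

variable {K : Type*} [Field K]

section
variable [NumberField K]

lemma mem_Hol_iff {F : PolyUpperHalfPlane K → ℂ} : F ∈ Hol K ↔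
    DifferentiableOn ℂ (fun w : (K →+* ℝ) → ℂ => F (fun i => ofComplex (w i))) (tube (K →+* ℝ)) :=
  Iff.rfl

/-- Composition of a holomorphic function with a holomorphic self-map of `ℍⁿ`. -/
lemma comp_mem_Hol {F : PolyUpperHalfPlane K → ℂ} (hF : F ∈ Hol K)
    {Φ : PolyUpperHalfPlane K → PolyUpperHalfPlane K}
    (hΦ : ∀ σ, (fun z => (Φ z σ : ℂ)) ∈ Hol K) : (fun z => F (Φ z)) ∈ Hol K := by
  have h : DifferentiableOn ℂ (fun w : (K →+* ℝ) → ℂ => fun σ =>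
      (Φ (fun i => ofComplex (w i)) σ : ℂ)) (tube (K →+* ℝ)) := by
    rw [differentiableOn_pi]; exact hΦ
  have := (mem_Hol_iff.mp hF).comp h (fun w _ σ => (Φ _ σ).im_pos)
  rw [mem_Hol_iff]
  refine this.congr fun w _ => ?_
  simp [ofComplex_apply]

lemma coord_mem_Hol (σ : K →+* ℝ) : (fun z : PolyUpperHalfPlane K => (z σ : ℂ)) ∈ Hol K := by
  rw [mem_Hol_iff]
  have : DifferentiableOn ℂ (fun w : (K →+* ℝ) → ℂ => w σ) (tube (K →+* ℝ)) := by fun_prop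
  refine this.congr fun w hw => ?_
  simp [ofComplex_apply_of_im_pos (hw σ)]

lemma inv_mem_Hol {F : PolyUpperHalfPlane K → ℂ} (hF : F ∈ Hol K) (h0 : ∀ z, F z ≠ 0) :
    (fun z => (F z)⁻¹) ∈ Hol K := by
  rw [mem_Hol_iff] at *
  exact hF.inv fun w _ => h0 _

lemma zpow_mem_Hol {F : PolyUpperHalfPlane K → ℂ} (hF : F ∈ Hol K) (h0 : ∀ z, F z ≠ 0) (m : ℤ) :
    (fun z => F z ^ m) ∈ Hol K := by
  rw [mem_Hol_iff] at *
  exact hF.zpow (Or.inl fun w _ => h0 _)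

lemma prod_mem_Hol {ι : Type*} (s : Finset ι) {F : ι → PolyUpperHalfPlane K → ℂ}
    (hF : ∀ i ∈ s, F i ∈ Hol K) : (fun z => ∏ i ∈ s, F i z) ∈ Hol K := by
  convert (Hol K).prod_mem hF using 1
  ext z; simp

lemma affine_mem_Hol (a b : ℂ) (σ : K →+* ℝ) :
    (fun z : PolyUpperHalfPlane K => a * (z σ : ℂ) + b) ∈ Hol K := by
  exact (Hol K).add_mem ((Hol K).smul_mem (coord_mem_Hol σ) a) ((Hol K).algebraMap_mem b)

lemma slash_mem_Hol (κ : (K →+* ℝ) → ℤ) {A : (K →+* ℝ) → GL (Fin 2) ℝ}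
    (hA : ∀ σ, 0 < (A σ).det.val) {F : PolyUpperHalfPlane K → ℂ} (hF : F ∈ Hol K) :
    slash κ A F ∈ Hol K := by
  have hden : ∀ σ, (fun z : PolyUpperHalfPlane K => denom (A σ) (z σ)) ∈ Hol K := fun σ =>
    affine_mem_Hol _ _ σ
  have h1 := prod_mem_Hol Finset.univ (F := fun σ z => denom (A σ) (z σ) ^ (-κ σ)) fun σ _ =>
    zpow_mem_Hol (hden σ) (fun z => denom_ne_zero _ _) _
  refine (Hol K).mul_mem h1 (comp_mem_Hol hF fun σ => ?_)
  have : (fun z : PolyUpperHalfPlane K => ((A σ • z σ : ℍ) : ℂ)) =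
      (fun z => num (A σ) (z σ)) * (fun z => (denom (A σ) (z σ))⁻¹) := by
    ext z
    rw [coe_smul_of_det_pos (hA σ)]; rfl
  rw [this]
  exact (Hol K).mul_mem (affine_mem_Hol _ _ σ) (inv_mem_Hol (hden σ) fun z => denom_ne_zero _ _)

end

/-- The image of an element of the Hilbert modular group in `∏ GL₂(ℝ)`. -/
def glConj (γ : SL(2, 𝓞 K)) (σ : K →+* ℝ) : GL (Fin 2) ℝ :=
  Matrix.SpecialLinearGroup.mapGL ℝ (conj γ σ)

lemma glConj_apply (γ : SL(2, 𝓞 K)) (σ : K →+* ℝ) (i j : Fin 2) :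
    glConj γ σ i j = σ (γ i j : K) := rfl

lemma glConj_det (γ : SL(2, 𝓞 K)) (σ : K →+* ℝ) : 0 < (glConj γ σ).det.val := by
  simp [glConj]

lemma glConj_mul (γ γ' : SL(2, 𝓞 K)) : glConj (γ * γ') = glConj γ * glConj γ' := by
  ext σ : 1
  simp [glConj, conj]

lemma act_apply (γ : SL(2, 𝓞 K)) (z : PolyUpperHalfPlane K) (σ : K →+* ℝ) :
    act γ z σ = glConj γ σ • z σ := rfl

lemma autFactor_eq_denom (γ : SL(2, 𝓞 K)) (z : PolyUpperHalfPlane K) (σ : K →+* ℝ) :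
    autFactor γ z σ = denom (glConj γ σ) (z σ) := rfl

lemma autFactor_ne_zero (γ : SL(2, 𝓞 K)) (z : PolyUpperHalfPlane K) (σ : K →+* ℝ) :
    autFactor γ z σ ≠ 0 := by
  rw [autFactor_eq_denom]; exact denom_ne_zero _ _

variable [NumberField K]

/-- Hilbert modular forms of weight `κ` for `SL₂(𝓞 K)`, without any condition at the cusps. -/
def IsModularForm (κ : (K →+* ℝ) → ℤ) (f : PolyUpperHalfPlane K → ℂ) : Prop :=
  f ∈ Hol K ∧ ∀ (z : PolyUpperHalfPlane K) (γ : SL(2, 𝓞 K)),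
    f (act γ z) = (∏ σ, autFactor γ z σ ^ κ σ) * f z

lemma slash_glConj_eq_iff (κ : (K →+* ℝ) → ℤ) (f : PolyUpperHalfPlane K → ℂ) (γ : SL(2, 𝓞 K)) :
    slash κ (glConj γ) f = f ↔ ∀ z, f (act γ z) = (∏ σ, autFactor γ z σ ^ κ σ) * f z := by
  rw [funext_iff]
  refine forall_congr' fun z => ?_
  have h0 : ∏ σ, autFactor γ z σ ^ κ σ ≠ 0 :=
    Finset.prod_ne_zero_iff.mpr fun σ _ => zpow_ne_zero _ (autFactor_ne_zero γ z σ)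
  have h1 : slash κ (glConj γ) f z = (∏ σ, autFactor γ z σ ^ κ σ)⁻¹ * f (act γ z) := by
    simp only [slash, zpow_neg, Finset.prod_inv_distrib]; rfl
  rw [h1, inv_mul_eq_iff_eq_mul₀ h0]

lemma IsModularForm.slash_eq {κ : (K →+* ℝ) → ℤ} {f : PolyUpperHalfPlane K → ℂ}
    (hf : IsModularForm κ f) (γ : SL(2, 𝓞 K)) : slash κ (glConj γ) f = f :=
  (slash_glConj_eq_iff κ f γ).mpr fun z => hf.2 z γ

/-- If `A C A⁻¹` comes from the Hilbert modular group, then `f ∣ A` is invariant under `C`. -/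
lemma IsModularForm.slash_slash_eq {κ : (K →+* ℝ) → ℤ} {f : PolyUpperHalfPlane K → ℂ}
    (hf : IsModularForm κ f) {A C : (K →+* ℝ) → GL (Fin 2) ℝ} (hA : ∀ σ, 0 < (A σ).det.val)
    (hC : ∀ σ, 0 < (C σ).det.val) {γ : SL(2, 𝓞 K)} (h : glConj γ * A = A * C) :
    slash κ C (slash κ A f) = slash κ A f := by
  rw [← slash_mul κ hC, ← h, slash_mul κ hA, hf.slash_eq]

/-- Action of an upper triangular element of the Hilbert modular group, in coordinates. -/
lemma apply_of_slash_eq_of_upper {κ : (K →+* ℝ) → ℤ} {h : PolyUpperHalfPlane K → ℂ} {α : 𝓞 K}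
    (hinv : ∀ γ : SL(2, 𝓞 K), γ 1 0 = 0 → α ∣ γ 0 1 → α ∣ γ 0 0 - γ 1 1 →
      slash κ (glConj γ) h = h) (ε : (𝓞 K)ˣ) (β : 𝓞 K)
    (h1 : α ∣ (ε : 𝓞 K) - (ε⁻¹ : (𝓞 K)ˣ)) (h2 : α ∣ β) {w : (K →+* ℝ) → ℂ}
    (hw : w ∈ tube (K →+* ℝ)) :
    h (fun i => ofComplex (((i (ε : 𝓞 K) : ℝ) : ℂ) ^ 2 * w i +
        ((i (ε : 𝓞 K) : ℝ) : ℂ) * ((i (β : K) : ℝ) : ℂ))) =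
      (∏ i : K →+* ℝ, ((i (ε : 𝓞 K) : ℝ) : ℂ) ^ (-κ i)) * h (fun i => ofComplex (w i)) := by
  let γ : SL(2, 𝓞 K) := ⟨!![(ε : 𝓞 K), β; 0, (ε⁻¹ : (𝓞 K)ˣ)], by simp⟩
  have h3 := hinv γ rfl h2 h1
  rw [slash_glConj_eq_iff] at h3
  have h4 := h3 (fun i => ofComplex (w i))
  have hinv : ∀ i : K →+* ℝ, (i ((ε⁻¹ : (𝓞 K)ˣ) : 𝓞 K) : ℝ) = (i (ε : 𝓞 K))⁻¹ := by
    intro i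
    exact eq_inv_of_mul_eq_one_left (by
      rw [← map_mul, ← map_mul, Units.inv_mul, map_one, map_one])
  have h5 : act γ (fun i => ofComplex (w i)) =
      fun i => ofComplex (((i (ε : 𝓞 K) : ℝ) : ℂ) ^ 2 * w i +
        ((i (ε : 𝓞 K) : ℝ) : ℂ) * ((i (β : K) : ℝ) : ℂ)) := by
    ext i : 1
    rw [← ofComplex_apply (act γ (fun i => ofComplex (w i)) i)]
    congr 1
    rw [act_apply, coe_smul_of_det_pos (glConj_det γ i)]
    simp only [num, denom, glConj_apply, ofComplex_apply_of_im_pos (hw i)]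
    have h0 : ((i (ε : 𝓞 K) : ℝ) : ℂ) ≠ 0 := by simp
    simp only [γ, Matrix.of_apply, Matrix.cons_val',
      Matrix.cons_val_zero, Matrix.cons_val_one, Matrix.cons_val_fin_one,
      map_zero, Complex.ofReal_zero, zero_mul, zero_add, hinv, Complex.ofReal_inv, div_inv_eq_mul]
    ring
  have h6 : ∀ i, autFactor γ (fun i => ofComplex (w i)) i = (((i (ε : 𝓞 K) : ℝ) : ℂ))⁻¹ := by
    intro i
    simp only [autFactor, lowerLeft, γ, Matrix.of_apply, Matrix.cons_val',
      Matrix.cons_val_zero, Matrix.cons_val_one, Matrix.cons_val_fin_one,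
      map_zero, Complex.ofReal_zero, zero_mul, zero_add, hinv, Complex.ofReal_inv]
  rw [h5] at h4
  simpa only [h6, inv_zpow, ← zpow_neg] using h4

variable [NumberField.IsTotallyReal K]

lemma exists_basis_of_slash_eq
    {κ : (K →+* ℝ) → ℤ} {h : PolyUpperHalfPlane K → ℂ} {α : 𝓞 K} (hα : α ≠ 0)
    (hinv : ∀ γ : SL(2, 𝓞 K), γ 1 0 = 0 → α ∣ γ 0 1 → α ∣ γ 0 0 - γ 1 1 →
      slash κ (glConj γ) h = h) :
    ∃ b : Module.Basis (K →+* ℝ) ℝ ((K →+* ℝ) → ℝ), ∀ j, ∀ w ∈ tube (K →+* ℝ),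
      h (fun i => ofComplex ((w + fun i => (b j i : ℂ)) i)) = h (fun i => ofComplex (w i)) := by
  obtain ⟨b, hb⟩ := exists_basis_conjugates hα
  refine ⟨b, fun j w hw => ?_⟩
  obtain ⟨β, hβ⟩ := hb j
  have := apply_of_slash_eq_of_upper hinv 1 (α * β) (by simp) (dvd_mul_right _ _) hw
  simpa [hβ] using this

/-- Koecher's principle at the cusp at infinity, for a holomorphic function invariant under the
upper triangular matrices congruent to scalar ones modulo `α`. -/
lemma koecher_of_slash_eq (hK : 1 < Module.finrank ℚ K)
    {κ : (K →+* ℝ) → ℤ} {h : PolyUpperHalfPlane K → ℂ} (hh : h ∈ Hol K) {α : 𝓞 K} (hα : α ≠ 0)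
    (hinv : ∀ γ : SL(2, 𝓞 K), γ 1 0 = 0 → α ∣ γ 0 1 → α ∣ γ 0 0 - γ 1 1 →
      slash κ (glConj γ) h = h)
    {y y' : (K →+* ℝ) → ℝ} (hy : ∀ i, 0 < y i) (hyy' : ∀ i, y i < y' i) {B : ℝ}
    (hB : ∀ x, ‖h (fun i => ofComplex (reImPoint x y i))‖ ≤ B) (x : (K →+* ℝ) → ℝ) :
    ‖h (fun i => ofComplex (reImPoint x y' i))‖ ≤ B := by
  obtain ⟨b, hb⟩ := exists_basis_of_slash_eq hα hinv
  choose η hη₀ hη₁ hη₂ using fun σ : K →+* ℝ => exists_unit_expanding hK hα σ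
  refine koecher (mem_Hol_iff.mp hh) b hb (fun i j => (j (η i : 𝓞 K) : ℝ) ^ 2) (fun i j => ?_)
    (fun i => ?_) (fun i j hij => ?_) (fun i => ∏ j : K →+* ℝ, |(j (η i : 𝓞 K) : ℝ)| ^ (-κ j))
    (fun i w hw => ?_) hy hyy' hB x
  · have : (j (η i : 𝓞 K) : ℝ) ≠ 0 := by simp
    positivity
  · rw [← sq_abs]; exact one_lt_pow₀ (hη₁ i) two_ne_zero
  · rw [← sq_abs]; exact pow_le_one₀ (abs_nonneg _) (hη₂ i j hij).le
  · have := apply_of_slash_eq_of_upper hinv (η i) 0 (hη₀ i) (dvd_zero _) hw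
    simp only [map_zero, Complex.ofReal_zero, mul_zero, add_zero] at this
    simp only [Complex.ofReal_pow]
    rw [this, norm_mul, norm_prod]
    simp

/-- A holomorphic function invariant under the upper triangular matrices congruent to scalar ones
modulo `α` is bounded at height one. -/
lemma exists_bound_of_slash_eq
    {κ : (K →+* ℝ) → ℤ} {h : PolyUpperHalfPlane K → ℂ} (hh : h ∈ Hol K) {α : 𝓞 K} (hα : α ≠ 0)
    (hinv : ∀ γ : SL(2, 𝓞 K), γ 1 0 = 0 → α ∣ γ 0 1 → α ∣ γ 0 0 - γ 1 1 →
      slash κ (glConj γ) h = h) :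
    ∃ B : ℝ, 0 < B ∧ ∀ x, ‖h (fun i => ofComplex (reImPoint x 1 i))‖ ≤ B := by
  obtain ⟨b, hb⟩ := exists_basis_of_slash_eq hα hinv
  obtain ⟨C, hC0, hC⟩ := exists_bound_of_periodic (mem_Hol_iff.mp hh).continuousOn b hb
    (isCompact_singleton (x := 1)) (by simp)
  exact ⟨C, hC0, hC 1 rfl⟩

end Modular

/-! ### Restriction to diagonals -/

section Diagonal

open UpperHalfPlane ModularForm CongruenceSubgroup Matrix.SpecialLinearGroup
open scoped Manifold

variable {K : Type*} [Field K] [NumberField K]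

omit [NumberField K] in
lemma map_natCast_emb (σ : K →+* ℝ) (N : ℕ) : σ ((N : 𝓞 K) : K) = N := by simp

/-- The matrix `(t, 0; 0, 1)`, acting on the upper half plane as multiplication by `t`. -/
def scaleGL (t : ℝ) (ht : 0 < t) : GL (Fin 2) ℝ :=
  Matrix.GeneralLinearGroup.mkOfDetNeZero !![t, 0; 0, 1] (by simpa using ht.ne')

lemma scaleGL_det (t : ℝ) (ht : 0 < t) : 0 < (scaleGL t ht).det.val := by
  simpa [scaleGL, Matrix.GeneralLinearGroup.mkOfDetNeZero] using ht

lemma denom_scaleGL (t : ℝ) (ht : 0 < t) (z : ℂ) : denom (scaleGL t ht) z = 1 := by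
  simp [denom, scaleGL, Matrix.GeneralLinearGroup.mkOfDetNeZero]

lemma scaleGL_smul (t : ℝ) (ht : 0 < t) (z : ℍ) : scaleGL t ht • z = ofComplex ((t : ℂ) * z) := by
  rw [← ofComplex_apply (scaleGL t ht • z), coe_smul_of_det_pos (scaleGL_det t ht), denom_scaleGL]
  simp [num, scaleGL, Matrix.GeneralLinearGroup.mkOfDetNeZero]

/-- The restriction of a function on `ℍⁿ` to the diagonal `τ ↦ (σ(α) τ)_σ`, for a totally positive
integer `α`. -/
def diagRestrict (α : 𝓞 K) (f : PolyUpperHalfPlane K → ℂ) (τ : ℍ) : ℂ :=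
  f (fun σ => ofComplex (((σ (α : K) : ℝ) : ℂ) * τ))

lemma prod_zpow_eq_zpow_sum {ι : Type*} (s : Finset ι) (κ : ι → ℤ) {x : ℂ} (hx : x ≠ 0) :
    ∏ i ∈ s, x ^ κ i = x ^ ∑ i ∈ s, κ i := by
  classical
  induction s using Finset.induction with
  | empty => simp
  | insert a s ha ih => rw [Finset.prod_insert ha, Finset.sum_insert ha, zpow_add₀ hx, ih]

lemma slash_scaleGL (κ : (K →+* ℝ) → ℤ) {α : 𝓞 K} (hα : ∀ σ : K →+* ℝ, 0 < σ (α : K))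
    (f : PolyUpperHalfPlane K → ℂ) (z : PolyUpperHalfPlane K) :
    slash κ (fun σ => scaleGL (σ (α : K)) (hα σ)) f z =
      f (fun σ => ofComplex (((σ (α : K) : ℝ) : ℂ) * z σ)) := by
  simp only [slash, denom_scaleGL, one_zpow, Finset.prod_const_one, one_mul, scaleGL_smul]

lemma diagRestrict_slash (κ : (K →+* ℝ) → ℤ) {α : 𝓞 K} (hα : ∀ σ : K →+* ℝ, 0 < σ (α : K))
    (f : PolyUpperHalfPlane K → ℂ) (γ : SL(2, ℤ)) (τ : ℍ) :
    (diagRestrict α f ∣[∑ σ, κ σ] γ) τ =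
      slash κ ((fun σ => scaleGL (σ (α : K)) (hα σ)) * fun _ => mapGL ℝ γ) f (fun _ => τ) := by
  rw [slash_mul _ (fun _ => by simp), SL_slash_apply]
  simp only [slash, denom_scaleGL, one_zpow, Finset.prod_const_one, one_mul, scaleGL_smul]
  rw [prod_zpow_eq_zpow_sum _ _ (denom_ne_zero _ _), Finset.sum_neg_distrib, mul_comm]
  rfl

/-- Conjugating an upper triangular matrix congruent to a scalar modulo `α` by `(α, 0; 0, 1) γ`,
with `γ ∈ SL₂(ℤ)`, gives an element of the Hilbert modular group. -/
lemma exists_conjugate_of_upper {α : 𝓞 K} (hα : ∀ σ : K →+* ℝ, 0 < σ (α : K)) (γ : SL(2, ℤ))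
    (B : SL(2, 𝓞 K)) (h10 : B 1 0 = 0) (h01 : α ∣ B 0 1) (hd : α ∣ B 0 0 - B 1 1) :
    ∃ γ' : SL(2, 𝓞 K), glConj γ' * ((fun σ => scaleGL (σ (α : K)) (hα σ)) * fun _ => mapGL ℝ γ) =
      ((fun σ => scaleGL (σ (α : K)) (hα σ)) * fun _ => mapGL ℝ γ) * glConj B := by
  obtain ⟨n, hn⟩ := h01
  obtain ⟨m, hm⟩ := hd
  have hγ := γ.det_coe
  have hB := B.det_coe
  rw [Matrix.det_fin_two] at hγ hB
  rw [h10, mul_zero, sub_zero] at hB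
  set p := γ 0 0 with hp
  set q := γ 0 1 with hq
  set r := γ 1 0 with hr
  set s := γ 1 1 with hs
  set e := B 0 0 with he
  set e' := B 1 1 with he'
  set b := B 0 1 with hb
  have hγ' : (p * s - q * r : 𝓞 K) = 1 := by exact_mod_cast congrArg (Int.cast : ℤ → 𝓞 K) hγ
  let γ' : SL(2, 𝓞 K) := ⟨!![p * e * s - r * (p * b + q * e'),
      α * (-p * e * q + p * (p * b + q * e'));
    r * s * m - r ^ 2 * n, -r * e * q + p * (r * b + s * e')], by
      rw [Matrix.det_fin_two_of]
      linear_combination ((p * s - q * r : 𝓞 K) + 1) * hγ' + (p * s - q * r : 𝓞 K) ^ 2 * hB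
        + ((-p * e * q + p * (p * b + q * e')) * r * s : 𝓞 K) * hm
        - ((-p * e * q + p * (p * b + q * e')) * r ^ 2 : 𝓞 K) * hn⟩
  refine ⟨γ', ?_⟩
  ext σ : 1
  have hγσ : (p * s - q * r : ℝ) = 1 := by exact_mod_cast congrArg (Int.cast : ℤ → ℝ) hγ
  have hmσ : σ (e : K) - σ (e' : K) = σ (α : K) * σ (m : K) := by
    rw [← map_mul, ← map_sub, ← map_mul, ← map_sub, hm]
  have hnσ : σ (b : K) = σ (α : K) * σ (n : K) := by
    rw [← map_mul, ← map_mul, hn]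
  have e1 : ((glConj γ' σ : GL (Fin 2) ℝ) : Matrix (Fin 2) (Fin 2) ℝ) =
      !![p * σ e * s - r * (p * σ b + q * σ e'), σ α * (-p * σ e * q + p * (p * σ b + q * σ e'));
        r * s * σ m - r ^ 2 * σ n, -r * σ e * q + p * (r * σ b + s * σ e')] := by
    ext i j
    rw [glConj_apply]
    fin_cases i <;> fin_cases j <;> simp [γ']
  have e2 : ((mapGL ℝ γ : GL (Fin 2) ℝ) : Matrix (Fin 2) (Fin 2) ℝ) = !![(p : ℝ), q; r, s] := by
    ext i j
    fin_cases i <;> fin_cases j <;> simp [hp, hq, hr, hs]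
  have e3 : ((glConj B σ : GL (Fin 2) ℝ) : Matrix (Fin 2) (Fin 2) ℝ) = !![σ e, σ b; 0, σ e'] := by
    ext i j
    rw [glConj_apply]
    fin_cases i <;> fin_cases j <;> simp [he, hb, he', h10]
  have e4 : ((scaleGL (σ (α : K)) (hα σ) : GL (Fin 2) ℝ) : Matrix (Fin 2) (Fin 2) ℝ) =
    !![σ (α : K), 0; 0, 1] := rfl
  apply Units.ext
  simp only [Pi.mul_apply, Units.val_mul, e1, e2, e3, e4]
  ext i j
  fin_cases i <;> fin_cases j <;> simp [Matrix.mul_apply, Fin.sum_univ_two]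
  · linear_combination (σ (α : K) * p * σ (e : K)) * hγσ
  · linear_combination (σ (α : K) * (p * σ (b : K) + q * σ (e' : K))) * hγσ
  · linear_combination (r * σ (e : K)) * hγσ - r * s * p * hmσ + r ^ 2 * p * hnσ
  · linear_combination (r * σ (b : K) + s * σ (e' : K)) * hγσ - r * s * q * hmσ + r ^ 2 * q * hnσ

variable [NumberField.IsTotallyReal K]

/-- The restriction of a Hilbert modular form to a diagonal is a modular form of one variable on a
principal congruence subgroup, its weight being the total weight. The growth condition at the cusps
holds by Koecher's principle. -/
lemma IsModularForm.exists_modularForm_diagRestrict (hK : 1 < Module.finrank ℚ K)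
    {κ : (K →+* ℝ) → ℤ} {f : PolyUpperHalfPlane K → ℂ} (hf : IsModularForm κ f)
    {α : 𝓞 K} (hα : ∀ σ : K →+* ℝ, 0 < σ (α : K)) :
    ∃ (N : ℕ) (_ : NeZero N) (g : ModularForm ((Gamma N).map (mapGL ℝ)) (∑ σ, κ σ)),
      (g : ℍ → ℂ) = diagRestrict α f := by
  have hα0 : α ≠ 0 := by
    rintro rfl
    obtain ⟨σ⟩ := nonempty_embeddings (K := K)
    simpa using hα σ
  obtain ⟨N, hN0, ν, hν⟩ := exists_natCast_dvd hα0
  have : NeZero N := ⟨hN0⟩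
  let D : (K →+* ℝ) → GL (Fin 2) ℝ := fun σ => scaleGL (σ (α : K)) (hα σ)
  have hD : ∀ σ, 0 < (D σ).det.val := fun σ => scaleGL_det _ _
  refine ⟨N, inferInstance, ⟨⟨diagRestrict α f, ?_⟩, ?_, ?_⟩, rfl⟩
  · rintro _ ⟨γ, hγ, rfl⟩
    ext τ
    have hγ10 : (N : ℤ) ∣ γ 1 0 := by
      rw [← ZMod.intCast_zmod_eq_zero_iff_dvd]
      exact ((Gamma_mem.mp hγ)).2.2.1
    obtain ⟨r, hr⟩ := hγ10
    have hdet := γ.det_coe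
    rw [Matrix.det_fin_two] at hdet
    let γ' : SL(2, 𝓞 K) := ⟨!![(γ 0 0 : 𝓞 K), α * γ 0 1; ν * r, γ 1 1], by
      rw [Matrix.det_fin_two_of]
      have h1 : (γ 0 0 * γ 1 1 - γ 0 1 * γ 1 0 : 𝓞 K) = 1 := by
        exact_mod_cast congrArg (Int.cast : ℤ → 𝓞 K) hdet
      have h2 : ((γ 1 0 : ℤ) : 𝓞 K) = N * r := by rw [hr]; push_cast; ring
      linear_combination h1 + (γ 0 1 : 𝓞 K) * h2 + (γ 0 1 * r : 𝓞 K) * hν⟩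
    have hmul : glConj γ' * D = D * fun _ => mapGL ℝ γ := by
      ext σ : 1
      apply Units.ext
      have e1 : ((glConj γ' σ : GL (Fin 2) ℝ) : Matrix (Fin 2) (Fin 2) ℝ) =
          !![(γ 0 0 : ℝ), σ α * γ 0 1; σ ν * r, γ 1 1] := by
        ext i j
        rw [glConj_apply]
        fin_cases i <;> fin_cases j <;> simp [γ']
      have e2 : ((mapGL ℝ γ : GL (Fin 2) ℝ) : Matrix (Fin 2) (Fin 2) ℝ) =
          !![(γ 0 0 : ℝ), γ 0 1; γ 1 0, γ 1 1] := by
        ext i j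
        fin_cases i <;> fin_cases j <;> simp
      have e4 : ((D σ : GL (Fin 2) ℝ) : Matrix (Fin 2) (Fin 2) ℝ) = !![σ (α : K), 0; 0, 1] := rfl
      have h2 : ((γ 1 0 : ℤ) : ℝ) = σ α * σ ν * r := by
        rw [hr, ← map_mul, ← map_mul, ← hν, map_natCast_emb]; push_cast; ring
      simp only [Pi.mul_apply, Units.val_mul, e1, e2, e4]
      ext i j
      fin_cases i <;> fin_cases j <;> simp [Matrix.mul_apply, Fin.sum_univ_two]
      · ring
      · rw [h2]; ring
    have h1 := congrFun (hf.slash_slash_eq hD (C := fun _ => mapGL ℝ γ) (fun _ => by simp) hmul)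
      (fun _ => τ)
    rw [← slash_mul _ (fun _ => by simp), slash_scaleGL] at h1
    have h2 := diagRestrict_slash κ hα f γ τ
    rw [SL_slash] at h2
    exact h2.trans h1
  · change MDiff (diagRestrict α f)
    rw [mdifferentiable_iff]
    have h1 : DifferentiableOn ℂ (fun w : ℂ => fun σ : K →+* ℝ => ((σ (α : K) : ℝ) : ℂ) * w)
        {w | 0 < w.im} := by
      rw [differentiableOn_pi]; intro σ; fun_prop
    have h2 := (mem_Hol_iff.mp hf.1).comp h1 (fun w hw σ => by
      simpa using mul_pos (hα σ) hw)
    refine h2.congr fun w hw => ?_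
    simp [diagRestrict, ofComplex_apply_of_im_pos hw]
  · intro c hc
    rw [Subgroup.IsArithmetic.isCusp_iff_isCusp_SL2Z] at hc
    change c.IsBoundedAt (diagRestrict α f) _
    rw [OnePoint.isBoundedAt_iff_forall_SL2Z hc]
    intro γ _
    let A : (K →+* ℝ) → GL (Fin 2) ℝ := D * fun _ => mapGL ℝ γ
    set h := slash κ A f
    have hdet : ∀ σ, 0 < (A σ).det.val := fun σ => by
      simpa [A] using hD σ
    have hhol : h ∈ Hol K := slash_mem_Hol κ hdet hf.1
    have hinv : ∀ B : SL(2, 𝓞 K), B 1 0 = 0 → α ∣ B 0 1 → α ∣ B 0 0 - B 1 1 →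
        slash κ (glConj B) h = h := by
      intro B h10 h01 hd
      obtain ⟨γ', hγ'⟩ := exists_conjugate_of_upper hα γ B h10 h01 hd
      exact hf.slash_slash_eq hdet (glConj_det B) hγ'
    obtain ⟨M, -, hM⟩ := exists_bound_of_slash_eq hhol hα0 hinv
    rw [isBoundedAtImInfty_iff]
    refine ⟨M, 2, fun τ hτ => ?_⟩
    have := koecher_of_slash_eq hK hhol hα0 hinv (y := 1) (y' := fun _ => τ.im)
      (by simp) (fun _ => by simp only [Pi.one_apply]; linarith) hM (fun _ => τ.re)
    rw [diagRestrict_slash κ hα]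
    convert this using 3
    ext i : 1
    rw [← ofComplex_apply τ]
    congr 1
    simpa [reImPoint] using (Complex.re_add_im (τ : ℂ)).symm

end Diagonal

/-! ### Weights of Hilbert modular forms -/

section Weight

open UpperHalfPlane ModularForm CongruenceSubgroup Matrix.SpecialLinearGroup
open scoped Topology

variable {K : Type*} [Field K] [NumberField K] [NumberField.IsTotallyReal K]

/-- A continuous function on the positive cone that vanishes at all positive multiples of totally
positive integers is zero, as these are dense. -/
lemma eq_zero_of_eq_zero_on_integers {G : ((K →+* ℝ) → ℝ) → ℂ}
    (hG : ContinuousOn G {t | ∀ i, 0 < t i})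
    (h : ∀ (α : 𝓞 K), (∀ σ : K →+* ℝ, 0 < σ (α : K)) → ∀ r : ℝ, 0 < r →
      G (fun σ => r * σ (α : K)) = 0)
    {t : (K →+* ℝ) → ℝ} (ht : ∀ i, 0 < t i) : G t = 0 := by
  by_contra h0
  have hopen : IsOpen {t : (K →+* ℝ) → ℝ | ∀ i, 0 < t i} := by
    have : {t : (K →+* ℝ) → ℝ | ∀ i, 0 < t i} = ⋂ i, {t | 0 < t i} := by ext; simp
    rw [this]
    exact isOpen_iInter_of_finite fun i => isOpen_lt continuous_const (continuous_apply i)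
  have h1 : ∀ᶠ s in 𝓝 t, G s ≠ 0 ∧ ∀ i, 0 < s i :=
    ((hG.continuousAt (hopen.mem_nhds ht)).eventually_ne h0).and (hopen.mem_nhds ht)
  obtain ⟨δ, hδ, hball⟩ := Metric.eventually_nhds_iff.mp h1
  obtain ⟨α, r, hr, hα⟩ := exists_integer_approx t hδ
  obtain ⟨h2, h3⟩ := @hball (fun σ => r * σ (α : K)) (by
    rw [dist_pi_lt_iff hδ]
    intro σ
    rw [Real.dist_eq]
    exact hα σ)
  exact h2 (h α (fun σ => pos_of_mul_pos_right (h3 σ) hr.le) r hr)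

omit [NumberField.IsTotallyReal K] in
lemma continuousOn_diagonal {f : PolyUpperHalfPlane K → ℂ} (hf : f ∈ Hol K) {τ : ℂ}
    (hτ : 0 < τ.im) : ContinuousOn (fun t : (K →+* ℝ) → ℝ => f (fun σ => ofComplex ((t σ : ℂ) * τ)))
      {t | ∀ i, 0 < t i} := by
  have h1 : ContinuousOn (fun t : (K →+* ℝ) → ℝ => fun σ => (t σ : ℂ) * τ) {t | ∀ i, 0 < t i} := by
    fun_prop
  exact (mem_Hol_iff.mp hf).continuousOn.comp h1 fun t ht σ => by
    simpa using mul_pos (ht σ) hτ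

omit [NumberField K] [NumberField.IsTotallyReal K] in
lemma diagRestrict_ofComplex (f : PolyUpperHalfPlane K → ℂ) (α : 𝓞 K) {r : ℝ} (hr : 0 < r) {τ : ℂ}
    (hτ : 0 < τ.im) : diagRestrict α f (ofComplex (r * τ)) =
      f (fun σ => ofComplex (((r * σ (α : K) : ℝ) : ℂ) * τ)) := by
  have : 0 < ((r : ℂ) * τ).im := by simpa using mul_pos hr hτ
  simp only [diagRestrict, ofComplex_apply_of_im_pos this, Complex.ofReal_mul]
  congr 1; ext σ : 1; congr 1; ring

omit [NumberField K] [NumberField.IsTotallyReal K] in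
lemma eq_ofComplex (z : PolyUpperHalfPlane K) : z = fun σ => ofComplex (z σ : ℂ) := by
  ext σ : 1; simp [ofComplex_apply]

/-- A holomorphic function whose restrictions to all diagonals vanish is zero. -/
lemma eq_zero_of_diagRestrict_eq_zero {f : PolyUpperHalfPlane K → ℂ} (hf : f ∈ Hol K)
    (h : ∀ α : 𝓞 K, (∀ σ : K →+* ℝ, 0 < σ (α : K)) → diagRestrict α f = 0) : f = 0 := by
  ext z
  rw [eq_ofComplex z]
  refine eq_zero_of_eq_zero_on_imaginary (mem_Hol_iff.mp hf) (fun y hy => ?_) fun σ => (z σ).im_pos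
  have := eq_zero_of_eq_zero_on_integers (continuousOn_diagonal hf (τ := Complex.I) (by simp))
    (fun α hα r hr => by
      rw [← diagRestrict_ofComplex f α hr (by simp), h α hα]; rfl) hy
  simpa [reImPoint] using this

/-- A holomorphic function with constant restrictions to all diagonals is invariant under positive
dilations. -/
lemma dilation_invariant_of_diagRestrict_const {f : PolyUpperHalfPlane K → ℂ} (hf : f ∈ Hol K)
    (h : ∀ α : 𝓞 K, (∀ σ : K →+* ℝ, 0 < σ (α : K)) → ∃ c, diagRestrict α f = fun _ => c)
    {r : ℝ} (hr : 0 < r) {w : (K →+* ℝ) → ℂ} (hw : w ∈ tube (K →+* ℝ)) :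
    f (fun σ => ofComplex (r * w σ)) = f (fun σ => ofComplex (w σ)) := by
  have hmaps : Set.MapsTo (fun w : (K →+* ℝ) → ℂ => fun σ => (r : ℂ) * w σ) (tube (K →+* ℝ))
      (tube (K →+* ℝ)) := fun w hw σ => by simpa using mul_pos hr (hw σ)
  have hd : DifferentiableOn ℂ (fun w : (K →+* ℝ) → ℂ =>
      f (fun σ => ofComplex (r * w σ)) - f (fun σ => ofComplex (w σ))) (tube (K →+* ℝ)) := by
    refine DifferentiableOn.sub ?_ (mem_Hol_iff.mp hf)
    exact (mem_Hol_iff.mp hf).comp (by rw [differentiableOn_pi]; intro σ; fun_prop) hmaps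
  rw [← sub_eq_zero]
  refine eq_zero_of_eq_zero_on_imaginary hd (fun y hy => ?_) hw
  have h1 : 0 < ((r : ℂ) * Complex.I).im := by simpa using hr
  have := eq_zero_of_eq_zero_on_integers
    ((continuousOn_diagonal hf h1).sub (continuousOn_diagonal hf (τ := Complex.I) (by simp)))
    (fun α hα s hs => by
      obtain ⟨c, hc⟩ := h α hα
      simp only [Pi.sub_apply]
      rw [← diagRestrict_ofComplex f α hs h1, ← diagRestrict_ofComplex f α hs (by simp), hc,
        sub_self]) hy
  simp only [Pi.sub_apply] at this
  rw [← this]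
  simp only [reImPoint, Pi.zero_apply, Complex.ofReal_zero, zero_add]
  congr 3
  ext σ : 1; congr 1; ring

/-- A holomorphic function on the tube that is invariant under all real translations is constant. -/
lemma eq_of_translation_invariant {ι : Type*} [Fintype ι] {G : (ι → ℂ) → ℂ}
    (hG : DifferentiableOn ℂ G (tube ι))
    (h : ∀ w ∈ tube ι, ∀ x : ι → ℝ, G (w + fun i => (x i : ℂ)) = G w) {w w' : ι → ℂ}
    (hw : w ∈ tube ι) (hw' : w' ∈ tube ι) : G w = G w' := by
  classical
  have hconv : Convex ℝ (tube ι) := by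
    intro u hu v hv a b ha hb hab i
    have : (a • u + b • v) i = a • u i + b • v i := rfl
    rw [this]
    exact (convex_halfSpace_im_gt 0) (hu i) (hv i) ha hb hab
  refine IsOpen.is_const_of_fderiv_eq_zero (𝕜 := ℂ) isOpen_tube hconv.isPreconnected hG
    (fun u hu => ?_) hw hw'
  have hd : HasFDerivAt G (fderiv ℂ G u) u :=
    (hG.differentiableAt (isOpen_tube.mem_nhds hu)).hasFDerivAt
  ext v
  -- the derivative vanishes in real directions, and these span
  have hreal : ∀ x : ι → ℝ, fderiv ℂ G u (fun i => (x i : ℂ)) = 0 := by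
    intro x
    have h1 : HasDerivAt (fun t : ℂ => G (u + t • fun i => (x i : ℂ)))
        (fderiv ℂ G u (fun i => (x i : ℂ))) 0 := hd.hasLineDerivAt _
    have h2 : HasDerivAt (fun t : ℝ => G (u + (t : ℂ) • fun i => (x i : ℂ)))
        (fderiv ℂ G u (fun i => (x i : ℂ))) 0 := HasDerivAt.comp_ofReal (by simpa using! h1)
    have h3 : (fun t : ℝ => G (u + (t : ℂ) • fun i => (x i : ℂ))) = fun _ => G u := by
      ext t
      have := h u hu (t • x)
      rw [← this]
      congr 1; ext i; simp
    rw [h3] at h2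
    exact h2.unique (hasDerivAt_const _ _)
  have hv : v = (fun i => ((v i).re : ℂ)) + Complex.I • fun i => ((v i).im : ℂ) := by
    ext i; simp [mul_comm Complex.I]
  rw [hv, map_add, map_smul, hreal, hreal]; simp

/-- A modular form with constant restrictions to all diagonals is constant: it is invariant under
the dilates of a lattice of translations, hence under all real translations. -/
lemma IsModularForm.const_of_diagRestrict_const {κ : (K →+* ℝ) → ℤ} {f : PolyUpperHalfPlane K → ℂ}
    (hf : IsModularForm κ f)
    (h : ∀ α : 𝓞 K, (∀ σ : K →+* ℝ, 0 < σ (α : K)) → ∃ c, diagRestrict α f = fun _ => c) :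
    ∃ c, f = fun _ => c := by
  obtain ⟨b, hb⟩ := exists_basis_of_slash_eq (α := 1) one_ne_zero (fun γ _ _ _ => hf.slash_eq γ)
  have hdil := fun {r : ℝ} (hr : 0 < r) {w : (K →+* ℝ) → ℂ} (hw : w ∈ tube (K →+* ℝ)) =>
    dilation_invariant_of_diagRestrict_const hf.1 h hr hw
  set G : ((K →+* ℝ) → ℂ) → ℂ := fun w => f (fun σ => ofComplex (w σ)) with hGdef
  have htube : ∀ {w : (K →+* ℝ) → ℂ} (x : (K →+* ℝ) → ℝ), w ∈ tube (K →+* ℝ) →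
      (w + fun i => (x i : ℂ)) ∈ tube (K →+* ℝ) := by
    intro w x hw i; simpa using hw i
  -- dilating turns the lattice of periods into all real multiples of it
  have hpos : ∀ j, ∀ r : ℝ, 0 < r → ∀ w ∈ tube (K →+* ℝ),
      G (w + fun i => ((r * b j i : ℝ) : ℂ)) = G w := by
    intro j r hr w hw
    have hr' : (r : ℂ) ≠ 0 := by exact_mod_cast hr.ne'
    have hw' : (fun i => ((r⁻¹ : ℝ) : ℂ) * w i) ∈ tube (K →+* ℝ) := fun i => by
      rw [Complex.im_ofReal_mul]; exact mul_pos (inv_pos.mpr hr) (hw i)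
    have h1 := hb j _ hw'
    have h2 := hdil hr (htube (b j) hw')
    have h3 := hdil hr hw'
    have e1 : (fun i => (r : ℂ) * ((fun i => ((r⁻¹ : ℝ) : ℂ) * w i) + fun i => (b j i : ℂ)) i) =
        w + fun i => ((r * b j i : ℝ) : ℂ) := by
      ext i; simp [mul_add, hr']
    have e2 : (fun i => (r : ℂ) * (((r⁻¹ : ℝ) : ℂ) * w i)) = w := by
      ext i; simp [hr']
    calc G (w + fun i => ((r * b j i : ℝ) : ℂ)) = _ := by rw [← e1]
      _ = _ := h2
      _ = _ := h1
      _ = _ := h3.symm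
      _ = G (fun i => (r : ℂ) * (((r⁻¹ : ℝ) : ℂ) * w i)) := rfl
      _ = G w := by rw [e2]
  have hall : ∀ j, ∀ r : ℝ, ∀ w ∈ tube (K →+* ℝ),
      G (w + fun i => ((r * b j i : ℝ) : ℂ)) = G w := by
    intro j r w hw
    rcases lt_trichotomy r 0 with hr | rfl | hr
    · have := hpos j (-r) (by linarith) _ (htube (fun i => r * b j i) hw)
      rw [← this]
      congr 1; ext i; simp
    · congr 1; ext i; simp
    · exact hpos j r hr w hw
  have hspan : ∀ x ∈ Submodule.span ℝ (Set.range b), ∀ a : ℝ, ∀ w ∈ tube (K →+* ℝ),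
      G (w + fun i => ((a * x i : ℝ) : ℂ)) = G w := by
    intro x hx
    induction hx using Submodule.span_induction with
    | mem x hx =>
      obtain ⟨j, rfl⟩ := hx
      exact hall j
    | zero => intro a w _; congr 1; ext i; simp
    | add x y _ _ hx hy =>
      intro a w hw
      rw [← hx a w hw, ← hy a _ (htube (fun i => a * x i) hw)]
      congr 1; ext i; simp [add_assoc, mul_add]
    | smul c x _ hx =>
      intro a w hw
      rw [← hx (a * c) w hw]
      congr 1; ext i; simp [mul_assoc]
  refine ⟨G (fun _ => Complex.I), ?_⟩
  ext z
  have h1 := eq_of_translation_invariant (G := G) (mem_Hol_iff.mp hf.1)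
    (fun w hw x => by simpa using hspan x (by rw [b.span_eq]; trivial) 1 w hw)
    (w := fun σ => (z σ : ℂ)) (w' := fun _ => Complex.I) (fun σ => (z σ).im_pos)
    (fun _ => by simp)
  rw [← h1]
  exact congrArg f (eq_ofComplex z)

omit [NumberField.IsTotallyReal K] in
lemma IsModularForm.weight_eq_zero_of_const {κ : (K →+* ℝ) → ℤ} {c : ℂ} (hc : c ≠ 0)
    (hf : IsModularForm κ (fun _ : PolyUpperHalfPlane K => c)) : κ = 0 := by
  classical
  ext σ
  let S : SL(2, 𝓞 K) := ⟨!![0, -1; 1, 0], by simp⟩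
  have haut : ∀ (z : PolyUpperHalfPlane K) (τ), autFactor S z τ = z τ := by
    intro z τ; simp [autFactor, lowerLeft, S]
  have key : ∀ z : PolyUpperHalfPlane K, ∏ τ, ((z τ : ℂ)) ^ κ τ = 1 := by
    intro z
    have := hf.2 z S
    simp only [haut] at this
    exact mul_right_cancel₀ hc (by rw [← this, one_mul])
  -- compare the points `(i, …, i)` and `(i, …, 2i, …, i)`
  have h1 := key (fun _ => UpperHalfPlane.I)
  have h2 := key (fun τ => if τ = σ then scaleGL 2 two_pos • UpperHalfPlane.I else UpperHalfPlane.I)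
  have h3 : ((scaleGL 2 two_pos • UpperHalfPlane.I : ℍ) : ℂ) = 2 * Complex.I := by
    rw [scaleGL_smul, ofComplex_apply_of_im_pos (by simp)]; simp
  rw [← Finset.mul_prod_erase _ _ (Finset.mem_univ σ)] at h1 h2
  rw [if_pos rfl, h3, Finset.prod_congr rfl (fun τ hτ => by
    rw [if_neg (Finset.ne_of_mem_erase hτ)]), mul_zpow, mul_assoc] at h2
  rw [UpperHalfPlane.coe_I] at h1 h2
  rw [h1, mul_one] at h2
  have h4 : (2 : ℝ) ^ κ σ = 1 := Complex.ofReal_injective (by push_cast; exact h2)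
  rwa [zpow_eq_one_iff_right₀ (by norm_num) (by norm_num)] at h4

/-- The total weight of a nonzero Hilbert modular form is nonnegative, and it vanishes only for
constants. Both follow from the corresponding facts for the elliptic modular forms obtained by
restriction to the diagonals. -/
theorem IsModularForm.weight (hK : 1 < Module.finrank ℚ K) {κ : (K →+* ℝ) → ℤ}
    {f : PolyUpperHalfPlane K → ℂ} (hf : IsModularForm κ f) (h0 : f ≠ 0) :
    0 ≤ ∑ σ, κ σ ∧ (∑ σ, κ σ = 0 → κ = 0 ∧ ∃ c : ℂ, c ≠ 0 ∧ f = fun _ => c) := by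
  refine ⟨?_, fun hκ => ?_⟩
  · by_contra! hneg
    refine h0 (eq_zero_of_diagRestrict_eq_zero hf.1 fun α hα => ?_)
    obtain ⟨N, hN, g, hg⟩ := hf.exists_modularForm_diagRestrict hK hα
    rw [← hg, ModularForm.isZero_of_neg_weight hneg g]; rfl
  · obtain ⟨c, hc⟩ := hf.const_of_diagRestrict_const fun α hα => by
      obtain ⟨N, hN, g, hg⟩ := hf.exists_modularForm_diagRestrict hK hα
      have hconst : ∀ k : ℤ, k = 0 → ∀ g : ModularForm ((Gamma N).map (mapGL ℝ)) k,
          ∃ c, (g : ℍ → ℂ) = fun _ => c := by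
        rintro _ rfl g; exact ModularForm.eq_const_of_weight_zero g
      rw [← hg]
      exact hconst _ hκ g
    have hc0 : c ≠ 0 := by
      rintro rfl; exact h0 hc
    subst hc
    exact ⟨hf.weight_eq_zero_of_const hc0, c, hc0, rfl⟩

end Weight

/-! ### There is no Hilbert analogue of `E₂` -/

section NoEisensteinTwo

open UpperHalfPlane ModularForm Matrix.SpecialLinearGroup EisensteinSeries Filter
open scoped Topology Manifold

/-- The constant term of `E₂` is nonzero. -/
lemma not_isZeroAtImInfty_E2 : ¬ IsZeroAtImInfty E2 := by
  intro h0
  let q : ℍ → ℂ := fun τ => Function.Periodic.qParam 1 τ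
  have hq0 : ∀ τ, q τ ≠ 0 := fun τ => Complex.exp_ne_zero _
  have hb : IsBoundedAtImInfty (fun τ => (E2 τ - 1) / q τ) := by
    refine isBoundedAtImInfty_of_hasSum_qExpansion (c := fun m =>
      (-24 * ArithmeticFunction.sigma 1 (m + 1) : ℂ)) one_pos fun τ => ?_
    have h1 := (hasSum_nat_add_iff' 1).mpr (hasSum_qExpansion_E2 (z := τ))
    have h2 := h1.div_const (q τ)
    simp only [Finset.range_one, Finset.sum_singleton, if_true, pow_zero, one_smul] at h2
    refine h2.congr_fun fun m => ?_
    simp only [Nat.add_eq_zero_iff, one_ne_zero, and_false, if_false, smul_eq_mul, pow_succ]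
    have hq : Complex.exp (2 * Real.pi * Complex.I * τ) = q τ := by
      simp only [q, Function.Periodic.qParam, Complex.ofReal_one, div_one]
    rw [hq, ← mul_assoc, mul_div_cancel_right₀ _ (hq0 τ)]
  have hqt : Tendsto q atImInfty (𝓝 0) := qParam_tendsto_atImInfty one_pos
  have h1 : Tendsto (fun τ => E2 τ - (E2 τ - 1) / q τ * q τ) atImInfty (𝓝 (0 - 0)) := by
    exact Tendsto.sub h0 (hb.mul_zeroAtFilter hqt)
  have h2 : (fun τ => E2 τ - (E2 τ - 1) / q τ * q τ) = fun _ => 1 := by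
    ext τ; rw [div_mul_cancel₀ _ (hq0 τ)]; ring
  rw [h2, sub_zero] at h1
  exact one_ne_zero (tendsto_nhds_unique tendsto_const_nhds h1)

/-- A function on the upper half plane that vanishes at `i∞` cannot satisfy the transformation law
of a nonzero multiple of `E₂`: subtracting that multiple gives a modular form of weight two and
level one. -/
lemma eq_zero_of_quasimodular_weight_two {g : ℍ → ℂ} (hg : MDiff g) (h0 : IsZeroAtImInfty g) {μ : ℂ}
    (h : ∀ (γ : SL(2, ℤ)) (τ : ℍ), g (γ • τ) =
      denom γ τ ^ 2 * (g τ + μ * ((γ 1 0 : ℂ) / denom γ τ))) : μ = 0 := by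
  have hpi : (2 * Real.pi * Complex.I : ℂ) ≠ 0 := Complex.two_pi_I_ne_zero
  have hz : riemannZeta 2 ≠ 0 := by
    rw [riemannZeta_two]
    exact div_ne_zero (pow_ne_zero _ (Complex.ofReal_ne_zero.mpr Real.pi_ne_zero)) (by norm_num)
  set ν : ℂ := μ / (2 * Real.pi * Complex.I) * (2 * riemannZeta 2) with hν
  have hslash : ∀ γ : SL(2, ℤ), (g + ν • E2) ∣[(2 : ℤ)] γ = g + ν • E2 := by
    intro γ
    rw [SlashAction.add_slash, SL_smul_slash, E2_slash_action]
    ext τ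
    have hd := denom_ne_zero γ τ
    have h1 : (g ∣[(2 : ℤ)] γ) τ = g τ + μ * ((γ 1 0 : ℂ) / denom γ τ) := by
      rw [SL_slash_apply, h, zpow_neg, mul_comm, ← mul_assoc]
      norm_cast
      rw [inv_mul_cancel₀ (pow_ne_zero _ hd), one_mul]
    simp only [Pi.add_apply, h1, Pi.smul_apply, Pi.sub_apply, smul_eq_mul, D2, hν]
    field_simp
    ring
  have hmd : MDiff (g + ν • E2) := hg.add (E2_mdifferentiable.const_smul ν)
  let G : ModularForm (mapGL ℝ : SL(2, ℤ) →* GL (Fin 2) ℝ).range 2 :=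
    { toFun := g + ν • E2
      slash_action_eq' := by rintro _ ⟨γ, rfl⟩; exact hslash γ
      holo' := hmd
      bdd_at_cusps' := by
        intro c hc
        rw [OnePoint.isBoundedAt_iff_forall_SL2Z hc]
        intro γ _
        rw [hslash]
        exact h0.isBoundedAtImInfty.add (isBoundedAtImInfty_E2.const_smul_left ν) }
  have hG : G = 0 := rank_zero_iff_forall_zero.mp levelOne_weight_two_rank_zero G
  have h2 : g + ν • E2 = 0 := congrArg (fun F : ModularForm _ 2 => (F : ℍ → ℂ)) hG
  by_contra hμ
  have hν0 : ν ≠ 0 := by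
    rw [hν]; exact mul_ne_zero (div_ne_zero hμ hpi) (mul_ne_zero two_ne_zero hz)
  have h3 : E2 = (-ν⁻¹) • g := by
    ext τ
    have := congrFun h2 τ
    simp only [Pi.add_apply, Pi.smul_apply, smul_eq_mul, Pi.zero_apply] at this ⊢
    field_simp
    linear_combination this
  refine not_isZeroAtImInfty_E2 ?_
  rw [h3]
  have := Tendsto.const_smul h0 (-ν⁻¹)
  simpa [IsZeroAtImInfty, ZeroAtFilter] using! this

variable {K : Type*} [Field K] [NumberField K] [NumberField.IsTotallyReal K]

/-- If `F` has the transformation law of a quasi-modular form of weight `2 e_σ` and depth at most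
one with constant leading coefficient `μ X_σ`, then `μ = 0`. The units force `F` to vanish at the
cusp at infinity, and restriction to the diagonal reduces to one variable. -/
theorem eq_zero_of_quasimodular_weight_two_single (hK : 1 < Module.finrank ℚ K) (σ : K →+* ℝ)
    {F : PolyUpperHalfPlane K → ℂ} (hF : F ∈ Hol K) {μ : ℂ}
    (h : ∀ (z : PolyUpperHalfPlane K) (γ : SL(2, 𝓞 K)), F (act γ z) =
      autFactor γ z σ ^ 2 * (F z + μ * (lowerLeft γ σ / autFactor γ z σ))) : μ = 0 := by
  classical
  let κ : (K →+* ℝ) → ℤ := Pi.single σ 2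
  have hκ : ∀ x : (K →+* ℝ) → ℂ, ∏ τ, x τ ^ κ τ = x σ ^ 2 := by
    intro x
    rw [Finset.prod_eq_single σ]
    · simp [κ]
    · intro τ _ hτ; simp [κ, hτ]
    · simp
  have hinv : ∀ γ : SL(2, 𝓞 K), γ 1 0 = 0 → (1 : 𝓞 K) ∣ γ 0 1 → (1 : 𝓞 K) ∣ γ 0 0 - γ 1 1 →
      slash κ (glConj γ) F = F := by
    intro γ h10 _ _
    rw [slash_glConj_eq_iff]
    intro z
    rw [hκ, h]
    simp [lowerLeft, h10]
  obtain ⟨B, hB0, hB⟩ := exists_bound_of_slash_eq hF one_ne_zero hinv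
  obtain ⟨u, -, hu, -⟩ := exists_unit_expanding hK (α := (1 : 𝓞 K)) one_ne_zero σ
  -- the dilation by `u ^ (2 m)` multiplies the supremum of `F` by `(σ u) ^ (-2 m)`
  have hsmall : ∀ m : ℕ, ∀ x, ‖F (fun i => ofComplex (reImPoint x
      (fun i => (i (u : 𝓞 K) : ℝ) ^ (2 * m)) i))‖ ≤ B * (|σ (u : 𝓞 K)| ^ (2 * m))⁻¹ := by
    intro m x
    have hne : ∀ i : K →+* ℝ, (i (u : 𝓞 K) : ℝ) ≠ 0 := fun i => by simp
    have h1 := apply_of_slash_eq_of_upper hinv (u ^ m) 0 (one_dvd _) (one_dvd _)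
      (w := reImPoint (fun i => ((i (u : 𝓞 K) : ℝ) ^ (2 * m))⁻¹ * x i) 1)
      (reImPoint_mem_tube (by simp))
    have h2 : ∀ i : K →+* ℝ, (((i ((u ^ m : (𝓞 K)ˣ) : 𝓞 K) : ℝ) : ℂ) ^ 2 *
        reImPoint (fun i => ((i (u : 𝓞 K) : ℝ) ^ (2 * m))⁻¹ * x i) 1 i +
        ((i ((u ^ m : (𝓞 K)ˣ) : 𝓞 K) : ℝ) : ℂ) * ((i ((0 : 𝓞 K) : K) : ℝ) : ℂ)) =
        reImPoint x (fun i => (i (u : 𝓞 K) : ℝ) ^ (2 * m)) i := by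
      intro i
      have : ((i (u : 𝓞 K) : ℝ) : ℂ) ≠ 0 := by exact_mod_cast hne i
      have h3 : ((i ((u ^ m : (𝓞 K)ˣ) : 𝓞 K) : ℝ) : ℂ) = ((i (u : 𝓞 K) : ℝ) : ℂ) ^ m := by
        rw [Units.val_pow_eq_pow_val]; push_cast; simp
      rw [h3]
      simp only [reImPoint, Pi.one_apply, map_zero, Complex.ofReal_zero, mul_zero, add_zero]
      push_cast
      field_simp
      ring
    simp only [h2] at h1
    rw [h1, norm_mul, mul_comm]
    have h3 : ∏ i : K →+* ℝ, ((i ((u ^ m : (𝓞 K)ˣ) : 𝓞 K) : ℝ) : ℂ) ^ (-κ i) =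
        ((((σ (u : 𝓞 K) : ℝ) : ℂ)) ^ (2 * m))⁻¹ := by
      simp only [zpow_neg, Finset.prod_inv_distrib]
      rw [hκ]
      simp [Units.val_pow_eq_pow_val, ← pow_mul, mul_comm]
    rw [h3, norm_inv, norm_pow, Complex.norm_real, Real.norm_eq_abs]
    gcongr
    exact hB _
  have hcoe : ∀ τ : ℍ, (fun _ : K →+* ℝ => ofComplex (τ : ℂ)) = fun _ => τ := by
    intro τ; ext; simp [ofComplex_apply]
  set g : ℍ → ℂ := fun τ => F (fun _ => τ) with hg
  refine eq_zero_of_quasimodular_weight_two (g := g) ?_ ?_ ?_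
  · rw [UpperHalfPlane.mdifferentiable_iff]
    have h1 : DifferentiableOn ℂ (fun w : ℂ => fun _ : K →+* ℝ => w) {w | 0 < w.im} := by
      rw [differentiableOn_pi]; intro σ; fun_prop
    exact (mem_Hol_iff.mp hF).comp h1 (fun w hw σ => hw)
  · rw [isZeroAtImInfty_iff]
    intro ε hε
    obtain ⟨m, hm⟩ : ∃ m : ℕ, B * (|σ (u : 𝓞 K)| ^ (2 * m))⁻¹ ≤ ε := by
      have h1 : Tendsto (fun m : ℕ => B * ((|σ (u : 𝓞 K)| ^ 2) ^ m)⁻¹) atTop (𝓝 (B * 0)) :=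
        (tendsto_pow_atTop_atTop_of_one_lt (one_lt_pow₀ hu two_ne_zero)).inv_tendsto_atTop.const_mul
          B
      rw [mul_zero] at h1
      obtain ⟨m, hm⟩ := (h1.eventually_le_const hε).exists
      exact ⟨m, by rwa [pow_mul]⟩
    obtain ⟨A, hA⟩ := (Set.finite_range (fun i : K →+* ℝ => (i (u : 𝓞 K) : ℝ) ^ (2 * m))).bddAbove
    refine ⟨A + 1, fun τ hτ => ?_⟩
    have h2 := koecher_of_slash_eq hK hF one_ne_zero hinv
      (y := fun i => (i (u : 𝓞 K) : ℝ) ^ (2 * m)) (y' := fun _ => τ.im) (fun i => by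
        have : (i (u : 𝓞 K) : ℝ) ≠ 0 := by simp
        rw [pow_mul]; positivity)
      (fun i => lt_of_le_of_lt (hA ⟨i, rfl⟩) (by linarith)) (hsmall m) (fun _ => τ.re)
    refine le_trans (le_of_eq ?_) (h2.trans hm)
    change ‖F (fun _ => τ)‖ = _
    congr 2
    rw [← hcoe τ]
    ext i : 1
    congr 1
    simpa [reImPoint] using (Complex.re_add_im (τ : ℂ)).symm
  · intro γ τ
    let γ' : SL(2, 𝓞 K) := Matrix.SpecialLinearGroup.map (Int.castRingHom (𝓞 K)) γ
    have h1 := h (fun _ => τ) γ'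
    have h2 : glConj γ' = fun _ : K →+* ℝ => mapGL ℝ γ := by
      ext i : 1
      apply Units.ext
      ext a b
      change i ((γ' a b : 𝓞 K) : K) = ((γ a b : ℤ) : ℝ)
      simp [γ']
    have h3 : act γ' (fun _ : K →+* ℝ => τ) = fun _ => γ • τ := by
      ext i : 1
      rw [act_apply, h2]; rfl
    have h4 : autFactor γ' (fun _ : K →+* ℝ => τ) σ = denom γ τ := by
      rw [autFactor_eq_denom, h2]; rfl
    have h5 : lowerLeft γ' σ = (γ 1 0 : ℂ) := by
      simp [lowerLeft, γ']
    rw [h3, h4, h5] at h1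
    exact h1

end NoEisensteinTwo

/-! ### Independence of the automorphy factors -/

section Independence

variable {K : Type*} [Field K] [NumberField K] [NumberField.IsTotallyReal K]

/-- The conjugate vectors of the integers of `K` are Zariski dense in `ℂⁿ`. -/
lemma mvPolynomial_eq_zero_of_forall_integers (R : MvPolynomial (K →+* ℝ) ℂ)
    (h : ∀ c : 𝓞 K, MvPolynomial.eval (fun σ => ((σ (c : K) : ℝ) : ℂ)) R = 0) : R = 0 := by
  classical
  obtain ⟨b, hb⟩ := exists_basis_conjugates (K := K) (α := 1) one_ne_zero
  choose β hβ using hb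
  -- in the coordinates of an integral basis, `R` vanishes at all integer points
  let R' : MvPolynomial (K →+* ℝ) ℂ := MvPolynomial.aeval
    (fun σ => ∑ j, MvPolynomial.C ((b j σ : ℝ) : ℂ) * MvPolynomial.X j) R
  have hR' : ∀ x : (K →+* ℝ) → ℂ, MvPolynomial.eval x R' =
      MvPolynomial.eval (fun σ => ∑ j, ((b j σ : ℝ) : ℂ) * x j) R := by
    intro x
    simp only [R', ← MvPolynomial.coe_aeval_eq_eval, RingHom.coe_coe]
    rw [← AlgHom.comp_apply, MvPolynomial.comp_aeval]
    simp [MvPolynomial.aeval_eq_eval]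
  have hR0 : R' = 0 := by
    refine MvPolynomial.funext_set (fun _ => Set.range ((↑) : ℤ → ℂ))
      (fun _ => Set.infinite_range_of_injective Int.cast_injective) fun x hx => ?_
    have hx' : ∀ j, ∃ m : ℤ, (m : ℂ) = x j := fun j => hx j (Set.mem_univ j)
    choose m hm using hx'
    rw [hR', map_zero, ← h (∑ j, m j * β j)]
    congr 2
    ext σ
    simp [← hm, hβ, mul_comm]
  refine MvPolynomial.funext_set (fun _ => Set.range ((↑) : ℝ → ℂ))
      (fun _ => Set.infinite_range_of_injective Complex.ofReal_injective) fun x hx => ?_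
  have hx' : ∀ j, ∃ m : ℝ, (m : ℂ) = x j := fun j => hx j (Set.mem_univ j)
  choose y hy using hx'
  have h1 := hR' (fun j => ((b.repr y j : ℝ) : ℂ))
  rw [hR0, map_zero] at h1
  rw [map_zero, h1]
  congr 2
  ext σ
  have h2 := congrFun (b.sum_repr y) σ
  rw [← hy, ← h2]
  simp [mul_comm]

/-- The function `∏ (c_σ z_σ + d_σ) ^ a_σ * (c_σ / (c_σ z_σ + d_σ)) ^ m_σ` of `γ = (*, *; c, d)`
attached to a pair `x = (a, m)` of exponents and to a point `z` of `ℍⁿ`. -/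
def autMonomial (z : PolyUpperHalfPlane K) (x : ((K →+* ℝ) → ℤ) × ((K →+* ℝ) → ℕ))
    (γ : SL(2, 𝓞 K)) : ℂ :=
  (∏ σ, autFactor γ z σ ^ x.1 σ) * ∏ σ, (lowerLeft γ σ / autFactor γ z σ) ^ x.2 σ

/-- At a fixed point of `ℍⁿ`, the pairs `(c z + d, c)` are Zariski dense, since `c` and `t` can be
prescribed in `(1, t; c, c t + 1)`. -/
lemma mvPolynomial_eq_zero_of_forall_autFactor (z : PolyUpperHalfPlane K)
    (Q : MvPolynomial ((K →+* ℝ) ⊕ (K →+* ℝ)) ℂ)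
    (h : ∀ γ : SL(2, 𝓞 K), MvPolynomial.eval (Sum.elim (autFactor γ z) (lowerLeft γ)) Q = 0) :
    Q = 0 := by
  classical
  have h1 : ∀ c t : 𝓞 K, MvPolynomial.eval (Sum.elim
      (fun σ => ((σ c : ℝ) : ℂ) * (z σ + ((σ t : ℝ) : ℂ)) + 1)
      (fun σ => ((σ c : ℝ) : ℂ))) Q = 0 := by
    intro c t
    have := h ⟨!![1, t; c, c * t + 1], by rw [Matrix.det_fin_two_of]; ring⟩
    convert this using 3
    ext (σ | σ)
    · simp [autFactor, lowerLeft]; ring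
    · simp [lowerLeft]
  -- `c`, and then `t`, can be replaced by arbitrary complex vectors
  have h2 : ∀ (t : 𝓞 K) (C : (K →+* ℝ) → ℂ), MvPolynomial.eval (Sum.elim
      (fun σ => C σ * (z σ + ((σ t : ℝ) : ℂ)) + 1) C) Q = 0 := by
    intro t C
    have h3 : ∀ C : (K →+* ℝ) → ℂ, MvPolynomial.eval C (MvPolynomial.aeval (Sum.elim
        (fun σ => MvPolynomial.X σ * MvPolynomial.C (z σ + ((σ t : ℝ) : ℂ)) + 1)
        MvPolynomial.X) Q) = MvPolynomial.eval (Sum.elim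
          (fun σ => C σ * (z σ + ((σ t : ℝ) : ℂ)) + 1) C) Q := by
      intro C
      simp only [← MvPolynomial.coe_aeval_eq_eval, RingHom.coe_coe]
      rw [← AlgHom.comp_apply, MvPolynomial.comp_aeval]
      congr 2
      ext (σ | σ) <;> simp [MvPolynomial.aeval_eq_eval]
    rw [← h3, mvPolynomial_eq_zero_of_forall_integers _ fun c => (h3 _).trans (h1 c t), map_zero]
  have h4 : ∀ T C : (K →+* ℝ) → ℂ, MvPolynomial.eval (Sum.elim
      (fun σ => C σ * (z σ + T σ) + 1) C) Q = 0 := by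
    intro T C
    have h3 : ∀ T : (K →+* ℝ) → ℂ, MvPolynomial.eval T (MvPolynomial.aeval (Sum.elim
        (fun σ => MvPolynomial.C (C σ) * (MvPolynomial.C (z σ : ℂ) + MvPolynomial.X σ) + 1)
        (fun σ => MvPolynomial.C (C σ))) Q) = MvPolynomial.eval (Sum.elim
          (fun σ => C σ * (z σ + T σ) + 1) C) Q := by
      intro C
      simp only [← MvPolynomial.coe_aeval_eq_eval, RingHom.coe_coe]
      rw [← AlgHom.comp_apply, MvPolynomial.comp_aeval]
      congr 2
      ext (σ | σ) <;> simp [MvPolynomial.aeval_eq_eval]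
    rw [← h3, mvPolynomial_eq_zero_of_forall_integers _ fun t => (h3 _).trans (h2 t C), map_zero]
  refine MvPolynomial.funext_set (fun _ => {0}ᶜ) (fun _ => (Set.finite_singleton 0).infinite_compl)
    fun x hx => ?_
  have hx0 : ∀ j, x j ≠ 0 := fun j => hx j (Set.mem_univ j)
  rw [map_zero, ← h4 (fun σ => (x (Sum.inl σ) - 1) / x (Sum.inr σ) - z σ) (fun σ => x (Sum.inr σ))]
  congr 2
  ext (σ | σ)
  · have := hx0 (Sum.inr σ)
    simp only [Sum.elim_inl]
    field_simp
    ring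
  · rfl

/-- At a fixed point of `ℍⁿ`, the monomials in the automorphy factors `c z + d` and in the quotients
`c / (c z + d)` are linearly independent functions on the Hilbert modular group. -/
theorem linearIndependent_autMonomial (z : PolyUpperHalfPlane K) :
    LinearIndependent ℂ (autMonomial z) := by
  classical
  rw [linearIndependent_iff']
  intro s g hg
  -- multiplying by a large power of `∏ (c_σ z_σ + d_σ)` removes the denominators
  obtain ⟨A, hA⟩ : ∃ A : ℕ, ∀ x ∈ s, ∀ σ, 0 ≤ x.1 σ - x.2 σ + A := by
    refine ⟨∑ x ∈ s, ∑ σ, (x.1 σ - x.2 σ).natAbs, fun x hx σ => ?_⟩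
    have h1 : (x.1 σ - x.2 σ).natAbs ≤ ∑ σ, (x.1 σ - x.2 σ).natAbs :=
      Finset.single_le_sum (f := fun σ => (x.1 σ - x.2 σ).natAbs) (fun _ _ => Nat.zero_le _)
        (Finset.mem_univ σ)
    have h2 : ∑ σ, (x.1 σ - x.2 σ).natAbs ≤ ∑ x ∈ s, ∑ σ, (x.1 σ - x.2 σ).natAbs :=
      Finset.single_le_sum (f := fun x => ∑ σ, (x.1 σ - x.2 σ).natAbs)
        (fun _ _ => Nat.zero_le _) hx
    omega
  let e : ((K →+* ℝ) → ℤ) × ((K →+* ℝ) → ℕ) → ((K →+* ℝ) ⊕ (K →+* ℝ)) →₀ ℕ := fun x =>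
    Finsupp.equivFunOnFinite.symm (Sum.elim (fun σ => (x.1 σ - x.2 σ + A).toNat) x.2)
  have he : Set.InjOn e s := by
    intro x hx y hy hxy
    have h1 := Finsupp.equivFunOnFinite.symm.injective hxy
    have h2 : x.2 = y.2 := by ext σ; exact congrFun h1 (Sum.inr σ)
    refine Prod.ext ?_ h2
    ext σ
    have h3 : (x.1 σ - x.2 σ + A).toNat = (y.1 σ - y.2 σ + A).toNat := congrFun h1 (Sum.inl σ)
    have h4 := hA x hx σ
    have h5 := hA y hy σ
    rw [h2] at h3 h4
    omega
  have hQ := mvPolynomial_eq_zero_of_forall_autFactor z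
    (∑ x ∈ s, MvPolynomial.monomial (e x) (g x)) (by
      intro γ
      have h1 := congrFun hg γ
      simp only [Finset.sum_apply, Pi.smul_apply, smul_eq_mul, Pi.zero_apply] at h1
      rw [← mul_zero (∏ σ, autFactor γ z σ ^ A), ← h1, map_sum, Finset.mul_sum]
      refine Finset.sum_congr rfl fun x hx => ?_
      rw [MvPolynomial.eval_monomial, Finsupp.prod_fintype _ _ (by simp), Fintype.prod_sum_type,
        autMonomial, mul_left_comm (∏ σ, _)]
      congr 1
      rw [← Finset.prod_mul_distrib, ← Finset.prod_mul_distrib, ← Finset.prod_mul_distrib]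
      refine Finset.prod_congr rfl fun σ _ => ?_
      have h0 := autFactor_ne_zero γ z σ
      have h2 : (((x.1 σ - x.2 σ + A).toNat : ℕ) : ℤ) = x.1 σ - x.2 σ + A :=
        Int.toNat_of_nonneg (hA x hx σ)
      simp only [e, Finsupp.equivFunOnFinite_symm_apply_apply, Sum.elim_inl, Sum.elim_inr]
      rw [← zpow_natCast (autFactor γ z σ) (Int.toNat _), h2, zpow_add₀ h0, zpow_sub₀ h0, div_pow,
        zpow_natCast, zpow_natCast]
      ring)
  intro x hx
  have h1 := congrArg (MvPolynomial.coeff (e x)) hQ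
  rw [MvPolynomial.coeff_sum, Finset.sum_eq_single x] at h1
  · simpa using h1
  · intro y hy hyx
    rw [MvPolynomial.coeff_monomial, if_neg fun h => hyx (he hy hx h)]
  · exact fun h => absurd hx h

end Independence

/-! ### The coefficients of a quasi-modular form -/

section AffineSubstitution

variable {ι R : Type*} [Fintype ι] [CommRing R]

lemma coeff_prod_affine_pow (α β : ι → R) (r m : ι →₀ ℕ) :
    MvPolynomial.coeff m
      (∏ i, (MvPolynomial.C (α i) * MvPolynomial.X i + MvPolynomial.C (β i)) ^ r i) =
      ∏ i, α i ^ m i * β i ^ (r i - m i) * (r i).choose (m i) := by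
  classical
  simp_rw [add_pow]
  rw [Finset.prod_univ_sum, MvPolynomial.coeff_sum]
  have h : ∀ p : ι → ℕ, ∏ i, ((MvPolynomial.C (α i) * MvPolynomial.X i) ^ p i *
      MvPolynomial.C (β i) ^ (r i - p i) * ((r i).choose (p i) : MvPolynomial ι R)) =
      MvPolynomial.monomial (Finsupp.equivFunOnFinite.symm p)
        (∏ i, α i ^ p i * β i ^ (r i - p i) * ((r i).choose (p i) : R)) := by
    intro p
    rw [MvPolynomial.monomial_eq, map_prod, Finsupp.prod_fintype _ _ (by simp),
      ← Finset.prod_mul_distrib]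
    refine Finset.prod_congr rfl fun i _ => ?_
    simp only [map_mul, map_pow, map_natCast, Finsupp.equivFunOnFinite_symm_apply_apply]
    ring
  simp_rw [h, MvPolynomial.coeff_monomial]
  by_cases hm : ∀ i, m i ≤ r i
  · rw [Finset.sum_eq_single ⇑m]
    · rw [if_pos (by ext; simp)]
    · intro p _ hp
      rw [if_neg fun h => hp (by rw [← h]; rfl)]
    · intro hmem
      refine absurd (Fintype.mem_piFinset.mpr fun i => ?_) hmem
      exact Finset.mem_range.mpr (Nat.lt_succ_of_le (hm i))
  · push Not at hm
    obtain ⟨i, hi⟩ := hm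
    rw [Finset.prod_eq_zero (Finset.mem_univ i) (by rw [Nat.choose_eq_zero_of_lt hi]; simp)]
    refine Finset.sum_eq_zero fun p hp => if_neg fun h => ?_
    have := Finset.mem_range.mp (Fintype.mem_piFinset.mp hp i)
    rw [← h, Finsupp.equivFunOnFinite_symm_apply_apply] at hi
    omega

/-- The coefficients of a polynomial after the substitution `X_i ↦ α_i X_i + β_i`. -/
lemma coeff_aeval_affine (α β : ι → R) (Q : MvPolynomial ι R) (m : ι →₀ ℕ) :
    MvPolynomial.coeff m (MvPolynomial.aeval
      (fun i => MvPolynomial.C (α i) * MvPolynomial.X i + MvPolynomial.C (β i)) Q) =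
      ∑ r ∈ Q.support, Q.coeff r * ∏ i, α i ^ m i * β i ^ (r i - m i) * (r i).choose (m i) := by
  rw [MvPolynomial.aeval_def, MvPolynomial.eval₂_eq', MvPolynomial.coeff_sum]
  refine Finset.sum_congr rfl fun r _ => ?_
  rw [MvPolynomial.algebraMap_eq, MvPolynomial.coeff_C_mul, coeff_prod_affine_pow]

/-- A maximal coefficient is only scaled by an affine substitution. -/
lemma coeff_aeval_affine_of_forall_le {α β : ι → R} {Q : MvPolynomial ι R} {m : ι →₀ ℕ}
    (h : ∀ r, Q.coeff r ≠ 0 → m ≤ r → r = m) :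
    MvPolynomial.coeff m (MvPolynomial.aeval
      (fun i => MvPolynomial.C (α i) * MvPolynomial.X i + MvPolynomial.C (β i)) Q) =
      (∏ i, α i ^ m i) * Q.coeff m := by
  classical
  rw [coeff_aeval_affine, Finset.sum_eq_single m]
  · simp [mul_comm]
  · intro r hr hrm
    have : ¬ m ≤ r := fun hle => hrm (h r (MvPolynomial.mem_support_iff.mp hr) hle)
    rw [Finsupp.le_def] at this
    push Not at this
    obtain ⟨i, hi⟩ := this
    rw [Finset.prod_eq_zero (Finset.mem_univ i) (by rw [Nat.choose_eq_zero_of_lt hi]; simp),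
      mul_zero]
  · intro hm
    rw [MvPolynomial.notMem_support_iff.mp hm, zero_mul]

/-- The effect of an affine substitution on the coefficient of index `m`, if the only larger index
with nonzero coefficient is the one exceeding `m` by `e_j`. -/
lemma coeff_aeval_affine_of_forall_le_add_single {α β : ι → R} {Q : MvPolynomial ι R}
    {m : ι →₀ ℕ} {j : ι}
    (h : ∀ r, Q.coeff r ≠ 0 → m ≤ r → r = m ∨ r = m + Finsupp.single j 1) :
    MvPolynomial.coeff m (MvPolynomial.aeval
      (fun i => MvPolynomial.C (α i) * MvPolynomial.X i + MvPolynomial.C (β i)) Q) =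
      (∏ i, α i ^ m i) * (Q.coeff m + (m j + 1) * β j * Q.coeff (m + Finsupp.single j 1)) := by
  classical
  have hne : m ≠ m + Finsupp.single j 1 := by
    intro h
    have := DFunLike.congr_fun h j
    simp at this
  have h1 : ∏ i, α i ^ m i * β i ^ ((m + Finsupp.single j 1 : ι →₀ ℕ) i - m i) *
      (((m + Finsupp.single j 1 : ι →₀ ℕ) i).choose (m i) : R) =
      (∏ i, α i ^ m i) * (β j * (m j + 1)) := by
    simp_rw [mul_assoc]
    rw [Finset.prod_mul_distrib, Finset.prod_eq_single (a := j) (f := fun i =>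
      β i ^ ((m + Finsupp.single j 1 : ι →₀ ℕ) i - m i) *
        (((m + Finsupp.single j 1 : ι →₀ ℕ) i).choose (m i) : R))]
    · simp
    · intro i _ hij
      simp [Ne.symm hij]
    · simp
  have h2 : ∏ i, α i ^ m i * β i ^ (m i - m i) * ((m i).choose (m i) : R) = ∏ i, α i ^ m i := by
    simp
  have h3 : ∑ r ∈ Q.support, Q.coeff r *
      ∏ i, α i ^ m i * β i ^ (r i - m i) * (r i).choose (m i) =
      ∑ r ∈ {m, m + Finsupp.single j 1}, Q.coeff r *
      ∏ i, α i ^ m i * β i ^ (r i - m i) * ((r i).choose (m i) : R) := by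
    refine Finset.sum_congr_of_eq_on_inter ?_ ?_ fun r _ _ => rfl
    · intro r hr hr'
      have : ¬ m ≤ r := fun hle => hr' (by
        simpa using h r (MvPolynomial.mem_support_iff.mp hr) hle)
      rw [Finsupp.le_def] at this
      push Not at this
      obtain ⟨i, hi⟩ := this
      rw [Finset.prod_eq_zero (Finset.mem_univ i) (by rw [Nat.choose_eq_zero_of_lt hi]; simp),
        mul_zero]
    · intro r _ hr
      rw [MvPolynomial.notMem_support_iff.mp hr, zero_mul]
  rw [coeff_aeval_affine, h3, Finset.sum_pair hne, h1, h2]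
  ring

end AffineSubstitution

section Cocycle

variable {K : Type*} [Field K]

lemma act_mul (γ γ' : SL(2, 𝓞 K)) (z : PolyUpperHalfPlane K) :
    act (γ * γ') z = act γ (act γ' z) := by
  ext σ : 1
  simp only [act, conj, map_mul, mul_smul]

lemma autFactor_mul (γ γ' : SL(2, 𝓞 K)) (z : PolyUpperHalfPlane K) (σ : K →+* ℝ) :
    autFactor (γ * γ') z σ = autFactor γ (act γ' z) σ * autFactor γ' z σ := by
  simp only [autFactor_eq_denom, act_apply, glConj_mul, Pi.mul_apply]
  rw [UpperHalfPlane.denom_cocycle_σ, UpperHalfPlane.σ, if_pos (glConj_det γ' σ),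
    ContinuousAlgEquiv.refl_apply]

lemma act_apply_coe (γ : SL(2, 𝓞 K)) (z : PolyUpperHalfPlane K) (σ : K →+* ℝ) :
    ((act γ z σ : ℍ) : ℂ) =
      (((σ (γ 0 0 : K) : ℝ) : ℂ) * z σ + ((σ (γ 0 1 : K) : ℝ) : ℂ)) / autFactor γ z σ := by
  rw [act_apply, UpperHalfPlane.coe_smul_of_det_pos (glConj_det γ σ)]; rfl

/-- The cocycle relation satisfied by `c / (c z + d)`. -/
lemma lowerLeft_div_autFactor_act (γ γ' : SL(2, 𝓞 K)) (z : PolyUpperHalfPlane K) (σ : K →+* ℝ) :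
    lowerLeft γ σ / autFactor γ (act γ' z) σ = autFactor γ' z σ ^ 2 *
      (lowerLeft (γ * γ') σ / autFactor (γ * γ') z σ - lowerLeft γ' σ / autFactor γ' z σ) := by
  have h1 := autFactor_ne_zero γ' z σ
  have h2 := autFactor_ne_zero γ (act γ' z) σ
  have h3 : lowerLeft (γ * γ') σ * autFactor γ' z σ - lowerLeft γ' σ * autFactor (γ * γ') z σ =
      lowerLeft γ σ := by
    have hdet : ((σ ((γ' 0 0 : 𝓞 K) : K) : ℝ) : ℂ) * ((σ (γ' 1 1 : K) : ℝ) : ℂ) -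
        ((σ (γ' 0 1 : K) : ℝ) : ℂ) * ((σ (γ' 1 0 : K) : ℝ) : ℂ) = 1 := by
      have := γ'.det_coe
      rw [Matrix.det_fin_two] at this
      have := congrArg (fun x : 𝓞 K => ((σ (x : K) : ℝ) : ℂ)) this
      simpa using this
    simp only [lowerLeft, autFactor, Matrix.SpecialLinearGroup.coe_mul, Matrix.mul_apply,
      Fin.sum_univ_two]
    push_cast
    simp only [map_add, map_mul]
    push_cast
    linear_combination (((σ (γ 1 0 : K) : ℝ) : ℂ)) * hdet
  rw [autFactor_mul] at h3 ⊢
  field_simp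
  linear_combination -h3

end Cocycle

section Coefficients

variable {K : Type*} [Field K] [NumberField K] [NumberField.IsTotallyReal K]

lemma eval_eq_of_forall_lowerLeft_div_autFactor (z : PolyUpperHalfPlane K)
    {Q Q' : MvPolynomial (K →+* ℝ) ℂ}
    (h : ∀ γ : SL(2, 𝓞 K), MvPolynomial.eval (fun σ => lowerLeft γ σ / autFactor γ z σ) Q =
      MvPolynomial.eval (fun σ => lowerLeft γ σ / autFactor γ z σ) Q') : Q = Q' := by
  classical
  rw [← sub_eq_zero]
  set D := Q - Q' with hD
  have hli := (linearIndependent_autMonomial z).comp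
    (fun m : (K →+* ℝ) →₀ ℕ => ((0 : (K →+* ℝ) → ℤ), (m : (K →+* ℝ) → ℕ)))
    (fun m m' h => DFunLike.coe_injective (Prod.ext_iff.mp h).2)
  rw [linearIndependent_iff'] at hli
  ext m
  by_contra hm
  refine hm (hli D.support (fun m => D.coeff m) ?_ m (MvPolynomial.mem_support_iff.mpr hm))
  ext γ
  have h1 : MvPolynomial.eval (fun σ => lowerLeft γ σ / autFactor γ z σ) D = 0 := by
    rw [hD, map_sub, h, sub_self]
  rw [MvPolynomial.eval_eq'] at h1
  simpa [autMonomial] using h1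

/-- The transformation law of a quasi-modular form determines that of its polynomial: `F (γ' γ z)`
is expanded in two ways, and the coefficients of the polynomials in `X (γ' γ, z)` are compared. -/
lemma map_evalAt_act {w : (K →+* ℝ) → ℤ} {F : PolyUpperHalfPlane K → ℂ}
    {P : MvPolynomial (K →+* ℝ) (Hol K)}
    (hP : ∀ (z : PolyUpperHalfPlane K) (γ : SL(2, 𝓞 K)), F (act γ z) =
      (∏ σ, autFactor γ z σ ^ w σ) *
        MvPolynomial.eval₂ (evalAt K z) (fun σ => lowerLeft γ σ / autFactor γ z σ) P)
    (z : PolyUpperHalfPlane K) (γ : SL(2, 𝓞 K)) :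
    MvPolynomial.map (evalAt K (act γ z)) P = MvPolynomial.C (∏ σ, autFactor γ z σ ^ w σ) *
      MvPolynomial.aeval (fun σ => MvPolynomial.C ((autFactor γ z σ ^ 2)⁻¹) * MvPolynomial.X σ +
        MvPolynomial.C (lowerLeft γ σ / autFactor γ z σ)) (MvPolynomial.map (evalAt K z) P) := by
  refine eval_eq_of_forall_lowerLeft_div_autFactor (act γ z) fun γ' => ?_
  have h1 := hP z (γ' * γ)
  rw [act_mul, hP] at h1
  simp only [autFactor_mul γ' γ, mul_zpow, Finset.prod_mul_distrib, mul_assoc] at h1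
  have h0 : ∏ σ, autFactor γ' (act γ z) σ ^ w σ ≠ 0 :=
    Finset.prod_ne_zero_iff.mpr fun σ _ => zpow_ne_zero _ (autFactor_ne_zero _ _ σ)
  have h2 := mul_left_cancel₀ h0 h1
  rw [MvPolynomial.eval_map, h2, map_mul, MvPolynomial.eval_C]
  congr 1
  rw [← MvPolynomial.eval_map]
  simp only [← MvPolynomial.coe_aeval_eq_eval, RingHom.coe_coe]
  rw [← AlgHom.comp_apply, MvPolynomial.comp_aeval]
  congr 2
  ext σ
  have h3 := autFactor_ne_zero γ z σ
  have h4 := lowerLeft_div_autFactor_act γ' γ z σ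
  simp only [MvPolynomial.aeval_eq_eval, map_add, map_mul, MvPolynomial.eval_C,
    MvPolynomial.eval_X]
  rw [h4, autFactor_mul]
  field_simp
  ring

end Coefficients

/-! ### Weight and depth of quasi-modular forms -/

section WeightDepth

variable {K : Type*} [Field K] [NumberField K]

lemma _root_.Finsupp.eq_of_le_of_sum_le {ι : Type*} [Fintype ι] {m r : ι →₀ ℕ} (h : m ≤ r)
    (hs : ∑ i, r i ≤ ∑ i, m i) : r = m := by
  have h1 := (Finset.sum_eq_sum_iff_of_le (s := Finset.univ) (f := ⇑m) (g := ⇑r)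
    fun i _ => h i).mp (le_antisymm (Finset.sum_le_sum fun i _ => h i) hs)
  ext i
  exact (h1 i (Finset.mem_univ i)).symm

variable [NumberField.IsTotallyReal K]

/-- A nonzero quasi-modular form of weight `w` and depth `s` satisfies `2 s ≤ ∑ w`, and the
inequality is strict if `s > 0`: the top coefficients are modular forms of total weight
`∑ w - 2 s`, and if that is zero, a coefficient of degree `s - 1` contradicts
`eq_zero_of_quasimodular_weight_two_single`. -/
theorem IsQuasiModularForm.two_mul_depth_le (hK : 1 < Module.finrank ℚ K) {w : (K →+* ℝ) → ℤ}
    {s : ℕ} {F : PolyUpperHalfPlane K → ℂ} (hF : IsQuasiModularForm w s F) (h0 : F ≠ 0) :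
    0 ≤ ∑ σ, w σ - 2 * s ∧ (s ≠ 0 → 0 < ∑ σ, w σ - 2 * s) := by
  classical
  obtain ⟨-, P, hs, hP⟩ := hF
  have hP0 : P ≠ 0 := by
    rintro rfl
    refine h0 (funext fun z => ?_)
    have h1 : act (1 : SL(2, 𝓞 K)) z = z := by ext σ : 1; simp [act, conj]
    have := hP z 1
    rw [h1] at this
    simpa using this
  have hcoeff : ∀ (m : (K →+* ℝ) →₀ ℕ) (z : PolyUpperHalfPlane K),
      (MvPolynomial.map (evalAt K z) P).coeff m =
        ((P.coeff m : Hol K) : PolyUpperHalfPlane K → ℂ) z := by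
    intro m z; rw [MvPolynomial.coeff_map]; rfl
  have hne : ∀ (m : (K →+* ℝ) →₀ ℕ) (z : PolyUpperHalfPlane K),
      (MvPolynomial.map (evalAt K z) P).coeff m ≠ 0 → P.coeff m ≠ 0 := by
    intro m z h1 h2
    rw [MvPolynomial.coeff_map, h2, map_zero] at h1
    exact h1 rfl
  have hdeg : ∀ m, P.coeff m ≠ 0 → ∑ σ, m σ ≤ s := by
    intro m hm
    rw [← hs, ← Finsupp.sum_fintype m (fun _ e => e) (by simp)]
    exact MvPolynomial.le_totalDegree (MvPolynomial.mem_support_iff.mpr hm)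
  obtain ⟨m, hm, hms⟩ : ∃ m, P.coeff m ≠ 0 ∧ ∑ σ, m σ = s := by
    obtain ⟨m, hm, h1⟩ := Finset.exists_mem_eq_sup P.support
      (MvPolynomial.support_nonempty.mpr hP0) (fun m => m.sum fun _ e => e)
    refine ⟨m, MvPolynomial.mem_support_iff.mp hm, ?_⟩
    rw [← hs, MvPolynomial.totalDegree, h1, Finsupp.sum_fintype _ _ (by simp)]
  have hfactor : ∀ (m : (K →+* ℝ) →₀ ℕ) (z) (γ : SL(2, 𝓞 K)), (∏ σ, autFactor γ z σ ^ w σ) *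
      ∏ σ, ((autFactor γ z σ ^ 2)⁻¹) ^ m σ = ∏ σ, autFactor γ z σ ^ (w σ - 2 * m σ) := by
    intro m z γ
    rw [← Finset.prod_mul_distrib]
    refine Finset.prod_congr rfl fun σ _ => ?_
    rw [zpow_sub₀ (autFactor_ne_zero γ z σ), zpow_mul, div_eq_mul_inv, inv_pow, zpow_natCast,
      zpow_ofNat]
  have hmod : ∀ m : (K →+* ℝ) →₀ ℕ, ∑ σ, m σ = s →
      IsModularForm (fun σ => w σ - 2 * m σ) ((P.coeff m : Hol K) : PolyUpperHalfPlane K → ℂ) := by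
    intro m hms
    refine ⟨(P.coeff m).2, fun z γ => ?_⟩
    have h1 := congrArg (MvPolynomial.coeff m) (map_evalAt_act hP z γ)
    rw [hcoeff, MvPolynomial.coeff_C_mul, coeff_aeval_affine_of_forall_le, ← mul_assoc, hfactor,
      hcoeff] at h1
    · exact h1
    · intro r hr hmr
      exact Finsupp.eq_of_le_of_sum_le hmr (by rw [hms]; exact hdeg r (hne r z hr))
  have hsum : ∀ m : (K →+* ℝ) →₀ ℕ, ∑ σ, m σ = s →
      ∑ σ, (w σ - 2 * m σ) = ∑ σ, w σ - 2 * s := by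
    intro m hms
    rw [Finset.sum_sub_distrib, ← Finset.mul_sum, ← hms]; push_cast; rfl
  have hcne : ∀ m, P.coeff m ≠ 0 → ((P.coeff m : Hol K) : PolyUpperHalfPlane K → ℂ) ≠ 0 :=
    fun m hm h => hm (Subtype.ext h)
  have hw := (hmod m hms).weight hK (hcne m hm)
  rw [hsum m hms] at hw
  refine ⟨hw.1, fun hs0 => lt_of_le_of_ne hw.1 fun heq => ?_⟩
  obtain ⟨hwm, c, hc0, hc⟩ := hw.2 heq.symm
  -- `m` is the only multidegree of a top coefficient
  have huniq : ∀ r, P.coeff r ≠ 0 → ∑ σ, r σ = s → r = m := by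
    intro r hr hrs
    have h1 := (hmod r hrs).weight hK (hcne r hr)
    rw [hsum r hrs] at h1
    have h2 := (h1.2 heq.symm).1
    ext σ
    have h3 := congrFun h2 σ
    have h4 := congrFun hwm σ
    simp only [Pi.zero_apply] at h3 h4
    omega
  obtain ⟨j, hj⟩ : ∃ j, m j ≠ 0 := by
    by_contra hcon
    push Not at hcon
    simp only [hcon, Finset.sum_const_zero] at hms
    exact hs0 hms.symm
  obtain ⟨m', rfl⟩ : ∃ m' : (K →+* ℝ) →₀ ℕ, m = m' + Finsupp.single j 1 := by
    refine ⟨m - Finsupp.single j 1, (tsub_add_cancel_of_le ?_).symm⟩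
    rw [Finsupp.single_le_iff]
    omega
  have hms' : ∑ σ, m' σ + 1 = s := by
    rw [← hms]
    simp [Finset.sum_add_distrib, Finsupp.single_apply]
  have hlaw : ∀ (z : PolyUpperHalfPlane K) (γ : SL(2, 𝓞 K)),
      ((P.coeff m' : Hol K) : PolyUpperHalfPlane K → ℂ) (act γ z) = autFactor γ z j ^ 2 *
        (((P.coeff m' : Hol K) : PolyUpperHalfPlane K → ℂ) z +
          ((m' j + 1) * c) * (lowerLeft γ j / autFactor γ z j)) := by
    intro z γ
    have h1 := congrArg (MvPolynomial.coeff m') (map_evalAt_act hP z γ)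
    rw [hcoeff, MvPolynomial.coeff_C_mul, coeff_aeval_affine_of_forall_le_add_single (j := j),
      ← mul_assoc, hfactor, hcoeff, hcoeff, hc] at h1
    · rw [h1, Finset.prod_eq_single j]
      · have h2 := congrFun hwm j
        simp only [Finsupp.add_apply, Finsupp.single_eq_same, Pi.zero_apply] at h2
        have h3 : w j - 2 * m' j = 2 := by push_cast at h2; omega
        rw [h3]
        norm_cast
        ring
      · intro σ _ hσ
        have h2 := congrFun hwm σ
        simp only [Finsupp.add_apply, Finsupp.single_apply, Ne.symm hσ, if_false, add_zero,
          Pi.zero_apply] at h2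
        rw [h2, zpow_zero]
      · simp
    · intro r hr hmr
      have hr' := hne r z hr
      rcases (hdeg r hr').lt_or_eq with hlt | heq'
      · exact Or.inl (Finsupp.eq_of_le_of_sum_le hmr (by omega))
      · exact Or.inr (huniq r hr' heq')
  have := eq_zero_of_quasimodular_weight_two_single hK j (P.coeff m').2 hlaw
  rcases mul_eq_zero.mp this with h | h
  · exact Nat.cast_add_one_ne_zero _ h
  · exact hc0 h

end WeightDepth

/-! ### The filtration by the slope of the depth -/

section Filtration

variable {K : Type*} [Field K] [NumberField K]

variable (K) in
/-- The pairs `(a, m)` of a weight and a multidegree with `|m| ≤ C (|a| - 2 |m|)`, where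
`|a| - 2 |m| ≥ 0`; the last condition makes these submonoids increase with `C`. -/
def slopeSubmonoid (C : ℕ) : AddSubmonoid (((K →+* ℝ) → ℤ) × ((K →+* ℝ) → ℕ)) where
  carrier := {x | 0 ≤ ∑ σ, x.1 σ - 2 * ∑ σ, (x.2 σ : ℤ) ∧
    ∑ σ, (x.2 σ : ℤ) ≤ C * (∑ σ, x.1 σ - 2 * ∑ σ, (x.2 σ : ℤ))}
  zero_mem' := by simp
  add_mem' := by
    rintro x y ⟨hx, hx'⟩ ⟨hy, hy'⟩
    simp only [Set.mem_ofPred_eq, Prod.fst_add, Prod.snd_add, Pi.add_apply, Nat.cast_add,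
      Finset.sum_add_distrib]
    constructor <;> linarith

lemma mem_slopeSubmonoid {C : ℕ} {x : ((K →+* ℝ) → ℤ) × ((K →+* ℝ) → ℕ)} :
    x ∈ slopeSubmonoid K C ↔ 0 ≤ ∑ σ, x.1 σ - 2 * ∑ σ, (x.2 σ : ℤ) ∧
      ∑ σ, (x.2 σ : ℤ) ≤ C * (∑ σ, x.1 σ - 2 * ∑ σ, (x.2 σ : ℤ)) := Iff.rfl

lemma slopeSubmonoid_mono {C D : ℕ} (h : C ≤ D) : slopeSubmonoid K C ≤ slopeSubmonoid K D := by
  rintro x ⟨hx, hx'⟩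
  exact ⟨hx, hx'.trans (mul_le_mul_of_nonneg_right (by exact_mod_cast h) hx)⟩

lemma autMonomial_zero (z : PolyUpperHalfPlane K) : autMonomial z 0 = 1 := by
  ext γ; simp [autMonomial]

lemma autMonomial_add (z : PolyUpperHalfPlane K) (x y : ((K →+* ℝ) → ℤ) × ((K →+* ℝ) → ℕ)) :
    autMonomial z (x + y) = autMonomial z x * autMonomial z y := by
  ext γ
  simp only [autMonomial, Prod.fst_add, Prod.snd_add, Pi.add_apply, Pi.mul_apply,
    zpow_add₀ (autFactor_ne_zero γ z _), pow_add, Finset.prod_mul_distrib]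
  ring

/-- The monomials in the automorphy factors, at the point `z`, with exponents of slope at
most `C`. -/
def autMonomialSubmonoid (C : ℕ) (z : PolyUpperHalfPlane K) : Submonoid (SL(2, 𝓞 K) → ℂ) where
  carrier := autMonomial z '' slopeSubmonoid K C
  one_mem' := ⟨0, zero_mem _, autMonomial_zero z⟩
  mul_mem' := by
    rintro _ _ ⟨x, hx, rfl⟩ ⟨y, hy, rfl⟩
    exact ⟨x + y, add_mem hx hy, autMonomial_add z x y⟩

variable (K) in
/-- The functions `F` on `ℍⁿ` such that, for each `z`, the function `γ ↦ F (γ z)` is a linear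
combination of the monomials `autMonomial z (a, m)` with `(a, m)` of slope at most `C`. -/
def slopeSubalgebra (C : ℕ) : Subalgebra ℂ (PolyUpperHalfPlane K → ℂ) :=
  ⨅ z : PolyUpperHalfPlane K,
    (Algebra.adjoin ℂ (autMonomialSubmonoid C z : Set (SL(2, 𝓞 K) → ℂ))).comap
      (AlgHom.pi (R := ℂ) fun γ : SL(2, 𝓞 K) =>
        Pi.evalAlgHom ℂ (fun _ : PolyUpperHalfPlane K => ℂ) (act γ z))

lemma mem_slopeSubalgebra {C : ℕ} {F : PolyUpperHalfPlane K → ℂ} : F ∈ slopeSubalgebra K C ↔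
    ∀ z, (fun γ : SL(2, 𝓞 K) => F (act γ z)) ∈
      Submodule.span ℂ (autMonomial z '' slopeSubmonoid K C) := by
  rw [slopeSubalgebra, Algebra.mem_iInf]
  refine forall_congr' fun z => ?_
  rw [Subalgebra.mem_comap, ← Subalgebra.mem_toSubmodule, Algebra.adjoin_eq_span,
    Submonoid.closure_eq]
  rfl

lemma slopeSubalgebra_mono {C D : ℕ} (h : C ≤ D) : slopeSubalgebra K C ≤ slopeSubalgebra K D := by
  intro F hF
  rw [mem_slopeSubalgebra] at *
  exact fun z => Submodule.span_mono (Set.image_mono (slopeSubmonoid_mono h)) (hF z)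

variable [NumberField.IsTotallyReal K]

/-- A quasi-modular form of depth `s` has slope at most `s`. -/
lemma IsQuasiModularForm.mem_slopeSubalgebra (hK : 1 < Module.finrank ℚ K)
    {w : (K →+* ℝ) → ℤ} {s : ℕ} {F : PolyUpperHalfPlane K → ℂ} (hF : IsQuasiModularForm w s F) :
    F ∈ slopeSubalgebra K s := by
  classical
  by_cases h0 : F = 0
  · rw [h0]; exact zero_mem _
  obtain ⟨hw, hw'⟩ := hF.two_mul_depth_le hK h0
  obtain ⟨-, P, hs, hP⟩ := hF
  rw [HilbertQuasiModular.mem_slopeSubalgebra]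
  intro z
  have h1 : (fun γ : SL(2, 𝓞 K) => F (act γ z)) =
      ∑ m ∈ P.support, evalAt K z (P.coeff m) • autMonomial z (w, m) := by
    ext γ
    rw [hP, MvPolynomial.eval₂_eq', Finset.sum_apply, Finset.mul_sum]
    refine Finset.sum_congr rfl fun m _ => ?_
    rw [Pi.smul_apply, autMonomial, smul_eq_mul, mul_left_comm]
  rw [h1]
  refine Submodule.sum_mem _ fun m hm => Submodule.smul_mem _ _ (Submodule.subset_span ⟨_, ?_, rfl⟩)
  have hms : ∑ σ, (m σ : ℤ) ≤ s := by
    have := MvPolynomial.le_totalDegree hm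
    rw [hs, Finsupp.sum_fintype _ _ (by simp)] at this
    exact_mod_cast this
  refine mem_slopeSubmonoid.mpr ⟨by simp only; linarith, ?_⟩
  simp only
  rcases Nat.eq_zero_or_pos s with rfl | hs0
  · simpa using hms
  · have := hw' hs0.ne'
    nlinarith

/-- A finitely generated algebra of quasi-modular forms has bounded slope. -/
lemma exists_quasiModularRing_le_slopeSubalgebra (hK : 1 < Module.finrank ℚ K)
    (h : Algebra.FiniteType ℂ (quasiModularRing K)) :
    ∃ C, quasiModularRing K ≤ slopeSubalgebra K C := by
  have hmem : ∀ F ∈ quasiModularRing K, ∃ C, F ∈ slopeSubalgebra K C := by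
    intro F hF
    induction hF using Algebra.adjoin_induction with
    | mem F hF =>
      obtain ⟨w, s, hF⟩ := hF
      exact ⟨s, hF.mem_slopeSubalgebra hK⟩
    | algebraMap c => exact ⟨0, Subalgebra.algebraMap_mem _ c⟩
    | add F G _ _ hF hG =>
      obtain ⟨C, hC⟩ := hF
      obtain ⟨D, hD⟩ := hG
      exact ⟨max C D, add_mem (slopeSubalgebra_mono (le_max_left _ _) hC)
        (slopeSubalgebra_mono (le_max_right _ _) hD)⟩
    | mul F G _ _ hF hG =>
      obtain ⟨C, hC⟩ := hF
      obtain ⟨D, hD⟩ := hG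
      exact ⟨max C D, mul_mem (slopeSubalgebra_mono (le_max_left _ _) hC)
        (slopeSubalgebra_mono (le_max_right _ _) hD)⟩
  obtain ⟨t, ht⟩ := (Subalgebra.fg_iff_finiteType _).mpr h
  have ht' : ∀ F : t, ∃ C, (F : PolyUpperHalfPlane K → ℂ) ∈ slopeSubalgebra K C := fun F =>
    hmem F (by rw [← ht]; exact Algebra.subset_adjoin F.2)
  choose C hC using ht'
  refine ⟨Finset.univ.sup C, ?_⟩
  rw [← ht]
  refine Algebra.adjoin_le fun F hF => ?_
  exact slopeSubalgebra_mono (Finset.le_sup (Finset.mem_univ (⟨F, hF⟩ : t))) (hC ⟨F, hF⟩)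

/-- If the orbit function of an element of `slopeSubalgebra K C` is a linear combination of
monomials with exponents `x j`, then the exponents with nonzero coefficients have slope at
most `C`. -/
lemma mem_slopeSubmonoid_of_mem_slopeSubalgebra {C : ℕ} {F : PolyUpperHalfPlane K → ℂ}
    (hF : F ∈ slopeSubalgebra K C) {z : PolyUpperHalfPlane K} {J : Type*} {s : Finset J}
    {x : J → ((K →+* ℝ) → ℤ) × ((K →+* ℝ) → ℕ)} (hx : Function.Injective x) {c : J → ℂ}
    (h : ∀ γ : SL(2, 𝓞 K), F (act γ z) = ∑ j ∈ s, c j * autMonomial z (x j) γ) {j : J}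
    (hj : j ∈ s) (hc : c j ≠ 0) : x j ∈ slopeSubmonoid K C := by
  classical
  by_contra hcon
  set T : Set (((K →+* ℝ) → ℤ) × ((K →+* ℝ) → ℕ)) := slopeSubmonoid K C ∪ x '' {j}ᶜ with hT
  have hjT : x j ∉ T := by
    rintro (h1 | ⟨i, hi, h1⟩)
    · exact hcon h1
    · exact hi (hx h1)
  refine (linearIndependent_autMonomial z).notMem_span_image hjT ?_
  have h1 : (fun γ : SL(2, 𝓞 K) => F (act γ z)) ∈ Submodule.span ℂ (autMonomial z '' T) :=
    Submodule.span_mono (Set.image_mono Set.subset_union_left) (mem_slopeSubalgebra.mp hF z)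
  have h2 : ∑ i ∈ s.erase j, c i • autMonomial z (x i) ∈ Submodule.span ℂ (autMonomial z '' T) :=
    Submodule.sum_mem _ fun i hi => Submodule.smul_mem _ _ (Submodule.subset_span
      ⟨_, Or.inr ⟨i, Finset.ne_of_mem_erase hi, rfl⟩, rfl⟩)
  have h3 : autMonomial z (x j) = (c j)⁻¹ • ((fun γ : SL(2, 𝓞 K) => F (act γ z)) -
      ∑ i ∈ s.erase j, c i • autMonomial z (x i)) := by
    ext γ
    simp only [Pi.smul_apply, Pi.sub_apply, Finset.sum_apply, smul_eq_mul, h,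
      ← Finset.add_sum_erase s (fun i => c i * autMonomial z (x i) γ) hj]
    field_simp
    ring
  rw [h3]
  exact Submodule.smul_mem _ _ (Submodule.sub_mem _ h1 h2)

end Filtration

/-! ### Pairs of integers modulo units -/

section Pairs

open NumberField InfinitePlace

variable {K : Type*} [Field K]

section
variable [NumberField K] [IsTotallyReal K]

lemma prod_abs_unit (u : (𝓞 K)ˣ) : ∏ σ : K →+* ℝ, |σ (u : 𝓞 K)| = 1 := by
  have h1 := prod_eq_abs_norm ((u : 𝓞 K) : K)
  rw [← RingOfIntegers.coe_norm, isUnit_iff_norm.mp u.isUnit, Rat.cast_one] at h1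
  rw [← h1]
  refine Fintype.prod_bijective placeOf placeOf_bijective _ _ fun τ => ?_
  rw [IsTotallyReal.mult_eq, pow_one, placeOf_apply]

lemma exists_one_le_abs {c : 𝓞 K} (hc : c ≠ 0) : ∃ σ : K →+* ℝ, 1 ≤ |σ c| := by
  by_contra! h
  have hlt : ∀ w : InfinitePlace K, w c < 1 := fun w => by
    obtain ⟨σ, rfl⟩ := placeOf_bijective.2 w
    rw [placeOf_apply]; exact h σ
  have w : InfinitePlace K := Classical.arbitrary _
  exact (hlt w).not_ge (one_le_of_lt_one hc fun z _ => hlt z)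

end

/-- The maximum of the absolute values of the conjugates at `σ` of the entries of a pair. -/
def pairNorm (v : Fin 2 → 𝓞 K) (σ : K →+* ℝ) : ℝ := max |σ (v 0)| |σ (v 1)|

lemma pairNorm_pos {v : Fin 2 → 𝓞 K} (hv : v ≠ 0) (σ : K →+* ℝ) : 0 < pairNorm v σ := by
  obtain ⟨j, hj⟩ := Function.ne_iff.mp hv
  have h1 : 0 < |σ (v j)| := by
    rw [abs_pos]; simpa using hj
  fin_cases j
  · exact lt_max_of_lt_left h1
  · exact lt_max_of_lt_right h1

lemma pairNorm_smul (c : 𝓞 K) (v : Fin 2 → 𝓞 K) (σ : K →+* ℝ) :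
    pairNorm (c • v) σ = |σ c| * pairNorm v σ := by
  simp [pairNorm, abs_mul, mul_max_of_nonneg]

variable (K) in
/-- The relation of being equal up to multiplication by a unit, on the nonzero pairs of
integers. -/
def pairSetoid : Setoid {v : Fin 2 → 𝓞 K // v ≠ 0} where
  r v w := ∃ ε : (𝓞 K)ˣ, w.1 = (ε : 𝓞 K) • v.1
  iseqv :=
    { refl := fun v => ⟨1, by simp⟩
      symm := by
        rintro v w ⟨ε, h⟩
        exact ⟨ε⁻¹, by rw [h, smul_smul, Units.inv_mul, one_smul]⟩
      trans := by
        rintro v w x ⟨ε, h⟩ ⟨ε', h'⟩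
        exact ⟨ε' * ε, by rw [h', h, smul_smul, Units.val_mul]⟩ }

variable (K) in
/-- The nonzero pairs of integers modulo units. -/
abbrev PairClass : Type _ := Quotient (pairSetoid K)

/-- A chosen pair in a class. -/
abbrev PairClass.rep (q : PairClass K) : Fin 2 → 𝓞 K := (Quotient.out q).1

lemma PairClass.rep_ne_zero (q : PairClass K) : q.rep ≠ 0 := (Quotient.out q).2

lemma PairClass.exists_rep_mk (v : {v : Fin 2 → 𝓞 K // v ≠ 0}) :
    ∃ ε : (𝓞 K)ˣ, v.1 = (ε : 𝓞 K) • PairClass.rep (Quotient.mk (pairSetoid K) v) :=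
  Quotient.exact (Quotient.out_eq (Quotient.mk (pairSetoid K) v))

variable (K) in
/-- The conjugates of a pair of integers. -/
def pairConjugates : (Fin 2 → 𝓞 K) →ₗ[ℤ] (Fin 2 → (K →+* ℝ) → ℝ) :=
  AddMonoidHom.toIntLinearMap
    { toFun := fun v j σ => σ (v j)
      map_zero' := by ext; simp
      map_add' := fun v w => by ext; simp }

lemma pairConjugates_apply (v : Fin 2 → 𝓞 K) (j : Fin 2) (σ : K →+* ℝ) :
    pairConjugates K v j σ = σ (v j) := rfl

variable [NumberField K]

variable (K) in
lemma finrank_range_pairConjugates_le :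
    Module.finrank ℤ (LinearMap.range (pairConjugates K)) ≤ 2 * Module.finrank ℚ K := by
  refine (LinearMap.finrank_range_le _).trans (le_of_eq ?_)
  rw [Module.finrank_pi_fintype]
  simp [RingOfIntegers.rank]

variable [IsTotallyReal K]

lemma pairConjugates_injective : Function.Injective (pairConjugates K) := by
  intro v w h
  ext j
  exact (Classical.arbitrary (K →+* ℝ)).injective (congrFun (congrFun h j) _)

instance : DiscreteTopology (LinearMap.range (pairConjugates K)) := by
  refine discreteTopology_of_isOpen_singleton_zero ?_
  have : ({0} : Set (LinearMap.range (pairConjugates K))) = Metric.ball 0 1 := by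
    ext ⟨x, hx⟩
    obtain ⟨v, rfl⟩ := hx
    rw [Set.mem_singleton_iff, mem_ball_zero_iff]
    refine ⟨fun h => by rw [h]; simp, fun h => ?_⟩
    change ‖pairConjugates K v‖ < 1 at h
    by_contra hne
    have hv : v ≠ 0 := by
      rintro rfl
      exact hne (Subtype.ext (map_zero _))
    obtain ⟨j, hj⟩ := Function.ne_iff.mp hv
    obtain ⟨σ, hσ⟩ := exists_one_le_abs hj
    have h1 := (pi_norm_lt_iff one_pos).mp ((pi_norm_lt_iff one_pos).mp h j) σ
    rw [Real.norm_eq_abs, pairConjugates_apply] at h1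
    exact h1.not_ge hσ
  rw [this]
  exact Metric.isOpen_ball

variable (K) in
/-- Balanced representatives of the classes of pairs are distinct points of a lattice of
rank `2 n`, and the summand is at most a constant times the power `-4 n` of their norm. -/
theorem summable_prod_pairNorm :
    Summable fun q : PairClass K => ((∏ σ, pairNorm q.rep σ) ^ 4)⁻¹ := by
  have hn : 0 < Module.finrank ℚ K := Module.finrank_pos
  obtain ⟨C, hC0, hC⟩ := exists_unit_balancing (K := K)
  choose u hu using fun q : PairClass K => hC (pairNorm q.rep) (pairNorm_pos q.rep_ne_zero)
  let x : PairClass K → LinearMap.range (pairConjugates K) := fun q =>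
    ⟨pairConjugates K ((u q : 𝓞 K) • q.rep), LinearMap.mem_range_self _ _⟩
  have hx : Function.Injective x := by
    intro q q' h
    have h1 := pairConjugates_injective (Subtype.ext_iff.mp h)
    rw [← Quotient.out_eq q, ← Quotient.out_eq q']
    refine Quotient.sound ⟨(u q')⁻¹ * u q, ?_⟩
    change q'.rep = _ • q.rep
    rw [Units.val_mul, ← smul_smul, h1, smul_smul, Units.inv_mul, one_smul]
  have hsum := (ZLattice.summable_norm_pow_inv (LinearMap.range (pairConjugates K))
    (4 * Module.finrank ℚ K) ((finrank_range_pairConjugates_le K).trans_lt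
      (by omega))).comp_injective hx
  refine Summable.of_nonneg_of_le (fun q => ?_) (fun q => ?_) (hsum.mul_left (C ^ 4))
  · positivity
  · set P := ∏ σ, pairNorm q.rep σ with hP
    have hP0 : 0 < P := Finset.prod_pos fun σ _ => pairNorm_pos q.rep_ne_zero σ
    have hx0 : 0 < ‖x q‖ := by
      refine norm_pos_iff.mpr fun h => ?_
      have h1 : pairConjugates K ((u q : 𝓞 K) • q.rep) = pairConjugates K 0 := by
        rw [map_zero]; exact Subtype.ext_iff.mp h
      have h2 := pairConjugates_injective h1
      exact q.rep_ne_zero (by simpa using h2)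
    have hle : ‖x q‖ ^ Module.finrank ℚ K ≤ C * P := by
      by_contra! hlt
      have h1 : ‖pairConjugates K ((u q : 𝓞 K) • q.rep)‖ < ‖x q‖ := by
        rw [pi_norm_lt_iff hx0]
        intro j
        rw [pi_norm_lt_iff hx0]
        intro σ
        refine lt_of_pow_lt_pow_left₀ (Module.finrank ℚ K) hx0.le (lt_of_le_of_lt ?_ hlt)
        refine le_trans (pow_le_pow_left₀ (norm_nonneg _) ?_ _) (hu q σ)
        rw [pairConjugates_apply, Real.norm_eq_abs, ← pairNorm_smul, pairNorm]
        fin_cases j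
        · exact le_max_left _ _
        · exact le_max_right _ _
      exact lt_irrefl _ h1
    change (P ^ 4)⁻¹ ≤ C ^ 4 * ‖x q‖⁻¹ ^ (4 * Module.finrank ℚ K)
    rw [mul_comm 4, pow_mul, inv_pow, inv_pow, ← div_eq_mul_inv, inv_eq_one_div,
      div_le_div_iff₀ (by positivity) (by positivity), one_mul, ← mul_pow]
    exact pow_le_pow_left₀ (by positivity) hle 4

end Pairs

/-! ### Quasi-modular Eisenstein series -/

section SeriesOfHolomorphicFunctions

open Metric

/-- A series of holomorphic functions of several variables that is locally dominated by a summable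
series is holomorphic. -/
lemma differentiableOn_tsum_of_locally_le {E α : Type*} [NormedAddCommGroup E] [NormedSpace ℂ E]
    {f : α → E → ℂ} {U : Set E} (hf : ∀ a, DifferentiableOn ℂ (f a) U)
    (hb : ∀ x ∈ U, ∃ r > 0, ball x r ⊆ U ∧ ∃ u : α → ℝ, Summable u ∧
      ∀ a, ∀ y ∈ ball x r, ‖f a y‖ ≤ u a) :
    DifferentiableOn ℂ (fun x => ∑' a, f a x) U := by
  intro x hx
  obtain ⟨r, hr, hrU, u, hu, hfu⟩ := hb x hx
  have hxr : x ∈ ball x (r / 2) := mem_ball_self (by positivity)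
  have hsub : ∀ y ∈ ball x (r / 2), ball y (r / 2) ⊆ ball x r := fun y hy =>
    ball_subset_ball' (by rw [mem_ball] at hy; linarith)
  refine (hasFDerivAt_tsum_of_isPreconnected (f' := fun a y => fderiv ℂ (f a) y) (x₀ := x)
    (s := ball x (r / 2)) (hu.mul_left (2 / (r / 2))) isOpen_ball
    (convex_ball x (r / 2)).isPreconnected (fun a y hy => ?_) (fun a y hy => ?_) hxr
    (hu.of_norm_bounded fun a => hfu a x (mem_ball_self hr))
    hxr).differentiableAt.differentiableWithinAt
  · refine ((hf a).differentiableAt (Filter.mem_of_superset ?_ hrU)).hasFDerivAt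
    exact isOpen_ball.mem_nhds (ball_subset_ball (by linarith) hy)
  · have h1 := Complex.norm_fderiv_le_div_of_mapsTo_ball (R₂ := 2 * u a)
      ((hf a).mono ((hsub y hy).trans hrU)) (fun y' hy' => ?_) (half_pos hr)
    · refine h1.trans (le_of_eq (by ring))
    · rw [mem_closedBall, dist_eq_norm]
      refine (norm_sub_le _ _).trans ?_
      have h2 := hfu a y' (hsub y hy hy')
      have h3 := hfu a y (hsub y hy (mem_ball_self (by positivity)))
      linarith

end SeriesOfHolomorphicFunctions

section Eisenstein

open NumberField

variable {K : Type*} [Field K]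

/-- The value at `w` of the linear form `c_σ w_σ + d_σ` attached to a pair `(c, d)`. -/
def pairForm (v : Fin 2 → 𝓞 K) (w : (K →+* ℝ) → ℂ) (σ : K →+* ℝ) : ℂ :=
  ((σ (v 0) : ℝ) : ℂ) * w σ + ((σ (v 1) : ℝ) : ℂ)

lemma pairForm_smul (c : 𝓞 K) (v : Fin 2 → 𝓞 K) (w : (K →+* ℝ) → ℂ) (σ : K →+* ℝ) :
    pairForm (c • v) w σ = ((σ c : ℝ) : ℂ) * pairForm v w σ := by
  simp only [pairForm, Pi.smul_apply, smul_eq_mul, map_mul]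
  push_cast
  ring

lemma abs_mul_im_le_norm_pairForm (v : Fin 2 → 𝓞 K) {w : (K →+* ℝ) → ℂ} {σ : K →+* ℝ}
    (hw : 0 < (w σ).im) : |σ (v 0)| * (w σ).im ≤ ‖pairForm v w σ‖ := by
  refine le_trans (le_of_eq ?_) (Complex.abs_im_le_norm _)
  simp [pairForm, abs_mul, abs_of_pos hw]

lemma pairNorm_le_mul_norm_pairForm (v : Fin 2 → 𝓞 K) {w : (K →+* ℝ) → ℂ} {σ : K →+* ℝ} {A B : ℝ}
    (hB : 0 < B) (hBw : B ≤ (w σ).im) (hA : ‖w σ‖ ≤ A) :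
    pairNorm v σ ≤ (B⁻¹ + 1 + A / B) * ‖pairForm v w σ‖ := by
  have hA0 : 0 ≤ A := (norm_nonneg _).trans hA
  have h1 : |σ (v 0)| ≤ ‖pairForm v w σ‖ / B := by
    rw [le_div_iff₀ hB]
    exact (mul_le_mul_of_nonneg_left hBw (abs_nonneg _)).trans
      (abs_mul_im_le_norm_pairForm v (hB.trans_le hBw))
  have h2 : |σ (v 1)| ≤ ‖pairForm v w σ‖ + |σ (v 0)| * ‖w σ‖ := by
    have : ((σ (v 1) : ℝ) : ℂ) = pairForm v w σ - ((σ (v 0) : ℝ) : ℂ) * w σ := by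
      rw [pairForm]; ring
    rw [← Real.norm_eq_abs, ← Complex.norm_real, this]
    refine (norm_sub_le _ _).trans (le_of_eq ?_)
    rw [norm_mul, Complex.norm_real, Real.norm_eq_abs]
  have h3 : |σ (v 0)| * ‖w σ‖ ≤ ‖pairForm v w σ‖ / B * A :=
    mul_le_mul h1 hA (norm_nonneg _) (by positivity)
  have h4 : (B⁻¹ + 1 + A / B) * ‖pairForm v w σ‖ =
      ‖pairForm v w σ‖ / B + ‖pairForm v w σ‖ + ‖pairForm v w σ‖ / B * A := by
    field_simp
  have h5 : 0 ≤ ‖pairForm v w σ‖ / B := by positivity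
  have h6 : 0 ≤ ‖pairForm v w σ‖ / B * A := by positivity
  rw [h4]
  exact max_le (by linarith [norm_nonneg (pairForm v w σ)]) (by linarith)

lemma pairForm_ne_zero {v : Fin 2 → 𝓞 K} (hv : v ≠ 0) {w : (K →+* ℝ) → ℂ}
    (hw : w ∈ tube (K →+* ℝ)) (σ : K →+* ℝ) : pairForm v w σ ≠ 0 := by
  intro h
  have h1 := pairNorm_le_mul_norm_pairForm v (hw σ) le_rfl le_rfl
  rw [h, norm_zero, mul_zero] at h1
  exact h1.not_gt (pairNorm_pos hv σ)

variable [NumberField K]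

/-- The summand of the Eisenstein series of weight `4 + 2 N e_{σ₀}` attached to a pair. -/
def eisTerm (σ₀ : K →+* ℝ) (N : ℕ) (v : Fin 2 → 𝓞 K) (w : (K →+* ℝ) → ℂ) : ℂ :=
  (((σ₀ (v 0) : ℝ) : ℂ) / pairForm v w σ₀) ^ N * ((∏ σ, pairForm v w σ) ^ 4)⁻¹

lemma differentiableOn_eisTerm (σ₀ : K →+* ℝ) (N : ℕ) {v : Fin 2 → 𝓞 K} (hv : v ≠ 0) :
    DifferentiableOn ℂ (eisTerm σ₀ N v) (tube (K →+* ℝ)) := by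
  have h1 : ∀ σ : K →+* ℝ, DifferentiableOn ℂ (fun w => pairForm v w σ) (tube (K →+* ℝ)) := by
    intro σ; unfold pairForm; fun_prop
  have h2 : ∀ s : Finset (K →+* ℝ), DifferentiableOn ℂ (fun w => ∏ σ ∈ s, pairForm v w σ)
      (tube (K →+* ℝ)) := by
    classical
    intro s
    induction s using Finset.induction_on with
    | empty => simp only [Finset.prod_empty]; exact differentiableOn_const _
    | insert σ s hσ hs => simp only [Finset.prod_insert hσ]; exact (h1 σ).mul hs
  unfold eisTerm
  simp only [div_eq_mul_inv]
  refine DifferentiableOn.mul (DifferentiableOn.pow (DifferentiableOn.mul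
    (differentiableOn_const _) ((h1 σ₀).inv fun w hw => pairForm_ne_zero hv hw _)) N)
    (DifferentiableOn.inv ((h2 Finset.univ).pow 4) fun w hw => ?_)
  exact pow_ne_zero _ (Finset.prod_ne_zero_iff.mpr fun σ _ => pairForm_ne_zero hv hw σ)

lemma norm_eisTerm_le (σ₀ : K →+* ℝ) (N : ℕ) {v : Fin 2 → 𝓞 K} (hv : v ≠ 0)
    {w : (K →+* ℝ) → ℂ} {A B : ℝ} (hB : 0 < B) (hBw : ∀ σ, B ≤ (w σ).im) (hA : ∀ σ, ‖w σ‖ ≤ A) :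
    ‖eisTerm σ₀ N v w‖ ≤ B⁻¹ ^ N * ((B⁻¹ + 1 + A / B) ^ Fintype.card (K →+* ℝ)) ^ 4 *
      ((∏ σ, pairNorm v σ) ^ 4)⁻¹ := by
  have hw : w ∈ tube (K →+* ℝ) := fun σ => hB.trans_le (hBw σ)
  have hA0 : 0 ≤ A := (norm_nonneg _).trans (hA σ₀)
  have hform : ∀ σ, 0 < ‖pairForm v w σ‖ := fun σ => norm_pos_iff.mpr (pairForm_ne_zero hv hw σ)
  have h1 : ‖((σ₀ (v 0) : ℝ) : ℂ) / pairForm v w σ₀‖ ≤ B⁻¹ := by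
    rw [norm_div, Complex.norm_real, Real.norm_eq_abs, div_le_iff₀ (hform σ₀), le_inv_mul_iff₀ hB,
      mul_comm]
    exact (mul_le_mul_of_nonneg_left (hBw σ₀) (abs_nonneg _)).trans
      (abs_mul_im_le_norm_pairForm v (hw σ₀))
  have h2 : ∏ σ, pairNorm v σ ≤
      (B⁻¹ + 1 + A / B) ^ Fintype.card (K →+* ℝ) * ∏ σ, ‖pairForm v w σ‖ := by
    rw [← Finset.card_univ, ← Finset.prod_const, ← Finset.prod_mul_distrib]
    exact Finset.prod_le_prod (fun σ _ => (pairNorm_pos hv σ).le) fun σ _ =>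
      pairNorm_le_mul_norm_pairForm v hB (hBw σ) (hA σ)
  have h3 : 0 < ∏ σ, pairNorm v σ := Finset.prod_pos fun σ _ => pairNorm_pos hv σ
  have h4 : 0 < ∏ σ, ‖pairForm v w σ‖ := Finset.prod_pos fun σ _ => hform σ
  rw [eisTerm, norm_mul, norm_pow, norm_inv, norm_pow, norm_prod, mul_assoc]
  refine mul_le_mul (pow_le_pow_left₀ (norm_nonneg _) h1 _) ?_ (by positivity) (by positivity)
  rw [← div_eq_mul_inv, le_div_iff₀ (by positivity), inv_mul_le_iff₀ (by positivity), ← mul_pow,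
    mul_comm (∏ σ, ‖pairForm v w σ‖)]
  exact pow_le_pow_left₀ h3.le h2 4

variable [IsTotallyReal K]

lemma eisTerm_unit_smul (σ₀ : K →+* ℝ) (N : ℕ) (ε : (𝓞 K)ˣ) (v : Fin 2 → 𝓞 K)
    (w : (K →+* ℝ) → ℂ) : eisTerm σ₀ N ((ε : 𝓞 K) • v) w = eisTerm σ₀ N v w := by
  have h1 : (∏ σ : K →+* ℝ, ((σ (ε : 𝓞 K) : ℝ) : ℂ)) ^ 4 = 1 := by
    rw [← Complex.ofReal_prod, ← Complex.ofReal_pow, ← Even.pow_abs (by decide : Even 4),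
      Finset.abs_prod, prod_abs_unit, one_pow, Complex.ofReal_one]
  have h2 : ((σ₀ (ε : 𝓞 K) : ℝ) : ℂ) ≠ 0 := by
    exact_mod_cast (map_ne_zero σ₀).mpr (by simp)
  simp only [eisTerm, pairForm_smul, Finset.prod_mul_distrib, mul_pow, h1, one_mul]
  congr 2
  simp only [Pi.smul_apply, smul_eq_mul, map_mul, Complex.ofReal_mul]
  rw [mul_div_mul_left _ _ h2]

/-- The Eisenstein series `∑ (c_{σ₀} / (c_{σ₀} z_{σ₀} + d_{σ₀})) ^ N * ∏ (c_σ z_σ + d_σ) ^ (-4)`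
over the nonzero pairs `(c, d)` of integers modulo units. -/
def eisenstein (σ₀ : K →+* ℝ) (N : ℕ) (z : PolyUpperHalfPlane K) : ℂ :=
  ∑' q : PairClass K, eisTerm σ₀ N q.rep (fun σ => z σ)

lemma summable_eisTerm (σ₀ : K →+* ℝ) (N : ℕ) (z : PolyUpperHalfPlane K) :
    Summable fun q : PairClass K => eisTerm σ₀ N q.rep (fun σ => z σ) := by
  obtain ⟨B, hB0, hB⟩ : ∃ B > 0, ∀ σ, B ≤ (z σ).im := by
    obtain ⟨σ, hσ⟩ := Finite.exists_min (fun σ => (z σ).im)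
    exact ⟨_, (z σ).im_pos, hσ⟩
  obtain ⟨A, hA⟩ := (Set.finite_range (fun σ => ‖(z σ : ℂ)‖)).bddAbove
  exact ((summable_prod_pairNorm K).mul_left _).of_norm_bounded fun q =>
    norm_eisTerm_le σ₀ N q.rep_ne_zero hB0 hB fun σ => hA ⟨σ, rfl⟩

lemma eisenstein_mem_Hol (σ₀ : K →+* ℝ) (N : ℕ) : eisenstein σ₀ N ∈ Hol K := by
  rw [mem_Hol_iff]
  have h1 : DifferentiableOn ℂ (fun w => ∑' q : PairClass K, eisTerm σ₀ N q.rep w)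
      (tube (K →+* ℝ)) := by
    refine differentiableOn_tsum_of_locally_le
      (fun q => differentiableOn_eisTerm σ₀ N q.rep_ne_zero) fun x hx => ?_
    obtain ⟨B, hB0, hB⟩ : ∃ B > 0, ∀ σ, B ≤ (x σ).im := by
      obtain ⟨σ, hσ⟩ := Finite.exists_min (fun σ => (x σ).im)
      exact ⟨_, hx σ, hσ⟩
    have him : ∀ y ∈ Metric.ball x (B / 2), ∀ σ, B / 2 ≤ (y σ).im := by
      intro y hy σ
      have h2 : ‖y σ - x σ‖ ≤ B / 2 := by
        rw [mem_ball_iff_norm] at hy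
        exact (norm_le_pi_norm (y - x) σ).trans hy.le
      have h3 := (abs_le.mp ((Complex.abs_im_le_norm _).trans h2)).1
      rw [Complex.sub_im] at h3
      linarith [hB σ]
    refine ⟨B / 2, half_pos hB0, fun y hy σ => (half_pos hB0).trans_le (him y hy σ), _,
      (summable_prod_pairNorm K).mul_left _, fun q y hy =>
      norm_eisTerm_le σ₀ N q.rep_ne_zero (half_pos hB0) (him y hy) (A := ‖x‖ + B / 2) fun σ => ?_⟩
    refine (norm_le_pi_norm y σ).trans ?_
    rw [mem_ball_iff_norm] at hy
    have := norm_add_le x (y - x)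
    rw [add_sub_cancel] at this
    linarith
  refine h1.congr fun w hw => ?_
  simp only [eisenstein, UpperHalfPlane.ofComplex_apply_of_im_pos (hw _)]

end Eisenstein

section EisensteinTransformation

open NumberField

variable {K : Type*} [Field K]

open Matrix in
lemma pairForm_act (v : Fin 2 → 𝓞 K) (γ : SL(2, 𝓞 K)) (z : PolyUpperHalfPlane K) (σ : K →+* ℝ) :
    pairForm v (fun σ => act γ z σ) σ =
      pairForm (v ᵥ* γ.1) (fun σ => z σ) σ / autFactor γ z σ := by
  have h0 := autFactor_ne_zero γ z σ
  have h1 : autFactor γ z σ = ((σ (γ 1 0 : K) : ℝ) : ℂ) * z σ + ((σ (γ 1 1 : K) : ℝ) : ℂ) := rfl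
  simp only [pairForm, act_apply_coe, vecMul, dotProduct, Fin.sum_univ_two]
  field_simp
  rw [h1]
  push_cast
  simp only [map_add, map_mul]
  push_cast
  ring

open Matrix in
lemma div_pairForm_act {v : Fin 2 → 𝓞 K} (hv : v ≠ 0) (γ : SL(2, 𝓞 K))
    (z : PolyUpperHalfPlane K) (σ : K →+* ℝ) :
    ((σ (v 0) : ℝ) : ℂ) / pairForm v (fun σ => act γ z σ) σ = autFactor γ z σ ^ 2 *
      (-(lowerLeft γ σ / autFactor γ z σ) +
        ((σ ((v ᵥ* γ.1) 0) : ℝ) : ℂ) / pairForm (v ᵥ* γ.1) (fun σ => z σ) σ) := by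
  have h0 := autFactor_ne_zero γ z σ
  have h1 : pairForm (v ᵥ* γ.1) (fun σ => (z σ : ℂ)) σ ≠ 0 := by
    have h2 := pairForm_ne_zero hv (w := fun σ => (act γ z σ : ℂ))
      (fun σ => (act γ z σ).im_pos) σ
    rw [pairForm_act] at h2
    exact fun h => h2 (by rw [h, zero_div])
  have hdet : ((σ ((γ 0 0 : 𝓞 K) : K) : ℝ) : ℂ) * ((σ (γ 1 1 : K) : ℝ) : ℂ) -
      ((σ (γ 0 1 : K) : ℝ) : ℂ) * ((σ (γ 1 0 : K) : ℝ) : ℂ) = 1 := by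
    have := γ.det_coe
    rw [Matrix.det_fin_two] at this
    have := congrArg (fun x : 𝓞 K => ((σ (x : K) : ℝ) : ℂ)) this
    simpa using this
  have h2 : ((σ ((v ᵥ* γ.1) 0) : ℝ) : ℂ) * autFactor γ z σ -
      lowerLeft γ σ * pairForm (v ᵥ* γ.1) (fun σ => z σ) σ = ((σ (v 0) : ℝ) : ℂ) := by
    simp only [pairForm, autFactor, lowerLeft, vecMul, dotProduct, Fin.sum_univ_two]
    push_cast
    simp only [map_add, map_mul]
    push_cast
    linear_combination ((σ (v 0) : ℝ) : ℂ) * hdet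
  rw [pairForm_act, ← h2]
  field_simp
  ring

/-- The right action of an element of the Hilbert modular group on the pairs of integers. -/
def pairEquiv (γ : SL(2, 𝓞 K)) : (Fin 2 → 𝓞 K) ≃ (Fin 2 → 𝓞 K) where
  toFun v := Matrix.vecMul v γ.1
  invFun v := Matrix.vecMul v (γ⁻¹).1
  left_inv v := by
    change Matrix.vecMul (Matrix.vecMul v (γ : Matrix (Fin 2) (Fin 2) (𝓞 K)))
      ((γ⁻¹ : SL(2, 𝓞 K)) : Matrix (Fin 2) (Fin 2) (𝓞 K)) = v
    rw [Matrix.vecMul_vecMul, ← Matrix.SpecialLinearGroup.coe_mul, mul_inv_cancel,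
      Matrix.SpecialLinearGroup.coe_one, Matrix.vecMul_one]
  right_inv v := by
    change Matrix.vecMul (Matrix.vecMul v ((γ⁻¹ : SL(2, 𝓞 K)) : Matrix (Fin 2) (Fin 2) (𝓞 K)))
      (γ : Matrix (Fin 2) (Fin 2) (𝓞 K)) = v
    rw [Matrix.vecMul_vecMul, ← Matrix.SpecialLinearGroup.coe_mul, inv_mul_cancel,
      Matrix.SpecialLinearGroup.coe_one, Matrix.vecMul_one]

lemma pairEquiv_apply (γ : SL(2, 𝓞 K)) (v : Fin 2 → 𝓞 K) :
    pairEquiv γ v = Matrix.vecMul v γ.1 := rfl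

lemma pairEquiv_ne_zero_iff (γ : SL(2, 𝓞 K)) (v : Fin 2 → 𝓞 K) : v ≠ 0 ↔ pairEquiv γ v ≠ 0 := by
  rw [not_iff_not, ← (pairEquiv γ).apply_eq_iff_eq, pairEquiv_apply γ 0, Matrix.zero_vecMul]

/-- The right action of an element of the Hilbert modular group on the nonzero pairs of integers
modulo units. -/
def pairClassEquiv (γ : SL(2, 𝓞 K)) : PairClass K ≃ PairClass K :=
  Quotient.congr ((pairEquiv γ).subtypeEquiv (pairEquiv_ne_zero_iff γ)) (by
    rintro v w
    refine exists_congr fun ε => ?_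
    change w.1 = _ ↔ pairEquiv γ w.1 = _ • pairEquiv γ v.1
    rw [pairEquiv_apply γ v.1, ← Matrix.smul_vecMul, ← pairEquiv_apply,
      (pairEquiv γ).apply_eq_iff_eq])

lemma exists_vecMul_rep (γ : SL(2, 𝓞 K)) (q : PairClass K) :
    ∃ ε : (𝓞 K)ˣ, Matrix.vecMul q.rep γ.1 = (ε : 𝓞 K) • (pairClassEquiv γ q).rep := by
  have h : ∀ q : PairClass K, ∀ v : {v : Fin 2 → 𝓞 K // v ≠ 0}, Quotient.mk (pairSetoid K) v = q →
      ∃ ε : (𝓞 K)ˣ, v.1 = (ε : 𝓞 K) • q.rep := by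
    rintro _ v rfl; exact PairClass.exists_rep_mk v
  refine h (pairClassEquiv γ q) ⟨Matrix.vecMul q.rep γ.1,
    (pairEquiv_ne_zero_iff γ _).mp q.rep_ne_zero⟩ ?_
  conv_rhs => rw [← Quotient.out_eq q]
  rfl

variable [NumberField K]

lemma eisTerm_act (σ₀ : K →+* ℝ) (N : ℕ) {v : Fin 2 → 𝓞 K} (hv : v ≠ 0) (γ : SL(2, 𝓞 K))
    (z : PolyUpperHalfPlane K) : eisTerm σ₀ N v (fun σ => act γ z σ) =
      (∏ σ, autFactor γ z σ) ^ 4 * autFactor γ z σ₀ ^ (2 * N) *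
        ∑ j ∈ Finset.range (N + 1), (-(lowerLeft γ σ₀ / autFactor γ z σ₀)) ^ j * N.choose j *
          eisTerm σ₀ (N - j) (Matrix.vecMul v γ.1) (fun σ => z σ) := by
  rw [eisTerm, div_pairForm_act hv, mul_pow, ← pow_mul, add_pow, Finset.mul_sum, Finset.sum_mul,
    Finset.mul_sum]
  refine Finset.sum_congr rfl fun j _ => ?_
  simp only [eisTerm, pairForm_act, Finset.prod_div_distrib, div_pow, inv_div]
  ring

/-- The weight `4 + 2 N e_{σ₀}` of the Eisenstein series `eisenstein σ₀ N`. -/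
def eisWeight (σ₀ : K →+* ℝ) (N : ℕ) : (K →+* ℝ) → ℤ :=
  open Classical in fun σ => 4 + if σ = σ₀ then 2 * (N : ℤ) else 0

lemma prod_zpow_eisWeight (σ₀ : K →+* ℝ) (N : ℕ) {u : (K →+* ℝ) → ℂ} (hu : ∀ σ, u σ ≠ 0) :
    ∏ σ, u σ ^ eisWeight σ₀ N σ = (∏ σ, u σ) ^ 4 * u σ₀ ^ (2 * N) := by
  classical
  simp only [eisWeight, zpow_add₀ (hu _), Finset.prod_mul_distrib]
  congr 1
  · rw [← Finset.prod_pow]; rfl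
  · rw [Finset.prod_eq_single σ₀ (fun σ _ h => by simp [h]) (by simp), if_pos rfl]
    norm_cast

open Classical in
lemma sum_eisWeight (σ₀ : K →+* ℝ) (N : ℕ) :
    ∑ σ, eisWeight σ₀ N σ = 4 * Fintype.card (K →+* ℝ) + 2 * N := by
  simp only [eisWeight, Finset.sum_add_distrib]
  rw [Finset.sum_eq_single (f := fun σ => if σ = σ₀ then 2 * (N : ℤ) else 0) σ₀
    (fun σ _ h => if_neg h) (by simp), if_pos rfl]
  simp [mul_comm]

variable [IsTotallyReal K]

/-- The transformation law of the Eisenstein series of weight `4 + 2 N e_{σ₀}`. -/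
theorem eisenstein_act (σ₀ : K →+* ℝ) (N : ℕ) (γ : SL(2, 𝓞 K)) (z : PolyUpperHalfPlane K) :
    eisenstein σ₀ N (act γ z) = (∏ σ, autFactor γ z σ) ^ 4 * autFactor γ z σ₀ ^ (2 * N) *
      ∑ j ∈ Finset.range (N + 1), (-(lowerLeft γ σ₀ / autFactor γ z σ₀)) ^ j * N.choose j *
        eisenstein σ₀ (N - j) z := by
  have h1 : ∀ (j : ℕ) (q : PairClass K),
      eisTerm σ₀ j (Matrix.vecMul q.rep γ.1) (fun σ => z σ) =
      eisTerm σ₀ j (pairClassEquiv γ q).rep (fun σ => z σ) := by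
    intro j q
    obtain ⟨ε, hε⟩ := exists_vecMul_rep γ q
    rw [hε, eisTerm_unit_smul]
  have h3 : eisenstein σ₀ N (act γ z) = ∑' q : PairClass K, (∏ σ, autFactor γ z σ) ^ 4 *
      autFactor γ z σ₀ ^ (2 * N) * ∑ j ∈ Finset.range (N + 1),
        (-(lowerLeft γ σ₀ / autFactor γ z σ₀)) ^ j * N.choose j *
          eisTerm σ₀ (N - j) (pairClassEquiv γ q).rep (fun σ => z σ) := by
    refine tsum_congr fun q => ?_
    rw [eisTerm_act σ₀ N q.rep_ne_zero]
    simp only [h1]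
  rw [h3]
  have h2 : ∀ j, HasSum (fun q : PairClass K =>
      eisTerm σ₀ j (pairClassEquiv γ q).rep (fun σ => z σ)) (eisenstein σ₀ j z) := fun j =>
    (Equiv.hasSum_iff (f := fun q : PairClass K => eisTerm σ₀ j q.rep (fun σ => z σ))
      (pairClassEquiv γ)).mpr (summable_eisTerm σ₀ j z).hasSum
  exact ((hasSum_sum fun j _ => (h2 (N - j)).mul_left _).mul_left _).tsum_eq

lemma isQuasiModularForm_eisenstein (σ₀ : K →+* ℝ) (N : ℕ) :
    ∃ s, IsQuasiModularForm (eisWeight σ₀ N) s (eisenstein σ₀ N) := by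
  refine ⟨_, eisenstein_mem_Hol σ₀ N, ∑ j ∈ Finset.range (N + 1),
    MvPolynomial.C (algebraMap ℂ (Hol K) ((-1) ^ j * N.choose j) *
      ⟨eisenstein σ₀ (N - j), eisenstein_mem_Hol σ₀ (N - j)⟩) * MvPolynomial.X σ₀ ^ j, rfl,
    fun z γ => ?_⟩
  rw [eisenstein_act, prod_zpow_eisWeight σ₀ N (autFactor_ne_zero γ z), MvPolynomial.eval₂_sum]
  congr 1
  refine Finset.sum_congr rfl fun j _ => ?_
  rw [MvPolynomial.eval₂_mul, MvPolynomial.eval₂_C, MvPolynomial.eval₂_pow, MvPolynomial.eval₂_X,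
    map_mul]
  change _ = ((-1) ^ j * N.choose j : ℂ) * eisenstein σ₀ (N - j) z * _
  rw [neg_pow]
  ring

open Filter Topology in
/-- As `z → i ∞` along the diagonal of the imaginary axis, the terms with `c ≠ 0` of the
Eisenstein series of weight `4` disappear, and the others are positive. -/
theorem exists_eisenstein_zero_ne_zero (σ₀ : K →+* ℝ) :
    ∃ z : PolyUpperHalfPlane K, eisenstein σ₀ 0 z ≠ 0 := by
  classical
  let g : PairClass K → ℝ := fun q =>
    if q.rep 0 = 0 then ((∏ σ : K →+* ℝ, (σ (q.rep 1) : ℝ)) ^ 4)⁻¹ else 0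
  let Z : ℕ → (K →+* ℝ) → ℂ := fun T _ => (((T : ℝ) + 1 : ℝ) : ℂ) * Complex.I
  have hZ : ∀ T σ, (Z T σ).im = T + 1 := by intro T σ; simp [Z]
  have hZ0 : ∀ T σ, 0 < (Z T σ).im := by intro T σ; rw [hZ T σ]; positivity
  have hform : ∀ (v : Fin 2 → 𝓞 K) T σ, pairNorm v σ ≤ ‖pairForm v (Z T) σ‖ := by
    intro v T σ
    refine max_le ?_ ?_
    · refine le_trans ?_ (abs_mul_im_le_norm_pairForm v (hZ0 T σ))
      rw [hZ T σ]
      exact le_mul_of_one_le_right (abs_nonneg _) (by linarith [T.cast_nonneg (α := ℝ)])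
    · refine le_trans (le_of_eq ?_) (Complex.abs_re_le_norm _)
      simp [pairForm, Z]
  have hbound : ∀ T (q : PairClass K),
      ‖eisTerm σ₀ 0 q.rep (Z T)‖ ≤ ((∏ σ, pairNorm q.rep σ) ^ 4)⁻¹ := by
    intro T q
    rw [eisTerm, pow_zero, one_mul, norm_inv, norm_pow, norm_prod]
    have h1 : 0 < ∏ σ, pairNorm q.rep σ := Finset.prod_pos fun σ _ => pairNorm_pos q.rep_ne_zero σ
    refine inv_anti₀ (by positivity) (pow_le_pow_left₀ h1.le ?_ 4)
    exact Finset.prod_le_prod (fun σ _ => (pairNorm_pos q.rep_ne_zero σ).le) fun σ _ => hform _ T σ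
  have hlim : ∀ q : PairClass K,
      Tendsto (fun T => eisTerm σ₀ 0 q.rep (Z T)) atTop (𝓝 ((g q : ℝ) : ℂ)) := by
    intro q
    by_cases hq : q.rep 0 = 0
    · refine tendsto_const_nhds.congr fun T => ?_
      simp [g, hq, eisTerm, pairForm]
    · simp only [g, if_neg hq, Complex.ofReal_zero]
      have h1 : 0 < ∏ σ : K →+* ℝ, |σ (q.rep 0)| := Finset.prod_pos fun σ _ => by
        rw [abs_pos]; simpa using hq
      have hn : Fintype.card (K →+* ℝ) * 4 ≠ 0 := by
        simp [Fintype.card_ne_zero]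
      have h2 : Tendsto (fun T : ℕ => ((∏ σ : K →+* ℝ, |σ (q.rep 0)|) ^ 4)⁻¹ *
          (((T : ℝ) + 1) ^ (Fintype.card (K →+* ℝ) * 4))⁻¹) atTop
          (𝓝 (((∏ σ : K →+* ℝ, |σ (q.rep 0)|) ^ 4)⁻¹ * 0)) :=
        ((tendsto_pow_atTop hn).comp (tendsto_atTop_add_const_right _ 1
          tendsto_natCast_atTop_atTop)).inv_tendsto_atTop.const_mul _
      rw [mul_zero] at h2
      refine squeeze_zero_norm (fun T => ?_) h2
      rw [eisTerm, pow_zero, one_mul, norm_inv, norm_pow, norm_prod, ← mul_inv, pow_mul, ← mul_pow,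
        ← Finset.card_univ, ← Finset.prod_const, ← Finset.prod_mul_distrib]
      have h3 : 0 < ∏ σ : K →+* ℝ, |σ (q.rep 0)| * ((T : ℝ) + 1) := by
        rw [Finset.prod_mul_distrib]; positivity
      refine inv_anti₀ (by positivity) (pow_le_pow_left₀ h3.le ?_ 4)
      refine Finset.prod_le_prod (fun σ _ => by positivity) fun σ _ => ?_
      rw [← hZ T σ]
      exact abs_mul_im_le_norm_pairForm _ (hZ0 T σ)
  have htend := tendsto_tsum_of_dominated_convergence (summable_prod_pairNorm K) hlim
    (Eventually.of_forall hbound)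
  have hg0 : ∀ q, 0 ≤ g q := by
    intro q
    simp only [g]
    split_ifs
    · exact inv_nonneg.mpr (Even.pow_nonneg (by decide) _)
    · exact le_rfl
  have hgs : Summable g := (summable_prod_pairNorm K).of_nonneg_of_le hg0 fun q => by
    have := le_of_tendsto (hlim q).norm (Eventually.of_forall fun T => hbound T q)
    rwa [Complex.norm_real, Real.norm_of_nonneg (hg0 q)] at this
  obtain ⟨q₁, hq₁⟩ : ∃ q, 0 < g q := by
    let v : {v : Fin 2 → 𝓞 K // v ≠ 0} := ⟨![0, 1], fun h => by simpa using congrFun h 1⟩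
    refine ⟨Quotient.mk (pairSetoid K) v, ?_⟩
    obtain ⟨ε, hε⟩ := PairClass.exists_rep_mk v
    have h0 := congrFun hε 0
    have h1 := congrFun hε 1
    simp only [v, Matrix.cons_val_zero, Matrix.cons_val_one, Pi.smul_apply, smul_eq_mul] at h0 h1
    have h2 : PairClass.rep (Quotient.mk (pairSetoid K) v) 0 = 0 := by
      simpa using h0.symm
    have h3 : PairClass.rep (Quotient.mk (pairSetoid K) v) 1 ≠ 0 := by
      intro h; rw [h, mul_zero] at h1; exact one_ne_zero h1
    simp only [g, if_pos h2]
    refine inv_pos.mpr (Even.pow_pos (by decide) (Finset.prod_ne_zero_iff.mpr fun σ _ => ?_))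
    simpa using h3
  have hpos : 0 < ∑' q, g q := hgs.tsum_pos hg0 q₁ hq₁
  rw [← Complex.ofReal_tsum] at htend
  have hne : ((∑' q, g q : ℝ) : ℂ) ≠ 0 := by exact_mod_cast hpos.ne'
  obtain ⟨T, hT⟩ := (htend.eventually_ne hne).exists
  exact ⟨fun σ => ⟨Z T σ, hZ0 T σ⟩, hT⟩

end EisensteinTransformation

end HilbertQuasiModular

end

open HilbertQuasiModular in
theorem mainTheorem5 (K : Type*) [Field K] [NumberField K] [NumberField.IsTotallyReal K]
    (hK : 1 < Module.finrank ℚ K) :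
    ¬ Algebra.FiniteType ℂ (HilbertQuasiModular.quasiModularRing K) := by
  classical
  intro hfin
  obtain ⟨C, hC⟩ := exists_quasiModularRing_le_slopeSubalgebra hK hfin
  let σ₀ : K →+* ℝ := Classical.arbitrary _
  obtain ⟨z, hz⟩ := exists_eisenstein_zero_ne_zero σ₀
  -- the slope of the exponent `(4 + 2 N e_{σ₀}, N e_{σ₀})` is `N / (4 n)`, which exceeds `C`
  set N : ℕ := C * (4 * Fintype.card (K →+* ℝ)) + 1 with hN
  obtain ⟨s, hs⟩ := isQuasiModularForm_eisenstein σ₀ N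
  have hmem : eisenstein σ₀ N ∈ slopeSubalgebra K C := hC (Algebra.subset_adjoin ⟨_, _, hs⟩)
  have hinj : Function.Injective fun j : ℕ => (eisWeight σ₀ N, (Pi.single σ₀ j : (K →+* ℝ) → ℕ)) :=
    fun j j' h => Pi.single_injective σ₀ (Prod.ext_iff.mp h).2
  have hexp : ∀ γ, eisenstein σ₀ N (act γ z) = ∑ j ∈ Finset.range (N + 1),
      ((-1) ^ j * N.choose j * eisenstein σ₀ (N - j) z) *
        autMonomial z (eisWeight σ₀ N, (Pi.single σ₀ j : (K →+* ℝ) → ℕ)) γ := by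
    intro γ
    rw [eisenstein_act, ← prod_zpow_eisWeight σ₀ N (autFactor_ne_zero γ z), Finset.mul_sum]
    refine Finset.sum_congr rfl fun j _ => ?_
    have h1 : ∏ σ, (lowerLeft γ σ / autFactor γ z σ) ^ (Pi.single σ₀ j : (K →+* ℝ) → ℕ) σ =
        (lowerLeft γ σ₀ / autFactor γ z σ₀) ^ j := by
      rw [Finset.prod_eq_single σ₀ (fun σ _ h => by simp [h]) (by simp), Pi.single_eq_same]
    rw [autMonomial, h1, neg_pow]
    ring
  have hslope := mem_slopeSubmonoid_of_mem_slopeSubalgebra hmem hinj hexp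
    (Finset.self_mem_range_succ N) (by
      rw [Nat.choose_self, Nat.sub_self, Nat.cast_one, mul_one]
      exact mul_ne_zero (pow_ne_zero _ (neg_ne_zero.mpr one_ne_zero)) hz)
  obtain ⟨-, hle⟩ := mem_slopeSubmonoid.mp hslope
  have hsum : ∑ σ, ((Pi.single σ₀ N : (K →+* ℝ) → ℕ) σ : ℤ) = N := by
    rw [Finset.sum_eq_single σ₀ (fun σ _ h => by simp [h]) (by simp), Pi.single_eq_same]
  simp only [hsum, sum_eisWeight] at hle
  rw [add_sub_cancel_right, hN] at hle
  push_cast at hle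
  linarith
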